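/- Let $V:\mathbb R^2\to\mathbb R$ satisfy $0\le V\in L^\infty_{loc}(\mathbb R^2)$ and $V(x)\to\infty$ as $|x|\to\infty$. Let $\mathcal H=\{u\in H^1(\mathbb R^2;\mathbb R):\int_{\mathbb R^2} V|u|^2dx<\infty\}$ and $\mathcal M=\{u\in\mathcal H:\int_{\mathbb R^2}|u|^2dx=1\}$. For $a\ge 0$ put $$E_a(u)=\int_{\mathbb R^2}\big(|\nabla u|^2+V|u|^2\big)dx-\frac a2\int_{\mathbb R^2}|u|^4dx,\qquad e(a)=\inf_{u\in\mathcal M}E_a(u),$$ and let $\Lambda_a$ be the set of minimizers of $E_a$ on $\mathcal M$. Let $a^*$ be the critical value for the existence of minimizers, that is, the supremum of those $a\ge0$ for which $\Lambda_a\ne\emptyset$, and let $a_*$ be the supremum of those $l>0$ such that $e(a)$ has a unique positive minimizer for every $a\in[0,l)$. For $\mu\in\mathbb R$ put $$J_{a,\mu}(u)=\frac12\int_{\mathbb R^2}\big(|\nabla u|^2+(V-\mu)|u|^2\big)dx-\frac a4\int_{\mathbb R^2}|u|^4dx,\qquad u\in\mathcal H,$$ let $S_{a,\mu}$ be the set of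 nontrivial weak solutions $u\in\mathcal H\setminus\{0\}$ of the Gross–Pitaevskii (GP) equation $$-\Delta u+Vu=\mu u+a|u|^2u\quad\text{in }\mathbb R^2$$ (that is, $\langle J_{a,\mu}'(u),\varphi\rangle=0$ for all $\varphi\in\mathcal H$), and let $G_{a,\mu}=\{u\in S_{a,\mu}: J_{a,\mu}(u)\le J_{a,\mu}(v)\text{ for all }v\in S_{a,\mu}\}$ be the set of its ground states. Theorem 1.1. For every $a\in[0,a_*)$, and for almost every $a\in[a_*,a^*)$, the derivative $e'(a)$ exists (the right derivative if $a=0$), and with $\mu_a:=e(a)+a\,e'(a)$ every minimizer of $e(a)$ is a weak solution of the GP equation with $\mu=\mu_a$. Moreover, $\Lambda_a=G_{a,\mu_a}$ if $a>0$, whereas for $a=0$ one has $\Lambda_0=G_{0,\mu_0}\cap\mathcal M$. -/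

import Mathlib

open MeasureTheory Set Filter Topology
open scoped ContDiff

namespace GP

/-- The plane `ℝ²` with its Euclidean norm and Lebesgue measure. -/
abbrev Plane : Type := EuclideanSpace ℝ (Fin 2)

/-- Real-valued `L²(ℝ²)` (classes modulo almost-everywhere equality). -/
abbrev L2 : Type := Lp ℝ 2 (volume : Measure Plane)

/-- `ℝ²`-valued `L²(ℝ²)`. -/
abbrev L2Vec : Type := Lp Plane 2 (volume : Measure Plane)

/-- `g` is the weak (distributional) gradient of `u`:
`∫ u ∇φ = - ∫ φ g` for every real test function `φ ∈ C_c^∞(ℝ²)`. -/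
def IsWeakGradient (u : Plane → ℝ) (g : Plane → Plane) : Prop :=
  ∀ φ : Plane → ℝ, ContDiff ℝ ∞ φ → HasCompactSupport φ →
    ∫ x, u x • gradient φ x = -∫ x, φ x • g x

/-- Membership in the Sobolev space `H¹(ℝ²)`: an `L²` function with a weak gradient in `L²`. -/
def MemH1 (u : L2) : Prop := ∃ g : L2Vec, IsWeakGradient u g

/-- A weak gradient in `L²` is unique. -/
theorem IsWeakGradient.unique {u : Plane → ℝ} {g₁ g₂ : L2Vec}
    (h₁ : IsWeakGradient u g₁) (h₂ : IsWeakGradient u g₂) : g₁ = g₂ := by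
  have l₁ : LocallyIntegrable g₁ (volume : Measure Plane) :=
    (Lp.memLp g₁).locallyIntegrable (by norm_num)
  have l₂ : LocallyIntegrable g₂ (volume : Measure Plane) :=
    (Lp.memLp g₂).locallyIntegrable (by norm_num)
  apply Lp.ext
  refine ae_eq_of_integral_contDiff_smul_eq l₁ l₂ ?_
  intro φ hφ hc
  have := (h₁ φ hφ hc).symm.trans (h₂ φ hφ hc)
  exact neg_injective this

open Classical in
/-- The weak gradient `∇u ∈ L²` of `u ∈ H¹(ℝ²)` (and `0` if `u ∉ H¹(ℝ²)`). -/
noncomputable def weakGrad (u : L2) : L2Vec :=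
  if h : MemH1 u then h.choose else 0

theorem MemH1.isWeakGradient {u : L2} (h : MemH1 u) : IsWeakGradient u (weakGrad u) := by
  rw [weakGrad, dif_pos h]
  exact h.choose_spec

/-- The assumption on the potential: `0 ≤ V ∈ L^∞_loc(ℝ²)` and `V(x) → ∞` as `|x| → ∞`.
As usual for elements of `L^∞_loc`, all conditions are meant up to null sets. -/
structure IsTrappingPotential (V : Plane → ℝ) : Prop where
  aestronglyMeasurable : AEStronglyMeasurable V (volume : Measure Plane)
  nonneg : ∀ᵐ x : Plane, 0 ≤ V x
  locallyBounded : ∀ R : ℝ, ∃ C : ℝ, ∀ᵐ x : Plane, ‖x‖ ≤ R → V x ≤ C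
  tendsto_atTop : ∀ M : ℝ, ∃ R : ℝ, ∀ᵐ x : Plane, R ≤ ‖x‖ → M ≤ V x

/-- The space `𝓗 = {u ∈ H¹(ℝ²) : ∫ V |u|² < ∞}`. -/
def energySpace (V : Plane → ℝ) : Set L2 :=
  {u | MemH1 u ∧ Integrable (fun x => V x * u x ^ 2)}

/-- The constraint set `𝓜 = {u ∈ 𝓗 : ∫ |u|² = 1}`. -/
def unitMass (V : Plane → ℝ) : Set L2 :=
  {u | u ∈ energySpace V ∧ ∫ x, u x ^ 2 = 1}

/-- The GP functional `E_a(u) = ∫ (|∇u|² + V |u|²) - (a/2) ∫ |u|⁴`. -/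
noncomputable def gpEnergy (V : Plane → ℝ) (a : ℝ) (u : L2) : ℝ :=
  (∫ x, (‖weakGrad u x‖ ^ 2 + V x * u x ^ 2)) - a / 2 * ∫ x, u x ^ 4

/-- The GP energy `e(a) = inf {E_a(u) : u ∈ 𝓜}`. -/
noncomputable def groundEnergy (V : Plane → ℝ) (a : ℝ) : ℝ :=
  sInf (gpEnergy V a '' unitMass V)

/-- `Λ_a`: the set of minimizers of `E_a` on `𝓜`. -/
def minimizers (V : Plane → ℝ) (a : ℝ) : Set L2 :=
  {u | u ∈ unitMass V ∧ ∀ v ∈ unitMass V, gpEnergy V a u ≤ gpEnergy V a v}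

/-- The action functional `J_{a,μ}(u) = (1/2) ∫ (|∇u|² + (V - μ) |u|²) - (a/4) ∫ |u|⁴`. -/
noncomputable def action (V : Plane → ℝ) (a μ : ℝ) (u : L2) : ℝ :=
  1 / 2 * (∫ x, (‖weakGrad u x‖ ^ 2 + (V x - μ) * u x ^ 2)) - a / 4 * ∫ x, u x ^ 4

/-- `u ∈ 𝓗` is a weak solution of `-Δu + V u = μ u + a |u|² u`, that is,
`⟨J_{a,μ}'(u), φ⟩ = 0` for all `φ ∈ 𝓗`. -/
def IsWeakSolution (V : Plane → ℝ) (a μ : ℝ) (u : L2) : Prop :=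
  u ∈ energySpace V ∧ ∀ φ ∈ energySpace V,
    (∫ x, (inner ℝ (weakGrad u x) (weakGrad φ x) + (V x - μ) * u x * φ x))
      - a * ∫ x, u x ^ 3 * φ x = 0

/-- `S_{a,μ}`: the set of nontrivial weak solutions. -/
def nontrivialSolutions (V : Plane → ℝ) (a μ : ℝ) : Set L2 :=
  {u | u ≠ 0 ∧ IsWeakSolution V a μ u}

/-- `G_{a,μ}`: the set of ground states, the nontrivial weak solutions of least action. -/
def groundStates (V : Plane → ℝ) (a μ : ℝ) : Set L2 :=
  {u | u ∈ nontrivialSolutions V a μ ∧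
    ∀ v ∈ nontrivialSolutions V a μ, action V a μ u ≤ action V a μ v}

/-- `e(a)` has exactly one positive minimizer. -/
def HasUniquePositiveMinimizer (V : Plane → ℝ) (a : ℝ) : Prop :=
  ∃! u : L2, u ∈ minimizers V a ∧ ∀ᵐ x : Plane, 0 < u x

/-- `a_*`, the supremum of the `l > 0` such that `e(a)` has a unique positive minimizer for
every `a ∈ [0, l)`. -/
noncomputable def aLower (V : Plane → ℝ) : ℝ :=
  sSup {l : ℝ | 0 < l ∧ ∀ a ∈ Ico 0 l, HasUniquePositiveMinimizer V a}

/-- `a^*`, the critical value: the threshold of the interaction strength for the existence of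
minimizers of `e(a)`, i.e. the supremum of the `a ≥ 0` for which `e(a)` is attained. -/
noncomputable def aUpper (V : Plane → ℝ) : ℝ :=
  sSup {a : ℝ | 0 ≤ a ∧ (minimizers V a).Nonempty}

end GP

/-! Write $E_a(u)=Q(u)-\tfrac a2B(u)$ with $B(u)=\int u^4$ (`quadEnergy`, `quartic`). For fixed $u$
this is affine in $a$ with slope $-B(u)/2$, so $e$ is an infimum of decreasing affine functions. If
$e$ is differentiable at an interior point $a$, the affine function of a minimizer touches $e$ from
above there, hence $e'(a)=-B(u)/2$ for every minimizer $u$ (`deriv_groundEnergy_eq`). All minimizers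
then share $B$, and so share the Lagrange multiplier $e(a)-\tfrac a2B=e(a)+a\,e'(a)=\mu_a$.

Testing the equation with a solution $v$ itself gives $Q(v)=\mu m+aB(v)$ with $m=\|v\|^2$, and the
action equals $\tfrac a4B(v)$; for $a>0$ least action means least $B$. Comparing $v/\|v\|$ with a
minimizer $u_0$ yields $B(u_0)m^2\le B(v)(2m-1)$. Since $2m-1\le m^2$, this gives $B(u_0)\le B(v)$,
and equality forces $m=1$, after which $v$ is itself a minimizer (`minimizers_eq_groundStates`). For
$a=0$ the action vanishes on all solutions, so the mass has to be prescribed.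

Almost everywhere differentiability is Lebesgue's theorem for the monotone function $e$. Below $a_*$
the difference quotients are squeezed between slopes given by positive minimizers, so continuity of
$B$ along them suffices (`tendsto_quartic_minimizers`). Limits of such minimizers exist by
compactness of the trapped energy space in $L^2$ (`exists_limit`) and Ladyzhenskaya's inequality.
They are a priori only nonnegative; the strong maximum principle (`ae_pos_of_supersolution`) makes
them positive, so that uniqueness applies.

No sharp interpolation constant is needed: attainment at one $b$ gives $E_s\ge e(b)+\tfrac{b-s}2B$
on the unit sphere, which is coercive for $0\le s<b$. -/

namespace GP

/-! ### Mollification in $L^2$ and its compatibility with weak gradients. -/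

open scoped Convolution ENNReal NNReal

/-- Mollification of `f` by the normalized bump function `ρ`. -/
noncomputable def mollify {F : Type*} [NormedAddCommGroup F] [NormedSpace ℝ F]
    (ρ : ContDiffBump (0 : Plane)) (f : Plane → F) : Plane → F :=
  ρ.normed volume ⋆[ContinuousLinearMap.lsmul ℝ ℝ, volume] f

section Mollify

variable {F : Type*} [NormedAddCommGroup F] [NormedSpace ℝ F] {f : Plane → F}

theorem mollify_apply (ρ : ContDiffBump (0 : Plane)) (f : Plane → F) (x : Plane) :
    mollify ρ f x = ∫ z, ρ.normed volume z • f (x - z) := rfl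

theorem mollify_apply' (ρ : ContDiffBump (0 : Plane)) (f : Plane → F) (x : Plane) :
    mollify ρ f x = ∫ y, ρ.normed volume (x - y) • f y := by
  rw [mollify, convolution_eq_swap]; rfl

theorem integrable_mollify_integrand (ρ : ContDiffBump (0 : Plane)) (hf : LocallyIntegrable f)
    (x : Plane) : Integrable (fun z => ρ.normed volume z • f (x - z)) :=
  ρ.hasCompactSupport_normed.convolutionExists_left (ContinuousLinearMap.lsmul ℝ ℝ)
    ρ.continuous_normed hf x

/-- Cauchy--Schwarz for the probability density `ρ`. -/
theorem enorm_integral_normed_smul_sq_le (ρ : ContDiffBump (0 : Plane)) {h : Plane → F}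
    (hm : AEStronglyMeasurable h volume) :
    ‖∫ z, ρ.normed volume z • h z‖ₑ ^ 2
      ≤ ∫⁻ z, ENNReal.ofReal (ρ.normed volume z) * ‖h z‖ₑ ^ 2 := by
  have hρm : Measurable fun z => ENNReal.ofReal (ρ.normed volume z) :=
    (ρ.continuous_normed.measurable).ennreal_ofReal
  have hρ1 : ∫⁻ z, ENNReal.ofReal (ρ.normed volume z) = 1 := by
    rw [← ofReal_integral_eq_lintegral_ofReal ρ.integrable_normed
      (Eventually.of_forall ρ.nonneg_normed), ρ.integral_normed, ENNReal.ofReal_one]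
  have hen : ∀ z, ‖ρ.normed volume z • h z‖ₑ = ENNReal.ofReal (ρ.normed volume z) * ‖h z‖ₑ := by
    intro z
    rw [enorm_smul, Real.enorm_of_nonneg (ρ.nonneg_normed z)]
  have key : ∫⁻ z, ENNReal.ofReal (ρ.normed volume z) * ‖h z‖ₑ
      ≤ (∫⁻ z, ENNReal.ofReal (ρ.normed volume z) * ‖h z‖ₑ ^ 2) ^ ((1 : ℝ) / 2) := by
    -- Hölder for the factorization $\rho|h|=\rho^{1/2}\cdot\rho^{1/2}|h|$; the first factor has
    -- $L^2$ norm one because $\rho$ has mass one.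
    have := ENNReal.lintegral_mul_le_Lp_mul_Lq volume
      (Real.HolderConjugate.two_two)
      (f := fun z => ENNReal.ofReal (ρ.normed volume z) ^ ((1 : ℝ) / 2))
      (g := fun z => ENNReal.ofReal (ρ.normed volume z) ^ ((1 : ℝ) / 2) * ‖h z‖ₑ)
      (hρm.pow_const _).aemeasurable ((hρm.pow_const _).aemeasurable.mul hm.enorm)
    have e1 : ∀ c : ℝ≥0∞, c ^ ((1 : ℝ) / 2) * c ^ ((1 : ℝ) / 2) = c := by
      intro c
      rw [← ENNReal.rpow_add_of_nonneg _ _ (by norm_num) (by norm_num)]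
      norm_num
    have e2 : ∀ c : ℝ≥0∞, (c ^ ((1 : ℝ) / 2)) ^ (2 : ℝ) = c := by
      intro c
      rw [← ENNReal.rpow_mul]; norm_num
    simp only [Pi.mul_apply, ENNReal.mul_rpow_of_nonneg _ _ (zero_le_two (α := ℝ)), e2,
      hρ1, ENNReal.one_rpow, one_mul, ← mul_assoc, e1] at this
    refine this.trans_eq ?_
    simp only [ENNReal.rpow_two]
  calc ‖∫ z, ρ.normed volume z • h z‖ₑ ^ 2
      ≤ (∫⁻ z, ENNReal.ofReal (ρ.normed volume z) * ‖h z‖ₑ) ^ 2 := by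
        gcongr
        refine (enorm_integral_le_lintegral_enorm _).trans_eq ?_
        exact lintegral_congr hen
    _ ≤ ((∫⁻ z, ENNReal.ofReal (ρ.normed volume z) * ‖h z‖ₑ ^ 2) ^ ((1 : ℝ) / 2)) ^ 2 := by
        gcongr
    _ = _ := by
        rw [← ENNReal.rpow_natCast, ← ENNReal.rpow_mul]; norm_num

theorem eLpNorm_two_sq {F : Type*} [NormedAddCommGroup F] (f : Plane → F) : eLpNorm f 2 volume ^ 2 = ∫⁻ x, ‖f x‖ₑ ^ 2 := by
  have := eLpNorm_nnreal_pow_eq_lintegral (f := f) (p := 2) (μ := (volume : Measure Plane))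
    (by norm_num)
  simpa using this

/-- The `L²` distance of `f` to its mollification is controlled by the modulus of continuity
of translations. -/
theorem eLpNorm_mollify_sub_le [CompleteSpace F] (ρ : ContDiffBump (0 : Plane)) (hf : LocallyIntegrable f)
    {δ : ℝ≥0∞} (hδ : ∀ z, ‖z‖ < ρ.rOut → eLpNorm (fun x => f (x - z) - f x) 2 volume ≤ δ) :
    eLpNorm (fun x => mollify ρ f x - f x) 2 volume ≤ δ := by
  have hfm : AEStronglyMeasurable f volume := hf.aestronglyMeasurable
  have hρm : Measurable fun z => ENNReal.ofReal (ρ.normed volume z) :=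
    (ρ.continuous_normed.measurable).ennreal_ofReal
  have hρ1 : ∫⁻ z, ENNReal.ofReal (ρ.normed volume z) = 1 := by
    rw [← ofReal_integral_eq_lintegral_ofReal ρ.integrable_normed
      (Eventually.of_forall ρ.nonneg_normed), ρ.integral_normed, ENNReal.ofReal_one]
  have hshift : ∀ x, AEStronglyMeasurable (fun z => f (x - z) - f x) volume := fun x =>
    (hfm.comp_quasiMeasurePreserving
      (quasiMeasurePreserving_sub_left_of_right_invariant volume x)).sub
      aestronglyMeasurable_const
  have hpt : ∀ x, ‖mollify ρ f x - f x‖ₑ ^ 2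
      ≤ ∫⁻ z, ENNReal.ofReal (ρ.normed volume z) * ‖f (x - z) - f x‖ₑ ^ 2 := by
    intro x
    have : mollify ρ f x - f x = ∫ z, ρ.normed volume z • (f (x - z) - f x) := by
      simp only [smul_sub]
      rw [integral_sub (integrable_mollify_integrand ρ hf x) (ρ.integrable_normed.smul_const _),
        ρ.integral_normed_smul, mollify_apply]
    rw [this]
    exact enorm_integral_normed_smul_sq_le ρ (hshift x)
  have hprod : AEStronglyMeasurable (fun p : Plane × Plane => f (p.1 - p.2) - f p.1)
      (volume.prod volume) :=
    (hfm.comp_quasiMeasurePreserving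
      (quasiMeasurePreserving_sub_of_right_invariant volume volume)).sub hfm.comp_fst
  have : eLpNorm (fun x => mollify ρ f x - f x) 2 volume ^ 2 ≤ δ ^ 2 := by
    rw [eLpNorm_two_sq]
    calc ∫⁻ x, ‖mollify ρ f x - f x‖ₑ ^ 2
        ≤ ∫⁻ x, ∫⁻ z, ENNReal.ofReal (ρ.normed volume z) * ‖f (x - z) - f x‖ₑ ^ 2 :=
          lintegral_mono hpt
      _ = ∫⁻ z, ∫⁻ x, ENNReal.ofReal (ρ.normed volume z) * ‖f (x - z) - f x‖ₑ ^ 2 := by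
          apply lintegral_lintegral_swap
          exact (hρm.comp measurable_snd).aemeasurable.mul (hprod.enorm.pow_const _)
      _ = ∫⁻ z, ENNReal.ofReal (ρ.normed volume z)
            * eLpNorm (fun x => f (x - z) - f x) 2 volume ^ 2 := by
          refine lintegral_congr fun z => ?_
          rw [lintegral_const_mul' _ _ ENNReal.ofReal_ne_top, eLpNorm_two_sq]
      _ ≤ ∫⁻ z, ENNReal.ofReal (ρ.normed volume z) * δ ^ 2 := by
          refine lintegral_mono fun z => ?_
          by_cases hz : ‖z‖ < ρ.rOut
          · gcongr; exact hδ z hz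
          · have : ρ.normed volume z = 0 := by
              have : z ∉ Function.support (ρ.normed volume) := by
                rw [ρ.support_normed_eq]; simpa using hz
              simpa using this
            simp [this]
      _ = δ ^ 2 := by
          rw [lintegral_mul_const _ hρm, hρ1, one_mul]
  exact (ENNReal.pow_le_pow_left_iff (two_ne_zero)).1 this

/-- Translations are continuous in `L²`. -/
theorem exists_eLpNorm_translate_sub_le {F : Type*} [NormedAddCommGroup F] {f : Plane → F}
    (hf : MemLp f 2 volume) {δ : ℝ≥0∞} (hδ : 0 < δ) :
    ∃ r > 0, ∀ z : Plane, ‖z‖ < r → eLpNorm (fun x => f (x - z) - f x) 2 volume ≤ δ := by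
  let f' : Lp F 2 (volume : Measure Plane) := hf.toLp f
  let c : Plane → C(Plane, Plane) := fun z => ⟨fun x => x - z, by fun_prop⟩
  have hc : Continuous c :=
    (ContinuousMap.curry ⟨fun p : Plane × Plane => p.2 - p.1, by fun_prop⟩).continuous
  have hcm : ∀ z, MeasurePreserving (c z) volume volume := fun z =>
    measurePreserving_sub_right volume z
  -- Composition with measure-preserving maps is continuous in the map for the compact-open
  -- topology, which reduces the claim to continuity of $z\mapsto(x\mapsto x-z)$.
  have h := (continuous_const (y := f') (X := Plane)).compMeasurePreservingLp hc hcm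
    ENNReal.ofNat_ne_top
  have h0 := h.tendsto 0
  rw [EMetric.tendsto_nhds] at h0
  obtain ⟨r, hr, H⟩ := Metric.eventually_nhds_iff.1 (h0 δ hδ)
  refine ⟨r, hr, fun z hz => ?_⟩
  have := (H (y := z) (by simpa using hz)).le
  rw [Lp.edist_def] at this
  refine le_trans (le_of_eq (eLpNorm_congr_ae ?_)) this
  have e1 : ∀ z, (Lp.compMeasurePreserving (c z) (hcm z) f' : Plane → F)
      =ᵐ[volume] fun x => f (x - z) := fun z =>
    (Lp.coeFn_compMeasurePreserving f' (hcm z)).trans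
      ((hcm z).quasiMeasurePreserving.ae_eq_comp hf.coeFn_toLp)
  filter_upwards [e1 z, e1 0] with x h1 h2
  simp only [Pi.sub_apply]
  rw [h1, h2, sub_zero]

theorem exists_mollify_close [CompleteSpace F] (hf : MemLp f 2 volume) {δ : ℝ≥0∞} (hδ : 0 < δ) :
    ∃ r > 0, ∀ ρ : ContDiffBump (0 : Plane), ρ.rOut < r →
      eLpNorm (fun x => mollify ρ f x - f x) 2 volume ≤ δ := by
  obtain ⟨r, hr, H⟩ := exists_eLpNorm_translate_sub_le hf hδ
  exact ⟨r, hr, fun ρ hρ => eLpNorm_mollify_sub_le ρ (hf.locallyIntegrable (by norm_num))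
    fun z hz => H z (hz.trans hρ)⟩

theorem mollify_contDiff (ρ : ContDiffBump (0 : Plane)) (hf : LocallyIntegrable f) :
    ContDiff ℝ ∞ (mollify ρ f) :=
  ρ.hasCompactSupport_normed.contDiff_convolution_left _ ρ.contDiff_normed hf

theorem mollify_hasCompactSupport (ρ : ContDiffBump (0 : Plane)) (hf : HasCompactSupport f) :
    HasCompactSupport (mollify ρ f) :=
  ρ.hasCompactSupport_normed.convolution _ hf

end Mollify

theorem inner_gradient_left {φ : Plane → ℝ} {x : Plane} (v : Plane) :
    inner ℝ (gradient φ x) v = fderiv ℝ φ x v := by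
  simp [gradient]

theorem continuous_gradient {φ : Plane → ℝ} (h : ContDiff ℝ ∞ φ) : Continuous (gradient φ) :=
  (InnerProductSpace.toDual ℝ Plane).symm.continuous.comp (h.continuous_fderiv (by simp))

theorem hasCompactSupport_gradient {φ : Plane → ℝ} (h : HasCompactSupport φ) :
    HasCompactSupport (gradient φ) :=
  (h.fderiv ℝ).comp_left (g := (InnerProductSpace.toDual ℝ Plane).symm) (by simp)

theorem norm_gradient (φ : Plane → ℝ) (x : Plane) : ‖gradient φ x‖ = ‖fderiv ℝ φ x‖ := by
  simp [gradient]

/-- The gradient of a mollification is the mollification of the weak gradient. -/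
theorem gradient_mollify (ρ : ContDiffBump (0 : Plane)) {u : Plane → ℝ} {g : Plane → Plane}
    (hu : LocallyIntegrable u) (h : IsWeakGradient u g) (x : Plane) :
    gradient (mollify ρ u) x = mollify ρ g x := by
  -- The reflected kernel serves as test function; the sign from differentiating $x-y$ in $y$
  -- cancels the one in the definition of the weak gradient.
  set ψ : Plane → ℝ := fun y => ρ.normed volume (x - y) with hψ
  have hψs : ContDiff ℝ ∞ ψ := ρ.contDiff_normed.comp (contDiff_const.sub contDiff_id)
  have hψc : HasCompactSupport ψ :=
    ρ.hasCompactSupport_normed.comp_homeomorph (Homeomorph.subLeft x)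
  have hd := ρ.hasCompactSupport_normed.hasFDerivAt_convolution_left
    (ContinuousLinearMap.lsmul ℝ ℝ) (ρ.contDiff_normed (μ := volume) (n := 1)) hu x
  have hder : ∀ y, fderiv ℝ ψ y = - fderiv ℝ (ρ.normed volume) (x - y) := by
    intro y
    have h1 : HasFDerivAt (ρ.normed volume) (fderiv ℝ (ρ.normed volume) (x - y)) (x - y) :=
      ((ρ.contDiff_normed (n := 1)).differentiable (by simp) _).hasFDerivAt
    have h2 : HasFDerivAt (fun y : Plane => x - y) (-(ContinuousLinearMap.id ℝ Plane)) y := by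
      simpa using (hasFDerivAt_id y).const_sub x
    have h3 := (h1.comp y h2).fderiv
    ext v
    change fderiv ℝ (ρ.normed volume ∘ fun y => x - y) y v = _
    rw [h3]; simp
  have hint : ∀ {G : Type} [NormedAddCommGroup G] [NormedSpace ℝ G] {q : Plane → ℝ}
      {w : Plane → G}, Continuous w → HasCompactSupport w → LocallyIntegrable q →
      Integrable (fun y => q y • w y) := by
    intro G _ _ q w hw hwc hq
    exact hq.integrable_smul_right_of_hasCompactSupport hw hwc
  refine ext_inner_right ℝ fun v => ?_
  rw [inner_gradient_left, mollify, hd.fderiv, convolution_eq_swap, mollify_apply' ρ g x]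
  have e := h ψ hψs hψc
  have i1 : Integrable fun y => u y • gradient ψ y :=
    hint (continuous_gradient hψs) (hasCompactSupport_gradient hψc) hu
  have e' : ∫ y, ψ y • g y = -∫ y, u y • gradient ψ y := by rw [e, neg_neg]
  rw [show (fun y => ρ.normed volume (x - y) • g y) = fun y => ψ y • g y from rfl, e',
    inner_neg_left, real_inner_comm, ← integral_inner i1]
  have i2 : Integrable (fun t => ((ContinuousLinearMap.lsmul ℝ ℝ).precompL Plane)
      (fderiv ℝ (ρ.normed volume) (x - t)) (u t)) := by
    have := (hint (q := u) (w := fun t => -fderiv ℝ ψ t)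
      (hψs.continuous_fderiv (by simp)).neg (hψc.fderiv ℝ).neg hu)
    refine this.congr (Eventually.of_forall fun t => ?_)
    ext v
    simp [hder, mul_comm]
  rw [ContinuousLinearMap.integral_apply i2, ← integral_neg]
  refine integral_congr_ae (Eventually.of_forall fun t => ?_)
  change _ = -inner ℝ v (u t • gradient ψ t)
  rw [real_inner_comm, real_inner_smul_left, inner_gradient_left, hder]
  simp [mul_comm]

end GP

/-! ### Product rule, cutoffs and density of test functions in $H^1$. -/

namespace GP

open scoped ENNReal

theorem hasCompactSupport_smul_right {F : Type*} [NormedAddCommGroup F] [NormedSpace ℝ F]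
    {ψ : Plane → ℝ} {w : Plane → F} (hc : HasCompactSupport ψ) :
    HasCompactSupport fun x => ψ x • w x := by
  refine hc.mono fun x hx => ?_
  simp only [Function.mem_support] at hx ⊢
  exact fun h => hx (by rw [h, zero_smul])

theorem gradient_mul {χ ψ : Plane → ℝ} {x : Plane} (hχ : DifferentiableAt ℝ χ x)
    (hψ : DifferentiableAt ℝ ψ x) :
    gradient (fun y => χ y * ψ y) x = χ x • gradient ψ x + ψ x • gradient χ x := by
  refine ext_inner_right ℝ fun v => ?_
  rw [inner_add_left, real_inner_smul_left, real_inner_smul_left]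
  simp only [inner_gradient_left]
  rw [fderiv_fun_mul hχ hψ]
  simp

theorem IsWeakGradient.congr {u u' : Plane → ℝ} {g g' : Plane → Plane} (h : IsWeakGradient u g)
    (hu : u =ᵐ[volume] u') (hg : g =ᵐ[volume] g') : IsWeakGradient u' g' := by
  intro φ hφ hc
  rw [← integral_congr_ae (hu.mono fun x hx => by simp only [hx] :
      (fun x => u x • gradient φ x) =ᵐ[volume] fun x => u' x • gradient φ x),
    ← integral_congr_ae (hg.mono fun x hx => by simp only [hx] :
      (fun x => φ x • g x) =ᵐ[volume] fun x => φ x • g' x)]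
  exact h φ hφ hc

/-- The classical gradient of a `C¹` function is its weak gradient. -/
theorem isWeakGradient_gradient {φ : Plane → ℝ} (hφ : ContDiff ℝ 1 φ) :
    IsWeakGradient φ (gradient φ) := by
  intro ψ hψ hc
  have cφ : Continuous (gradient φ) :=
    (InnerProductSpace.toDual ℝ Plane).symm.continuous.comp (hφ.continuous_fderiv (by simp))
  have i1 : Integrable fun x => φ x • gradient ψ x :=
    (hφ.continuous.smul (continuous_gradient hψ)).integrable_of_hasCompactSupport
      (hasCompactSupport_gradient hc).smul_left
  have i2 : Integrable fun x => ψ x • gradient φ x :=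
    (hψ.continuous.smul cφ).integrable_of_hasCompactSupport hc.smul_right
  refine ext_inner_left ℝ fun v => ?_
  have e1 : ∀ x, inner ℝ v (φ x • gradient ψ x) = φ x * fderiv ℝ ψ x v := fun x => by
    rw [inner_smul_right, real_inner_comm, inner_gradient_left]
  have e2 : ∀ x, inner ℝ v (ψ x • gradient φ x) = fderiv ℝ φ x v * ψ x := fun x => by
    rw [inner_smul_right, real_inner_comm, inner_gradient_left, mul_comm]
  have j1 : Integrable fun x => φ x * fderiv ℝ ψ x v :=
    (i1.const_inner (𝕜 := ℝ) v).congr (Eventually.of_forall e1)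
  have j2 : Integrable fun x => fderiv ℝ φ x v * ψ x :=
    (i2.const_inner (𝕜 := ℝ) v).congr (Eventually.of_forall e2)
  rw [inner_neg_right, ← integral_inner i1, ← integral_inner i2]
  simp only [e1, e2]
  exact integral_mul_fderiv_eq_neg_fderiv_mul_of_integrable j2 j1
    ((hφ.continuous.mul hψ.continuous).integrable_of_hasCompactSupport hc.mul_left)
    (fun x _ => hφ.differentiable (by simp) x) (fun x _ => hψ.differentiable (by simp) x)

/-- Product rule for a weak gradient and a smooth factor. -/
theorem IsWeakGradient.smooth_mul {u χ : Plane → ℝ} {g : Plane → Plane} (h : IsWeakGradient u g)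
    (hu : LocallyIntegrable u) (hg : LocallyIntegrable g) (hχ : ContDiff ℝ ∞ χ) :
    IsWeakGradient (fun x => χ x * u x) (fun x => χ x • g x + u x • gradient χ x) := by
  intro ψ hψ hc
  have s3 : HasCompactSupport fun x => χ x * ψ x := hc.smul_left (f := χ)
  have e := h (fun x => χ x * ψ x) (hχ.mul hψ) s3
  have dχ : Differentiable ℝ χ := hχ.differentiable (by simp)
  have dψ : Differentiable ℝ ψ := hψ.differentiable (by simp)
  have s1 : HasCompactSupport fun x => χ x • gradient ψ x :=
    HasCompactSupport.smul_left (f := χ) (hasCompactSupport_gradient hc)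
  have s2 : HasCompactSupport fun x => ψ x • gradient χ x :=
    hasCompactSupport_smul_right hc
  have c1 : Continuous fun x => χ x • gradient ψ x := hχ.continuous.smul (continuous_gradient hψ)
  have c2 : Continuous fun x => ψ x • gradient χ x := hψ.continuous.smul (continuous_gradient hχ)
  have c3 : Continuous fun x => χ x * ψ x := hχ.continuous.mul hψ.continuous
  have i1 : Integrable fun x => u x • χ x • gradient ψ x :=
    hu.integrable_smul_right_of_hasCompactSupport c1 s1
  have i2 : Integrable fun x => u x • ψ x • gradient χ x :=
    hu.integrable_smul_right_of_hasCompactSupport c2 s2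
  have i3 : Integrable fun x => (χ x * ψ x) • g x :=
    hg.integrable_smul_left_of_hasCompactSupport c3 s3
  have e1 : ∫ x, u x • gradient (fun y => χ y * ψ y) x
      = ∫ x, (u x • χ x • gradient ψ x + u x • ψ x • gradient χ x) :=
    integral_congr_ae (Eventually.of_forall fun x => by
      simp only [gradient_mul (dχ x) (dψ x), smul_add])
  have e2 : ∫ x, (χ x * u x) • gradient ψ x = ∫ x, u x • χ x • gradient ψ x :=
    integral_congr_ae (Eventually.of_forall fun x => by
      simp only [smul_smul, mul_comm (u x)])
  have e3 : ∫ x, ψ x • (χ x • g x + u x • gradient χ x)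
      = ∫ x, ((χ x * ψ x) • g x + u x • ψ x • gradient χ x) :=
    integral_congr_ae (Eventually.of_forall fun x => by
      simp only [smul_add, smul_smul, mul_comm (ψ x)])
  rw [e1, integral_add i1 i2] at e
  rw [e2, e3, integral_add i3 i2, neg_add, ← e]
  abel

/-- Dominated convergence in `L²`. -/
theorem tendsto_eLpNorm_two_of_dominated {F : Type*} [NormedAddCommGroup F] {f : ℕ → Plane → F}
    {G : Plane → ℝ} (hf : ∀ n, AEStronglyMeasurable (f n) volume) (hG : MemLp G 2 volume)
    (hb : ∀ n, ∀ᵐ x, ‖f n x‖ ≤ G x) (h0 : ∀ᵐ x, Tendsto (fun n => f n x) atTop (𝓝 0)) :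
    Tendsto (fun n => eLpNorm (f n) 2 volume) atTop (𝓝 0) := by
  have hlim : Tendsto (fun n => eLpNorm (f n) 2 volume ^ 2) atTop (𝓝 0) := by
    simp_rw [eLpNorm_two_sq]
    have := tendsto_lintegral_of_dominated_convergence' (μ := (volume : Measure Plane))
      (F := fun n x => ‖f n x‖ₑ ^ 2) (f := fun _ => 0) (fun x => ‖G x‖ₑ ^ 2)
      (fun n => (hf n).enorm.pow_const _) ?_ ?_ ?_
    · simpa using this
    · intro n
      filter_upwards [hb n] with x hx
      gcongr
      exact enorm_le_iff_norm_le.2 (hx.trans (le_abs_self _))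
    · rw [← eLpNorm_two_sq]
      exact ENNReal.pow_ne_top hG.2.ne
    · filter_upwards [h0] with x hx
      have := ((ENNReal.continuous_pow 2).tendsto _).comp hx.enorm
      simpa [Function.comp_def] using this
  have := hlim.ennrpow_const ((1 : ℝ) / 2)
  have hr : ∀ c : ℝ≥0∞, (c ^ 2) ^ ((1 : ℝ) / 2) = c := by
    intro c
    rw [← ENNReal.rpow_natCast, ← ENNReal.rpow_mul]; norm_num
  simpa only [hr, ENNReal.zero_rpow_of_pos (show (0 : ℝ) < 1 / 2 by norm_num)] using this

/-- Smooth cutoff functions with uniformly bounded gradients. -/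
theorem exists_cutoff : ∃ (C : ℝ) (χ : ℕ → Plane → ℝ), 0 ≤ C ∧ (∀ n, ContDiff ℝ ∞ (χ n)) ∧
    (∀ n, HasCompactSupport (χ n)) ∧ (∀ n x, 0 ≤ χ n x) ∧ (∀ n x, χ n x ≤ 1) ∧
    (∀ n x, ‖gradient (χ n) x‖ ≤ C) ∧ (∀ (n : ℕ) x, ‖x‖ < n + 1 → χ n x = 1 ∧ gradient (χ n) x = 0) := by
  let b : ContDiffBump (0 : Plane) := ⟨1, 2, one_pos, one_lt_two⟩
  have hbs : ContDiff ℝ ∞ b := b.contDiff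
  obtain ⟨C, hC⟩ := (b.hasCompactSupport.fderiv ℝ).exists_bound_of_continuous
    (hbs.continuous_fderiv (by simp))
  have hC0 : 0 ≤ C := (norm_nonneg _).trans (hC 0)
  -- The cutoffs are $b(x/(n+1))$. The scale is at most one, so dilation never increases the
  -- gradient bound.
  let s : ℕ → ℝ := fun n => ((n : ℝ) + 1)⁻¹
  have hs0 : ∀ n, 0 < s n := fun n => by positivity
  have hs1 : ∀ n, s n ≤ 1 := fun n => inv_le_one_of_one_le₀ (by linarith [n.cast_nonneg (α := ℝ)])
  have h1 : ∀ (n : ℕ) (x : Plane), ‖x‖ < n + 1 → b (s n • x) = 1 := by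
    intro n x hx
    apply b.one_of_mem_closedBall
    rw [mem_closedBall_zero_iff, norm_smul, Real.norm_of_nonneg (hs0 n).le]
    change ((n : ℝ) + 1)⁻¹ * ‖x‖ ≤ 1
    rw [inv_mul_le_iff₀ (by positivity)]; linarith
  refine ⟨C, fun n x => b (s n • x), hC0, fun n => ?_, fun n => ?_, fun n x => b.nonneg,
    fun n x => b.le_one, fun n x => ?_, fun n x hx => ⟨h1 n x hx, ?_⟩⟩
  · exact hbs.comp (contDiff_const_smul _)
  · exact b.hasCompactSupport.comp_homeomorph (Homeomorph.smulOfNeZero (s n) (hs0 n).ne')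
  · rw [norm_gradient]
    have := fderiv_comp_smul (𝕜 := ℝ) (f := b) (s n) (x := x)
    rw [this, norm_smul, Real.norm_of_nonneg (hs0 n).le]
    calc s n * _ ≤ 1 * C := mul_le_mul (hs1 n) (hC _) (norm_nonneg _) zero_le_one
      _ = C := one_mul C
  · have : (fun x => b (s n • x)) =ᶠ[𝓝 x] fun _ => (1 : ℝ) := by
      filter_upwards [(continuous_norm.isOpen_preimage _ isOpen_Iio).mem_nhds hx] with y hy
      exact h1 n y hy
    rw [gradient, this.fderiv_eq]
    simp

/-- Bounding the outer radius by twice the inner one keeps the kernels comparable to averages over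
balls, as Lebesgue differentiation requires; only `IsWeakGradient.ae_const_of_zero` needs it. -/
theorem exists_contDiffBump_rOut_lt {r : ℝ} (hr : 0 < r) :
    ∃ ρ : ContDiffBump (0 : Plane), ρ.rOut < r ∧ ρ.rOut ≤ 2 * ρ.rIn :=
  ⟨⟨r / 4, r / 2, by positivity, by linarith⟩, by change r / 2 < r; linarith,
    by change r / 2 ≤ 2 * (r / 4); linarith⟩

/-- `H¹` functions are approximated in `H¹` by compactly supported ones. -/
theorem exists_compactSupport_close {u : Plane → ℝ} {g : Plane → Plane} (hu : MemLp u 2 volume)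
    (hg : MemLp g 2 volume) {ε : ℝ≥0∞} (hε : 0 < ε) :
    ∃ χ : Plane → ℝ, ContDiff ℝ ∞ χ ∧ HasCompactSupport χ ∧ (∀ x, 0 ≤ χ x) ∧ (∀ x, χ x ≤ 1) ∧
      MemLp (fun x => χ x • g x + u x • gradient χ x) 2 volume ∧
      eLpNorm (fun x => χ x * u x - u x) 2 volume ≤ ε ∧
      eLpNorm (fun x => (χ x • g x + u x • gradient χ x) - g x) 2 volume ≤ ε := by
  obtain ⟨C, χ, hC, hs, hc, h0, h1, hgr, hone⟩ := exists_cutoff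
  have m1 : ∀ n, AEStronglyMeasurable (fun x => χ n x * u x - u x) volume := fun n =>
    ((hs n).continuous.aestronglyMeasurable.mul hu.1).sub hu.1
  have m2 : ∀ n, AEStronglyMeasurable (fun x => χ n x • g x + u x • gradient (χ n) x) volume :=
    fun n => ((hs n).continuous.aestronglyMeasurable.smul hg.1).add
      (hu.1.smul (continuous_gradient (hs n)).aestronglyMeasurable)
  have ev : ∀ x : Plane, ∀ᶠ n : ℕ in atTop, ‖x‖ < n + 1 := by
    intro x
    obtain ⟨N, hN⟩ := exists_nat_gt ‖x‖
    filter_upwards [eventually_ge_atTop N] with n hn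
    have : (N : ℝ) ≤ n := by exact_mod_cast hn
    linarith
  have hχn : ∀ n x, ‖χ n x‖ ≤ 1 := fun n x => by
    rw [Real.norm_of_nonneg (h0 n x)]; exact h1 n x
  have l1 := tendsto_eLpNorm_two_of_dominated (f := fun n x => χ n x * u x - u x)
    (G := fun x => 2 * ‖u x‖) m1 (hu.norm.const_mul 2)
    (fun n => Eventually.of_forall fun x => by
      calc ‖χ n x * u x - u x‖ ≤ ‖χ n x‖ * ‖u x‖ + ‖u x‖ := by
            rw [← norm_mul]; exact norm_sub_le _ _
        _ ≤ 1 * ‖u x‖ + ‖u x‖ := by gcongr; exact hχn n x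
        _ = 2 * ‖u x‖ := by ring)
    (Eventually.of_forall fun x => by
      refine tendsto_const_nhds.congr' ?_
      filter_upwards [ev x] with n hn
      simp [(hone n x hn).1])
  have b2 : ∀ n x, ‖χ n x • g x + u x • gradient (χ n) x‖ ≤ ‖g x‖ + C * ‖u x‖ := by
    intro n x
    calc _ ≤ ‖χ n x‖ * ‖g x‖ + ‖u x‖ * ‖gradient (χ n) x‖ := by
            rw [← norm_smul, ← norm_smul]; exact norm_add_le _ _
        _ ≤ 1 * ‖g x‖ + ‖u x‖ * C := by gcongr; exacts [hχn n x, hgr n x]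
        _ = _ := by ring
  have l2 := tendsto_eLpNorm_two_of_dominated
    (f := fun n x => (χ n x • g x + u x • gradient (χ n) x) - g x)
    (G := fun x => 2 * ‖g x‖ + C * ‖u x‖) (fun n => (m2 n).sub hg.1)
    ((hg.norm.const_mul 2).add (hu.norm.const_mul C))
    (fun n => Eventually.of_forall fun x => by
      calc _ ≤ (‖g x‖ + C * ‖u x‖) + ‖g x‖ := (norm_sub_le _ _).trans (by gcongr; exact b2 n x)
        _ = _ := by ring)
    (Eventually.of_forall fun x => by
      refine tendsto_const_nhds.congr' ?_
      filter_upwards [ev x] with n hn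
      simp [(hone n x hn).1, (hone n x hn).2])
  obtain ⟨n, hn1, hn2⟩ := ((l1.eventually_lt_const hε).and (l2.eventually_lt_const hε)).exists
  refine ⟨χ n, hs n, hc n, h0 n, h1 n, ?_, hn1.le, hn2.le⟩
  exact (hg.norm.add (hu.norm.const_mul C)).of_le (m2 n) (Eventually.of_forall fun x =>
    (b2 n x).trans (le_abs_self _))

/-- Smooth compactly supported functions are dense in `H¹`. -/
theorem exists_smooth_close {u : Plane → ℝ} {g : Plane → Plane} (hu : MemLp u 2 volume)
    (hg : MemLp g 2 volume) (h : IsWeakGradient u g) {ε : ℝ≥0∞} (hε : 0 < ε) :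
    ∃ φ : Plane → ℝ, ContDiff ℝ ∞ φ ∧ HasCompactSupport φ ∧ ((∀ᵐ x, 0 ≤ u x) → ∀ x, 0 ≤ φ x) ∧
      eLpNorm (fun x => φ x - u x) 2 volume ≤ ε ∧
      eLpNorm (fun x => gradient φ x - g x) 2 volume ≤ ε := by
  have hε2 : 0 < ε / 2 := ENNReal.half_pos hε.ne'
  obtain ⟨χ, hs, hc, h0, h1, hm, c1, c2⟩ := exists_compactSupport_close hu hg hε2
  have liu := hu.locallyIntegrable (p := 2) (by norm_num)
  have lig := hg.locallyIntegrable (p := 2) (by norm_num)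
  set u' : Plane → ℝ := fun x => χ x * u x with hu'
  set g' : Plane → Plane := fun x => χ x • g x + u x • gradient χ x with hg'
  have mu' : MemLp u' 2 volume := hu.of_le (hs.continuous.aestronglyMeasurable.mul hu.1)
    (Eventually.of_forall fun x => by
      rw [norm_mul, Real.norm_of_nonneg (h0 x)]
      exact mul_le_of_le_one_left (norm_nonneg _) (h1 x))
  have h' : IsWeakGradient u' g' := h.smooth_mul liu lig hs
  have liu' := mu'.locallyIntegrable (p := 2) (by norm_num)
  obtain ⟨r1, hr1, H1⟩ := exists_mollify_close mu' hε2
  obtain ⟨r2, hr2, H2⟩ := exists_mollify_close hm hε2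
  obtain ⟨ρ, hρ, -⟩ := exists_contDiffBump_rOut_lt (lt_min hr1 hr2)
  have tri : ∀ {F : Type} [NormedAddCommGroup F] {a b c : Plane → F},
      AEStronglyMeasurable a volume → AEStronglyMeasurable b volume →
      AEStronglyMeasurable c volume → eLpNorm (fun x => a x - b x) 2 volume ≤ ε / 2 →
      eLpNorm (fun x => b x - c x) 2 volume ≤ ε / 2 →
      eLpNorm (fun x => a x - c x) 2 volume ≤ ε := by
    intro F _ a b c ha hb hc h1 h2
    calc eLpNorm (fun x => a x - c x) 2 volume
        = eLpNorm ((fun x => a x - b x) + fun x => b x - c x) 2 volume := by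
          congr 1; ext x; simp
      _ ≤ _ := eLpNorm_add_le (ha.sub hb) (hb.sub hc) (by norm_num)
      _ ≤ ε / 2 + ε / 2 := add_le_add h1 h2
      _ = ε := ENNReal.add_halves ε
  have cont : ContDiff ℝ ∞ (mollify ρ u') := mollify_contDiff ρ liu'
  refine ⟨mollify ρ u', cont, mollify_hasCompactSupport ρ hc.mul_right, ?_, ?_, ?_⟩
  · intro hpos x
    rw [mollify_apply']
    refine integral_nonneg_of_ae ?_
    filter_upwards [hpos] with y hy
    exact mul_nonneg (ρ.nonneg_normed _) (mul_nonneg (h0 y) hy)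
  · exact tri cont.continuous.aestronglyMeasurable mu'.1 hu.1
      (H1 ρ (hρ.trans_le (min_le_left _ _))) c1
  · refine tri (continuous_gradient cont).aestronglyMeasurable hm.1 hg.1 ?_ c2
    simp_rw [gradient_mollify ρ liu' h']
    exact H2 ρ (hρ.trans_le (min_le_right _ _))

/-- Approximation of an `H¹` function by a sequence of test functions, in `H¹` and almost
everywhere. -/
theorem exists_smooth_seq {u : Plane → ℝ} {g : Plane → Plane} (hu : MemLp u 2 volume)
    (hg : MemLp g 2 volume) (h : IsWeakGradient u g) :
    ∃ φ : ℕ → Plane → ℝ, (∀ n, ContDiff ℝ ∞ (φ n)) ∧ (∀ n, HasCompactSupport (φ n)) ∧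
      ((∀ᵐ x, 0 ≤ u x) → ∀ n x, 0 ≤ φ n x) ∧
      Tendsto (fun n => eLpNorm (fun x => φ n x - u x) 2 volume) atTop (𝓝 0) ∧
      Tendsto (fun n => eLpNorm (fun x => gradient (φ n) x - g x) 2 volume) atTop (𝓝 0) ∧
      (∀ᵐ x, Tendsto (fun n => φ n x) atTop (𝓝 (u x))) ∧
      (∀ᵐ x, Tendsto (fun n => gradient (φ n) x) atTop (𝓝 (g x))) := by
  obtain ⟨ε, -, hε0, hεl⟩ := exists_seq_strictAnti_tendsto' (show (0 : ℝ≥0∞) < 1 by norm_num)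
  choose φ hs hc hpos h1 h2 using fun n => exists_smooth_close hu hg h (hε0 n).1
  have l1 : Tendsto (fun n => eLpNorm (fun x => φ n x - u x) 2 volume) atTop (𝓝 0) :=
    tendsto_of_tendsto_of_tendsto_of_le_of_le tendsto_const_nhds hεl (fun _ => zero_le) h1
  have l2 : Tendsto (fun n => eLpNorm (fun x => gradient (φ n) x - g x) 2 volume) atTop (𝓝 0) :=
    tendsto_of_tendsto_of_tendsto_of_le_of_le tendsto_const_nhds hεl (fun _ => zero_le) h2
  -- Convergence in $L^2$ gives convergence in measure, hence almost everywhere along a subsequence;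
  -- this is done for the functions and then, on that subsequence, for the gradients.
  have m1 := tendstoInMeasure_of_tendsto_eLpNorm (two_ne_zero)
    (fun n => (hs n).continuous.aestronglyMeasurable) hu.1 l1
  obtain ⟨s, hsm, ae1⟩ := m1.exists_seq_tendsto_ae
  have l2' := l2.comp hsm.tendsto_atTop
  have m2 := tendstoInMeasure_of_tendsto_eLpNorm (two_ne_zero)
    (fun n => (continuous_gradient (hs (s n))).aestronglyMeasurable) hg.1 l2'
  obtain ⟨t, htm, ae2⟩ := m2.exists_seq_tendsto_ae
  refine ⟨fun n => φ (s (t n)), fun n => hs _, fun n => hc _, fun hp n => hpos _ hp,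
    l1.comp (hsm.comp htm).tendsto_atTop, l2'.comp htm.tendsto_atTop, ?_, ae2⟩
  filter_upwards [ae1] with x hx
  exact hx.comp htm.tendsto_atTop

end GP

/-! ### Ladyzhenskaya's inequality, translation estimate, chain rule. -/

namespace GP

open scoped ENNReal NNReal

/-- Cauchy--Schwarz for `lintegral`. -/
theorem lintegral_enorm_mul_le {F G : Type*} [NormedAddCommGroup F] [NormedAddCommGroup G]
    {f : Plane → F} {k : Plane → G} (hf : AEStronglyMeasurable f volume)
    (hk : AEStronglyMeasurable k volume) :
    ∫⁻ x, ‖f x‖ₑ * ‖k x‖ₑ ≤ eLpNorm f 2 volume * eLpNorm k 2 volume := by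
  have := ENNReal.lintegral_mul_le_Lp_mul_Lq volume Real.HolderConjugate.two_two
    hf.enorm hk.enorm
  simpa [eLpNorm_eq_lintegral_rpow_enorm_toReal] using this

/-- Cauchy–Schwarz against a fixed $L^2$ weight. In the chain rule it turns $L^2$ convergence of the
approximants into convergence of the tested integrals. -/
theorem tendsto_integral_of_eLpNorm_two {F G : Type*} [NormedAddCommGroup F] [NormedSpace ℝ F]
    [NormedAddCommGroup G] {k : ℕ → Plane → F} {f : ℕ → Plane → G} {w : Plane → ℝ}
    (hf : ∀ n, AEStronglyMeasurable (f n) volume) (hw : MemLp w 2 volume)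
    (hk : ∀ n, ∀ᵐ x, ‖k n x‖ ≤ w x * ‖f n x‖)
    (h0 : Tendsto (fun n => eLpNorm (f n) 2 volume) atTop (𝓝 0)) :
    Tendsto (fun n => ∫ x, k n x) atTop (𝓝 0) := by
  rw [tendsto_zero_iff_enorm_tendsto_zero]
  have hlim : Tendsto (fun n => eLpNorm w 2 volume * eLpNorm (f n) 2 volume) atTop (𝓝 0) := by
    simpa using ENNReal.Tendsto.const_mul h0 (Or.inr hw.2.ne)
  refine tendsto_of_tendsto_of_tendsto_of_le_of_le tendsto_const_nhds hlim (fun _ => zero_le)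
    fun n => ?_
  calc ‖∫ x, k n x‖ₑ ≤ ∫⁻ x, ‖k n x‖ₑ := enorm_integral_le_lintegral_enorm _
    _ ≤ ∫⁻ x, ‖w x‖ₑ * ‖f n x‖ₑ := by
        refine lintegral_mono_ae ?_
        filter_upwards [hk n] with x hx
        have e : ‖w x‖ₑ * ‖f n x‖ₑ = ‖w x * ‖f n x‖‖ₑ := by rw [enorm_mul, enorm_norm]
        rw [e]
        exact enorm_le_iff_norm_le.2 (hx.trans (le_abs_self _))
    _ ≤ _ := lintegral_enorm_mul_le hw.1 (hf n)

/-- Ladyzhenskaya's inequality for test functions. -/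
theorem exists_ladyzhenskaya_smooth : ∃ C : ℝ≥0, ∀ φ : Plane → ℝ, ContDiff ℝ ∞ φ →
    HasCompactSupport φ → ∫⁻ x, ‖φ x‖ₑ ^ 4
      ≤ C * (eLpNorm φ 2 volume ^ 2 * eLpNorm (gradient φ) 2 volume ^ 2) := by
  set K := eLpNormLESNormFDerivOneConst (volume : Measure Plane) (2 : ℝ≥0) with hK
  refine ⟨(K * 2) ^ 2, fun φ hφ hc => ?_⟩
  have hp : NNReal.HolderConjugate (Module.finrank ℝ Plane) 2 := by
    rw [finrank_euclideanSpace_fin]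
    exact NNReal.HolderConjugate.two_two
  have hφ1 : ContDiff ℝ 1 φ := hφ.of_le (by simp)
  -- In dimension two $W^{1,1}$ embeds in $L^2$. Applied to $\varphi^2$, with
  -- $\nabla(\varphi^2)=2\varphi\nabla\varphi$ and Cauchy–Schwarz, this is the inequality.
  have h := eLpNorm_le_eLpNorm_fderiv_one (volume : Measure Plane) (u := fun x => φ x ^ 2)
    (hφ1.pow 2) (hc.comp_left (g := fun t => t ^ 2) (by simp)) hp
  have h1 : eLpNorm (fderiv ℝ fun x => φ x ^ 2) 1 volume
      ≤ 2 * (eLpNorm φ 2 volume * eLpNorm (gradient φ) 2 volume) := by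
    rw [eLpNorm_one_eq_lintegral_enorm]
    calc ∫⁻ x, ‖fderiv ℝ (fun x => φ x ^ 2) x‖ₑ
        = ∫⁻ x, 2 * (‖φ x‖ₑ * ‖gradient φ x‖ₑ) := by
          refine lintegral_congr fun x => ?_
          have : fderiv ℝ (fun x => φ x ^ 2) x = (2 * φ x) • fderiv ℝ φ x := by
            have := ((hφ.differentiable (by simp) x).hasFDerivAt.pow 2).fderiv
            simpa using this
          have hg : ‖gradient φ x‖ₑ = ‖fderiv ℝ φ x‖ₑ := by
            rw [← ofReal_norm, ← ofReal_norm, norm_gradient]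
          rw [this, enorm_smul, enorm_mul, hg, mul_assoc]
          congr 1
          rw [Real.enorm_of_nonneg (by norm_num)]; simp
      _ = 2 * ∫⁻ x, ‖φ x‖ₑ * ‖gradient φ x‖ₑ := by
          rw [lintegral_const_mul' _ _ (by norm_num)]
      _ ≤ _ := by
          gcongr
          exact lintegral_enorm_mul_le hφ.continuous.aestronglyMeasurable
            (continuous_gradient hφ).aestronglyMeasurable
  have h2 : ∫⁻ x, ‖φ x‖ₑ ^ 4 = eLpNorm (fun x => φ x ^ 2) ((2 : ℝ≥0) : ℝ≥0∞) volume ^ 2 := by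
    have e := eLpNorm_two_sq (fun x => φ x ^ 2)
    simp only [ENNReal.coe_ofNat]
    rw [e]
    refine lintegral_congr fun x => ?_
    rw [enorm_pow, ← pow_mul]
  rw [h2]
  calc _ ≤ ((K : ℝ≥0∞) * (2 * (eLpNorm φ 2 volume * eLpNorm (gradient φ) 2 volume))) ^ 2 := by
        gcongr
        exact h.trans (mul_le_mul_right h1 _)
    _ = _ := by push_cast; ring

theorem eLpNorm_two_le_add {F : Type*} [NormedAddCommGroup F] {a b : Plane → F}
    (ha : AEStronglyMeasurable a volume) (hb : AEStronglyMeasurable b volume) :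
    eLpNorm a 2 volume ≤ eLpNorm b 2 volume + eLpNorm (fun x => a x - b x) 2 volume := by
  calc eLpNorm a 2 volume = eLpNorm (b + fun x => a x - b x) 2 volume := by
        congr 1; ext x; simp
    _ ≤ _ := eLpNorm_add_le hb (ha.sub hb) (by norm_num)

/-- Ladyzhenskaya's inequality in `H¹(ℝ²)`. -/
theorem exists_ladyzhenskaya : ∃ C : ℝ≥0, ∀ (u : Plane → ℝ) (g : Plane → Plane),
    MemLp u 2 volume → MemLp g 2 volume → IsWeakGradient u g →
    ∫⁻ x, ‖u x‖ₑ ^ 4 ≤ C * (eLpNorm u 2 volume ^ 2 * eLpNorm g 2 volume ^ 2) := by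
  obtain ⟨C, hC⟩ := exists_ladyzhenskaya_smooth
  refine ⟨C, fun u g hu hg h => ?_⟩
  obtain ⟨φ, hs, hc, -, l1, l2, ae1, -⟩ := exists_smooth_seq hu hg h
  have b1 : Tendsto (fun n => (C : ℝ≥0∞) *
      ((eLpNorm u 2 volume + eLpNorm (fun x => φ n x - u x) 2 volume) ^ 2 *
        (eLpNorm g 2 volume + eLpNorm (fun x => gradient (φ n) x - g x) 2 volume) ^ 2)) atTop
      (𝓝 (C * (eLpNorm u 2 volume ^ 2 * eLpNorm g 2 volume ^ 2))) := by
    have t1 := (ENNReal.continuous_pow 2).tendsto _ |>.comp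
      ((tendsto_const_nhds (x := eLpNorm u 2 volume)).add l1)
    have t2 := (ENNReal.continuous_pow 2).tendsto _ |>.comp
      ((tendsto_const_nhds (x := eLpNorm g 2 volume)).add l2)
    simp only [add_zero] at t1 t2
    have f1 : eLpNorm u 2 volume ^ 2 ≠ ⊤ := ENNReal.pow_ne_top hu.2.ne
    have f2 : eLpNorm g 2 volume ^ 2 ≠ ⊤ := ENNReal.pow_ne_top hg.2.ne
    exact ENNReal.Tendsto.const_mul (ENNReal.Tendsto.mul t1 (Or.inr f2) t2 (Or.inr f1))
      (Or.inr ENNReal.coe_ne_top)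
  -- Fatou along the almost everywhere convergent approximants, since their convergence in $L^4$ is
  -- not yet known.
  calc ∫⁻ x, ‖u x‖ₑ ^ 4 = ∫⁻ x, liminf (fun n => ‖φ n x‖ₑ ^ 4) atTop := by
        refine lintegral_congr_ae ?_
        filter_upwards [ae1] with x hx
        exact (((ENNReal.continuous_pow 4).tendsto _).comp hx.enorm).liminf_eq.symm
    _ ≤ liminf (fun n => ∫⁻ x, ‖φ n x‖ₑ ^ 4) atTop :=
        lintegral_liminf_le fun n => ((hs n).continuous.enorm.measurable.pow_const 4)
    _ ≤ liminf (fun n => (C : ℝ≥0∞) *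
      ((eLpNorm u 2 volume + eLpNorm (fun x => φ n x - u x) 2 volume) ^ 2 *
        (eLpNorm g 2 volume + eLpNorm (fun x => gradient (φ n) x - g x) 2 volume) ^ 2)) atTop := by
        refine liminf_le_liminf (Eventually.of_forall fun n => (hC _ (hs n) (hc n)).trans ?_)
        gcongr
        · exact eLpNorm_two_le_add (hs n).continuous.aestronglyMeasurable hu.1
        · exact eLpNorm_two_le_add (continuous_gradient (hs n)).aestronglyMeasurable hg.1
    _ = _ := b1.liminf_eq

theorem eLpNorm_translate {F : Type*} [NormedAddCommGroup F] {f : Plane → F}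
    (hf : AEStronglyMeasurable f volume) (z : Plane) :
    eLpNorm (fun x => f (x - z)) 2 volume = eLpNorm f 2 volume :=
  eLpNorm_comp_measurePreserving hf (measurePreserving_sub_right volume z)

/-- The increment is the integral of the directional derivative along the segment from $x$ to $x-z$.
Cauchy–Schwarz in the segment parameter, Tonelli and translation invariance do the rest. -/
theorem eLpNorm_translate_sub_le_smooth {φ : Plane → ℝ} (hφ : ContDiff ℝ ∞ φ) (z : Plane) :
    eLpNorm (fun x => φ (x - z) - φ x) 2 volume
      ≤ ‖z‖ₑ * eLpNorm (gradient φ) 2 volume := by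
  have cg := continuous_gradient hφ
  have hpt : ∀ x, ‖φ (x - z) - φ x‖ₑ ^ 2
      ≤ ‖z‖ₑ ^ 2 * ∫⁻ t in Ioc (0 : ℝ) 1, ‖gradient φ (x - t • z)‖ₑ ^ 2 := by
    intro x
    have hd : ∀ t ∈ uIcc (0 : ℝ) 1,
        HasDerivAt (fun t : ℝ => φ (x - t • z)) (fderiv ℝ φ (x - t • z) (-z)) t := by
      intro t _
      have h1 := (hφ.differentiable (by simp) (x - t • z)).hasFDerivAt
      have h2 : HasDerivAt (fun t : ℝ => x - t • z) (-z) t := by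
        simpa using ((hasDerivAt_id t).smul_const z).const_sub x
      exact h1.comp_hasDerivAt t h2
    have hcont : Continuous fun t : ℝ => fderiv ℝ φ (x - t • z) (-z) := by
      have := hφ.continuous_fderiv (by simp)
      fun_prop
    have ftc := intervalIntegral.integral_eq_sub_of_hasDerivAt hd
      (hcont.intervalIntegrable 0 1)
    simp only [one_smul, zero_smul, sub_zero] at ftc
    rw [← ftc, intervalIntegral.integral_of_le zero_le_one]
    have mg : Measurable fun t : ℝ => ‖gradient φ (x - t • z)‖ₑ :=
      (cg.comp (by fun_prop : Continuous fun t : ℝ => x - t • z)).enorm.measurable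
    have cs := ENNReal.lintegral_mul_le_Lp_mul_Lq (volume.restrict (Ioc (0 : ℝ) 1))
      Real.HolderConjugate.two_two (f := fun _ => 1) aemeasurable_const mg.aemeasurable
    simp only [Pi.mul_apply, one_mul, ENNReal.one_rpow, lintegral_const, MeasurableSet.univ,
      Measure.restrict_apply, univ_inter, Real.volume_Ioc, sub_zero, ENNReal.ofReal_one] at cs
    calc _ ≤ (∫⁻ t in Ioc (0 : ℝ) 1, ‖fderiv ℝ φ (x - t • z) (-z)‖ₑ) ^ 2 := by
          gcongr; exact enorm_integral_le_lintegral_enorm _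
      _ ≤ (∫⁻ t in Ioc (0 : ℝ) 1, ‖z‖ₑ * ‖gradient φ (x - t • z)‖ₑ) ^ 2 := by
          gcongr with t
          rw [← inner_gradient_left]
          have := norm_inner_le_norm (𝕜 := ℝ) (gradient φ (x - t • z)) (-z)
          rw [norm_neg, mul_comm] at this
          rw [← enorm_norm z, ← enorm_norm (gradient φ _), ← enorm_mul]
          exact enorm_le_iff_norm_le.2 (this.trans (le_abs_self _))
      _ = ‖z‖ₑ ^ 2 * (∫⁻ t in Ioc (0 : ℝ) 1, ‖gradient φ (x - t • z)‖ₑ) ^ 2 := by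
          rw [lintegral_const_mul' _ _ enorm_ne_top, mul_pow]
      _ ≤ ‖z‖ₑ ^ 2 * ((∫⁻ t in Ioc (0 : ℝ) 1, ‖gradient φ (x - t • z)‖ₑ ^ (2 : ℝ))
            ^ ((1 : ℝ) / 2)) ^ 2 := by
          gcongr
      _ = _ := by
          rw [← ENNReal.rpow_natCast _ 2, ← ENNReal.rpow_natCast _ 2, ← ENNReal.rpow_mul]
          norm_num
  rw [← ENNReal.pow_le_pow_left_iff two_ne_zero, mul_pow, eLpNorm_two_sq]
  calc ∫⁻ x, ‖φ (x - z) - φ x‖ₑ ^ 2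
      ≤ ∫⁻ x, ‖z‖ₑ ^ 2 * ∫⁻ t in Ioc (0 : ℝ) 1, ‖gradient φ (x - t • z)‖ₑ ^ 2 :=
        lintegral_mono hpt
    _ = ‖z‖ₑ ^ 2 * ∫⁻ x, ∫⁻ t in Ioc (0 : ℝ) 1, ‖gradient φ (x - t • z)‖ₑ ^ 2 :=
        lintegral_const_mul' _ _ (ENNReal.pow_ne_top enorm_ne_top)
    _ = ‖z‖ₑ ^ 2 * ∫⁻ t in Ioc (0 : ℝ) 1, ∫⁻ x, ‖gradient φ (x - t • z)‖ₑ ^ 2 := by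
        congr 1
        apply lintegral_lintegral_swap
        have : Continuous fun p : Plane × ℝ => gradient φ (p.1 - p.2 • z) :=
          cg.comp (by fun_prop)
        exact (this.enorm.measurable.pow_const 2).aemeasurable
    _ = ‖z‖ₑ ^ 2 * ∫⁻ t in Ioc (0 : ℝ) 1, eLpNorm (gradient φ) 2 volume ^ 2 := by
        congr 1
        refine lintegral_congr fun t => ?_
        rw [← eLpNorm_two_sq (fun x => gradient φ (x - t • z)),
          eLpNorm_translate cg.aestronglyMeasurable]
    _ = _ := by simp

/-- Translation estimate in `H¹`. -/
theorem eLpNorm_translate_sub_le {u : Plane → ℝ} {g : Plane → Plane} (hu : MemLp u 2 volume)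
    (hg : MemLp g 2 volume) (h : IsWeakGradient u g) (z : Plane) :
    eLpNorm (fun x => u (x - z) - u x) 2 volume ≤ ‖z‖ₑ * eLpNorm g 2 volume := by
  obtain ⟨φ, hs, -, -, l1, l2, -, -⟩ := exists_smooth_seq hu hg h
  have ms : ∀ n, AEStronglyMeasurable (φ n) volume := fun n =>
    (hs n).continuous.aestronglyMeasurable
  have mu : AEStronglyMeasurable (fun x => u (x - z)) volume :=
    hu.1.comp_measurePreserving (measurePreserving_sub_right volume z)
  have mφ : ∀ n, AEStronglyMeasurable (fun x => φ n (x - z)) volume := fun n =>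
    (ms n).comp_measurePreserving (measurePreserving_sub_right volume z)
  have b : ∀ n, eLpNorm (fun x => u (x - z) - u x) 2 volume
      ≤ ‖z‖ₑ * (eLpNorm g 2 volume + eLpNorm (fun x => gradient (φ n) x - g x) 2 volume)
        + (eLpNorm (fun x => φ n x - u x) 2 volume
          + eLpNorm (fun x => φ n x - u x) 2 volume) := by
    intro n
    refine (eLpNorm_two_le_add (mu.sub hu.1) ((mφ n).sub (ms n))).trans (add_le_add ?_ ?_)
    · refine (eLpNorm_translate_sub_le_smooth (hs n) z).trans ?_
      gcongr
      exact eLpNorm_two_le_add (continuous_gradient (hs n)).aestronglyMeasurable hg.1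
    · have e : (fun x => u (x - z) - u x - (φ n (x - z) - φ n x))
          = (fun x => φ n x - u x) - fun x => φ n (x - z) - u (x - z) := by
        ext x; simp only [Pi.sub_apply]; ring
      change eLpNorm (fun x => u (x - z) - u x - (φ n (x - z) - φ n x)) 2 volume ≤ _
      rw [e]
      refine (eLpNorm_sub_le ((ms n).sub hu.1) ((mφ n).sub mu) (by norm_num)).trans_eq ?_
      congr 1
      exact eLpNorm_translate ((ms n).sub hu.1) z
  have t := (ENNReal.Tendsto.const_mul ((tendsto_const_nhds (x := eLpNorm g 2 volume)).add l2)
    (Or.inr (enorm_ne_top (x := z)))).add (l1.add l1)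
  simp only [add_zero] at t
  exact ge_of_tendsto' t b

/-- Chain rule for nonnegative `H¹` functions. -/
theorem IsWeakGradient.comp_of_nonneg {u : Plane → ℝ} {g : Plane → Plane}
    (h : IsWeakGradient u g) (hu : MemLp u 2 volume) (hg : MemLp g 2 volume)
    (hpos : ∀ᵐ x, 0 ≤ u x) {f f' : ℝ → ℝ} {K : ℝ} (hd : ∀ t, 0 ≤ t → HasDerivAt f (f' t) t)
    (hc' : ContinuousOn f' (Ici 0)) (hK : ∀ t, 0 ≤ t → |f' t| ≤ K) :
    IsWeakGradient (fun x => f (u x)) (fun x => f' (u x) • g x) := by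
  obtain ⟨φ, hs, hc, hp, l1, l2, ae1, ae2⟩ := exists_smooth_seq hu hg h
  -- The approximants inherit nonnegativity, so `f` and `f'` are evaluated only on $[0,\infty)$,
  -- where alone they are controlled.
  replace hp := hp hpos
  have hK0 : 0 ≤ K := (abs_nonneg _).trans (hK 0 le_rfl)
  have lip : ∀ s t, 0 ≤ s → 0 ≤ t → ‖f s - f t‖ ≤ K * ‖s - t‖ := fun s t hs ht =>
    (convex_Ici (0 : ℝ)).norm_image_sub_le_of_norm_hasDerivWithin_le
      (fun x hx => (hd x hx).hasDerivWithinAt) (fun x hx => hK x hx) ht hs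
  have hfc : ContinuousOn f (Ici 0) := fun t ht => (hd t ht).continuousAt.continuousWithinAt
  have hgrad : ∀ n x, HasFDerivAt (fun y => f (φ n y)) (f' (φ n x) • fderiv ℝ (φ n) x) x :=
    fun n x => (hd _ (hp n x)).comp_hasFDerivAt x
      ((hs n).differentiable (by simp) x).hasFDerivAt
  have cF' : ∀ n, Continuous fun x => f' (φ n x) := fun n =>
    hc'.comp_continuous (hs n).continuous (hp n)
  have cF : ∀ n, Continuous fun x => f (φ n x) := fun n =>
    hfc.comp_continuous (hs n).continuous (hp n)
  have C1 : ∀ n, ContDiff ℝ 1 fun x => f (φ n x) := by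
    intro n
    rw [contDiff_one_iff_fderiv]
    refine ⟨fun x => (hgrad n x).differentiableAt, ?_⟩
    have : fderiv ℝ (fun x => f (φ n x)) = fun x => f' (φ n x) • fderiv ℝ (φ n) x :=
      funext fun x => (hgrad n x).fderiv
    rw [this]
    exact (cF' n).smul ((hs n).continuous_fderiv (by simp))
  have gr : ∀ n x, gradient (fun y => f (φ n y)) x = f' (φ n x) • gradient (φ n) x := by
    intro n x
    rw [gradient, (hgrad n x).fderiv, map_smul]; rfl
  -- measurability of the limits
  have mF : AEStronglyMeasurable (fun x => f (u x)) volume :=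
    aestronglyMeasurable_of_tendsto_ae atTop (fun n => (cF n).aestronglyMeasurable) (by
      filter_upwards [ae1, hpos] with x hx h0
      exact (hd _ h0).continuousAt.tendsto.comp hx)
  have aeF' : ∀ᵐ x, Tendsto (fun n => f' (φ n x)) atTop (𝓝 (f' (u x))) := by
    filter_upwards [ae1, hpos] with x hx h0
    exact (hc' _ h0).tendsto.comp (tendsto_nhdsWithin_iff.2 ⟨hx, Eventually.of_forall (hp · x)⟩)
  have mF' : AEStronglyMeasurable (fun x => f' (u x)) volume :=
    aestronglyMeasurable_of_tendsto_ae atTop (fun n => (cF' n).aestronglyMeasurable) aeF'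
  have lF : LocallyIntegrable (fun x => f (u x)) := by
    have : LocallyIntegrable fun x => ‖f 0‖ + K * ‖u x‖ :=
      (locallyIntegrable_const _).add
        ((hu.norm.const_mul K).locallyIntegrable (p := 2) (by norm_num))
    refine this.mono mF ?_
    filter_upwards [hpos] with x h0
    have := lip (u x) 0 h0 le_rfl
    rw [sub_zero] at this
    calc ‖f (u x)‖ ≤ ‖f 0‖ + ‖f (u x) - f 0‖ := by
          have := norm_add_le (f 0) (f (u x) - f 0); simpa using this
      _ ≤ ‖f 0‖ + K * ‖u x‖ := by gcongr
      _ ≤ _ := le_abs_self _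
  have mg' : MemLp (fun x => f' (u x) • g x) 2 volume := by
    refine (hg.norm.const_mul K).of_le (mF'.smul hg.1) ?_
    filter_upwards [hpos] with x h0
    rw [norm_smul]
    calc ‖f' (u x)‖ * ‖g x‖ ≤ K * ‖g x‖ := by gcongr; exact hK _ h0
      _ ≤ _ := le_abs_self _
  intro ψ hψ hψc
  have hψ2 : MemLp ψ 2 volume := hψ.continuous.memLp_of_hasCompactSupport hψc
  have hgψ2 : MemLp (gradient ψ) 2 volume :=
    (continuous_gradient hψ).memLp_of_hasCompactSupport (hasCompactSupport_gradient hψc)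
  have e : ∀ n, ∫ x, f (φ n x) • gradient ψ x = -∫ x, ψ x • f' (φ n x) • gradient (φ n) x := by
    intro n
    have := isWeakGradient_gradient (C1 n) ψ hψ hψc
    simpa only [gr] using this
  have iL : ∀ n, Integrable fun x => f (φ n x) • gradient ψ x := fun n =>
    ((cF n).smul (continuous_gradient hψ)).integrable_of_hasCompactSupport
      (hasCompactSupport_gradient hψc).smul_left
  have iL' : Integrable fun x => f (u x) • gradient ψ x :=
    lF.integrable_smul_right_of_hasCompactSupport (continuous_gradient hψ)
      (hasCompactSupport_gradient hψc)
  have iR : ∀ n, Integrable fun x => ψ x • f' (φ n x) • gradient (φ n) x := fun n =>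
    (hψ.continuous.smul ((cF' n).smul (continuous_gradient (hs n)))).integrable_of_hasCompactSupport
      (hasCompactSupport_smul_right hψc)
  have iM : ∀ n, Integrable fun x => ψ x • f' (φ n x) • g x := fun n =>
    ((hg.locallyIntegrable (p := 2) (by norm_num)).integrable_smul_left_of_hasCompactSupport
      (hψ.continuous.mul (cF' n)) (hasCompactSupport_smul_right hψc)).congr
      (Eventually.of_forall fun x => mul_smul _ _ _)
  have t1 : Tendsto (fun n => ∫ x, f (φ n x) • gradient ψ x) atTop
      (𝓝 (∫ x, f (u x) • gradient ψ x)) := by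
    rw [← tendsto_sub_nhds_zero_iff]
    simp_rw [← integral_sub (iL _) iL', ← sub_smul]
    refine tendsto_integral_of_eLpNorm_two (f := fun n x => φ n x - u x)
      (w := fun x => K * ‖gradient ψ x‖)
      (fun n => (hs n).continuous.aestronglyMeasurable.sub hu.1) (hgψ2.norm.const_mul K)
      (fun n => ?_) l1
    filter_upwards [hpos] with x h0
    rw [norm_smul]
    calc _ ≤ (K * ‖φ n x - u x‖) * ‖gradient ψ x‖ := by gcongr; exact lip _ _ (hp n x) h0
      _ = _ := by ring
  have t2 : Tendsto (fun n => ∫ x, ψ x • f' (φ n x) • gradient (φ n) x) atTop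
      (𝓝 (∫ x, ψ x • f' (u x) • g x)) := by
    -- Split $f'(\varphi_n)\nabla\varphi_n=f'(\varphi_n)g+f'(\varphi_n)(\nabla\varphi_n-g)$:
    -- dominated convergence handles the first term, boundedness of `f'` and $L^2$ convergence of
    -- the gradients the second.
    have s1 : Tendsto (fun n => ∫ x, ψ x • f' (φ n x) • g x) atTop
        (𝓝 (∫ x, ψ x • f' (u x) • g x)) := by
      refine tendsto_integral_of_dominated_convergence (fun x => ‖ψ x‖ * (K * ‖g x‖))
        (fun n => (iM n).1) ?_ (fun n => Eventually.of_forall fun x => ?_) ?_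
      · exact (hψ2.norm.integrable_mul (hg.norm.const_mul K))
      · rw [norm_smul, norm_smul]
        gcongr
        exact hK _ (hp n x)
      · filter_upwards [aeF'] with x hx
        exact (hx.smul_const _).const_smul _
    have s2 : Tendsto (fun n => ∫ x, ψ x • f' (φ n x) • (gradient (φ n) x - g x)) atTop
        (𝓝 0) := by
      refine tendsto_integral_of_eLpNorm_two (f := fun n x => gradient (φ n) x - g x)
        (w := fun x => K * ‖ψ x‖)
        (fun n => (continuous_gradient (hs n)).aestronglyMeasurable.sub hg.1)
        (hψ2.norm.const_mul K) (fun n => Eventually.of_forall fun x => ?_) l2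
      rw [norm_smul, norm_smul]
      calc _ ≤ ‖ψ x‖ * (K * ‖gradient (φ n) x - g x‖) := by gcongr; exact hK _ (hp n x)
        _ = _ := by ring
    have := s2.add s1
    rw [zero_add] at this
    refine this.congr fun n => ?_
    simp_rw [smul_sub]
    rw [integral_sub (iR n) (iM n)]
    abel
  exact tendsto_nhds_unique t1 ((t2.neg).congr fun n => (e n).symm)

/-- A locally integrable function with vanishing weak gradient is constant. -/
theorem IsWeakGradient.ae_const_of_zero {f : Plane → ℝ} (hf : LocallyIntegrable f)
    (h : IsWeakGradient f 0) : ∃ c, ∀ᵐ x, f x = c := by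
  have hb : ∀ n : ℕ, ∃ ρ : ContDiffBump (0 : Plane), ρ.rOut < 1 / ((n : ℝ) + 1) ∧
      ρ.rOut ≤ 2 * ρ.rIn := fun n => exists_contDiffBump_rOut_lt (by positivity)
  choose ρ h1 h2 using hb
  have l0 : Tendsto (fun n => (ρ n).rOut) atTop (𝓝 0) :=
    tendsto_of_tendsto_of_tendsto_of_le_of_le tendsto_const_nhds
      tendsto_one_div_add_atTop_nhds_zero_nat (fun n => (ρ n).rOut_pos.le) fun n => (h1 n).le
  have ae := ContDiffBump.ae_convolution_tendsto_right_of_locallyIntegrable l0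
    (Eventually.of_forall h2) hf
  -- Each mollification is smooth with zero gradient, hence constant, and the mollifications
  -- converge to `f` at almost every point.
  have hconst : ∀ n x, mollify (ρ n) f x = mollify (ρ n) f 0 := by
    intro n x
    have hs := mollify_contDiff (ρ n) hf
    refine is_const_of_fderiv_eq_zero (𝕜 := ℝ) (hs.differentiable (by simp)) (fun y => ?_) x 0
    rw [← norm_eq_zero, ← norm_gradient, gradient_mollify (ρ n) hf h, mollify_apply]
    simp
  obtain ⟨x₀, hx₀⟩ := ae.exists
  refine ⟨f x₀, ?_⟩
  filter_upwards [ae] with x hx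
  refine tendsto_nhds_unique hx (hx₀.congr fun n => ?_)
  exact (hconst n x₀).trans (hconst n x).symm

end GP

/-! ### Finite-net criterion for small $L^2$ norm; weak limits along ultrafilters. -/

namespace GP

open scoped ENNReal NNReal

/-- Cauchy–Schwarz with the translated kernel. Applied to a weak gradient, it gives the
mollification a Lipschitz constant depending only on the $L^2$ norm of that gradient. -/
theorem enorm_mollify_le {F : Type*} [NormedAddCommGroup F] [NormedSpace ℝ F]
    (ρ : ContDiffBump (0 : Plane)) {f : Plane → F} (hf : AEStronglyMeasurable f volume)
    (x : Plane) : ‖mollify ρ f x‖ₑ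
      ≤ eLpNorm (ρ.normed volume) 2 volume * eLpNorm f 2 volume := by
  have hc : Continuous (ρ.normed (volume : Measure Plane)) := ρ.continuous_normed
  have e : eLpNorm (fun y => ρ.normed volume (x - y)) 2 volume
      = eLpNorm (ρ.normed volume) 2 volume :=
    eLpNorm_comp_measurePreserving (g := ρ.normed volume) (f := fun y => x - y)
      hc.aestronglyMeasurable (Measure.measurePreserving_sub_left volume x)
  rw [mollify_apply', ← e]
  refine (enorm_integral_le_lintegral_enorm _).trans ?_
  simp_rw [enorm_smul]
  exact lintegral_enorm_mul_le (hc.comp (by fun_prop)).aestronglyMeasurable hf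

/-- Quantitative local compactness: an `H¹` function with small tail and small mollification
on a finite set has small `L²` norm. -/
theorem exists_finite_net {C ε R : ℝ} (hC : 0 < C) (hε : 0 < ε) :
    ∃ (ρ : ContDiffBump (0 : Plane)) (S : Set Plane) (η : ℝ), S.Finite ∧ 0 < η ∧
      ∀ (w : Plane → ℝ) (g : Plane → Plane), MemLp w 2 volume → MemLp g 2 volume →
        IsWeakGradient w g → eLpNorm g 2 volume ≤ ENNReal.ofReal C →
        eLpNorm w 2 (volume.restrict (Metric.closedBall 0 R)ᶜ) ≤ ENNReal.ofReal ε →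
        (∀ s ∈ S, |mollify ρ w s| ≤ η) → eLpNorm w 2 volume ≤ ENNReal.ofReal (3 * ε) := by
  -- With radius below $\varepsilon/C$, translations inside the kernel's support, and hence the
  -- mollification, move an admissible function by at most $\varepsilon$ in $L^2$.
  obtain ⟨ρ, hρ, -⟩ := exists_contDiffBump_rOut_lt (show 0 < ε / C by positivity)
  set B : Set Plane := Metric.closedBall 0 R with hB
  have hBc : IsCompact B := isCompact_closedBall _ _
  have hBm : MeasurableSet B := hBc.isClosed.measurableSet
  have hρ2 : MemLp (ρ.normed (volume : Measure Plane)) 2 volume :=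
    ρ.continuous_normed.memLp_of_hasCompactSupport ρ.hasCompactSupport_normed
  set L : ℝ := (eLpNorm (ρ.normed (volume : Measure Plane)) 2 volume).toReal * C with hL
  have hL0 : 0 ≤ L := by positivity
  set b : ℝ := (volume B).toReal ^ ((1 : ℝ) / 2) with hb
  have hb0 : 0 ≤ b := by positivity
  -- A function bounded by $2\eta$ on the ball has $L^2$ norm there at most $2\eta b\le\varepsilon$,
  -- where $b$ is the square root of the area; the `+ 1` keeps the denominator positive.
  set η : ℝ := ε / (2 * (b + 1)) with hη
  have hη0 : 0 < η := by positivity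
  -- The mollification is $L$-Lipschitz, so between a point of the ball and a nearby net point it
  -- changes by at most $\eta$.
  obtain ⟨S, -, hSf, hScov⟩ := hBc.finite_cover_balls (show 0 < η / (L + 1) by positivity)
  refine ⟨ρ, S, η, hSf, hη0, fun w g hw hg h hgC htail hS => ?_⟩
  have lw := hw.locallyIntegrable (p := 2) (by norm_num)
  have hs := mollify_contDiff ρ lw
  have hgrad : ∀ x, ‖fderiv ℝ (mollify ρ w) x‖ ≤ L := by
    intro x
    rw [← norm_gradient, gradient_mollify ρ lw h]
    have h1 := (enorm_mollify_le ρ hg.1 x).trans (mul_le_mul_right hgC _)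
    rw [← ENNReal.ofReal_toReal hρ2.2.ne, ← ENNReal.ofReal_mul ENNReal.toReal_nonneg,
      ← ofReal_norm, ENNReal.ofReal_le_ofReal_iff hL0] at h1
    exact h1
  have hsup : ∀ x ∈ B, ‖mollify ρ w x‖ ≤ 2 * η := by
    intro x hx
    obtain ⟨s, hs', hxs⟩ := mem_iUnion₂.1 (hScov hx)
    have hl := convex_univ.norm_image_sub_le_of_norm_fderiv_le (𝕜 := ℝ)
      (fun y _ => hs.differentiable (by simp) y) (fun y _ => hgrad y) (mem_univ s) (mem_univ x)
    have hd : ‖x - s‖ ≤ η / (L + 1) := by rw [← dist_eq_norm]; exact (Metric.mem_ball.1 hxs).le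
    have hm : L * (η / (L + 1)) ≤ η := by
      rw [← mul_div_assoc, div_le_iff₀ (by positivity)]; nlinarith
    have h1 := hS s hs'
    calc ‖mollify ρ w x‖ = ‖mollify ρ w s + (mollify ρ w x - mollify ρ w s)‖ := by
          congr 1; ring
      _ ≤ ‖mollify ρ w s‖ + ‖mollify ρ w x - mollify ρ w s‖ := norm_add_le _ _
      _ ≤ η + L * (η / (L + 1)) := add_le_add h1 (hl.trans (by gcongr))
      _ ≤ 2 * η := by linarith
  have e1 : eLpNorm (fun x => mollify ρ w x - w x) 2 volume ≤ ENNReal.ofReal ε := by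
    refine eLpNorm_mollify_sub_le ρ lw fun z hz => (eLpNorm_translate_sub_le hw hg h z).trans ?_
    have hz' : ‖z‖ₑ ≤ ENNReal.ofReal (ε / C) := by
      rw [← ofReal_norm]; exact ENNReal.ofReal_le_ofReal (hz.trans hρ).le
    calc ‖z‖ₑ * eLpNorm g 2 volume ≤ ENNReal.ofReal (ε / C) * ENNReal.ofReal C :=
          mul_le_mul' hz' hgC
      _ = ENNReal.ofReal ε := by
          rw [← ENNReal.ofReal_mul (by positivity), div_mul_cancel₀ _ hC.ne']
  have e2 : eLpNorm (mollify ρ w) 2 (volume.restrict B) ≤ ENNReal.ofReal ε := by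
    have := eLpNorm_le_of_ae_bound (p := 2) (μ := volume.restrict B) (f := mollify ρ w)
      (C := 2 * η) ((ae_restrict_iff' hBm).2 (Eventually.of_forall hsup))
    refine this.trans ?_
    rw [Measure.restrict_apply MeasurableSet.univ, univ_inter,
      ← ENNReal.ofReal_toReal hBc.measure_lt_top.ne, ENNReal.ofReal_rpow_of_nonneg
      ENNReal.toReal_nonneg (by positivity), ← ENNReal.ofReal_mul (by positivity)]
    refine ENNReal.ofReal_le_ofReal ?_
    have : (volume B).toReal ^ (ENNReal.toReal 2)⁻¹ = b := by simp [hb]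
    rw [this]
    have : 2 * η * (b + 1) = ε := by rw [hη]; field_simp
    nlinarith
  have e3 : eLpNorm w 2 (volume.restrict B) ≤ ENNReal.ofReal ε + ENNReal.ofReal ε := by
    have : w = mollify ρ w - fun x => mollify ρ w x - w x := by ext x; simp
    calc eLpNorm w 2 (volume.restrict B)
        = eLpNorm (mollify ρ w - fun x => mollify ρ w x - w x) 2 (volume.restrict B) := by
          rw [← this]
      _ ≤ _ := eLpNorm_sub_le hs.continuous.aestronglyMeasurable
          (hs.continuous.aestronglyMeasurable.sub hw.1.restrict) (by norm_num)
      _ ≤ _ := add_le_add e2 ((eLpNorm_mono_measure _ Measure.restrict_le_self).trans e1)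
  have hsplit : w = B.indicator w + Bᶜ.indicator w := by
    rw [indicator_self_add_compl]
  calc eLpNorm w 2 volume = eLpNorm (B.indicator w + Bᶜ.indicator w) 2 volume := by
        rw [← hsplit]
    _ ≤ _ := eLpNorm_add_le (hw.1.indicator hBm) (hw.1.indicator hBm.compl) (by norm_num)
    _ = eLpNorm w 2 (volume.restrict B) + eLpNorm w 2 (volume.restrict Bᶜ) := by
        rw [eLpNorm_indicator_eq_eLpNorm_restrict hBm,
          eLpNorm_indicator_eq_eLpNorm_restrict hBm.compl]
    _ ≤ _ := add_le_add e3 htail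
    _ = _ := by
        rw [← ENNReal.ofReal_add hε.le hε.le, ← ENNReal.ofReal_add (by positivity) hε.le]
        congr 1; ring

/-- Bounded families in a Hilbert space converge weakly along ultrafilters. -/
theorem exists_weak_limit {ι H : Type*} [NormedAddCommGroup H] [InnerProductSpace ℝ H]
    [CompleteSpace H] (U : Ultrafilter ι) (f : ι → H) {C : ℝ} (hC : ∀ᶠ i in U, ‖f i‖ ≤ C) :
    ∃ g : H, ∀ h : H, Tendsto (fun i => inner ℝ (f i) h) U (𝓝 (inner ℝ g h)) := by
  have hC0 : 0 ≤ C := by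
    obtain ⟨i, hi⟩ := hC.exists
    exact (norm_nonneg _).trans hi
  -- Bounded reals converge along an ultrafilter, so no subsequence or separability is needed. The
  -- limits depend linearly and boundedly on `h`, and Riesz representation gives the weak limit.
  have hlim : ∀ h : H, ∃ l : ℝ, |l| ≤ C * ‖h‖ ∧ Tendsto (fun i => inner ℝ (f i) h) U (𝓝 l) := by
    intro h
    have hcomp : IsCompact (Icc (-(C * ‖h‖)) (C * ‖h‖)) := isCompact_Icc
    obtain ⟨l, hl, hl'⟩ := hcomp.ultrafilter_le_nhds (U.map fun i => inner ℝ (f i) h) (by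
      rw [le_principal_iff, Ultrafilter.coe_map, mem_map]
      filter_upwards [hC] with i hi
      rw [mem_preimage, mem_Icc, ← abs_le]
      exact (abs_real_inner_le_norm _ _).trans (by gcongr))
    exact ⟨l, abs_le.2 hl, hl'⟩
  choose l hb hl using hlim
  let Λ : H →ₗ[ℝ] ℝ :=
    { toFun := l
      map_add' := fun x y => tendsto_nhds_unique (hl (x + y))
        (((hl x).add (hl y)).congr fun i => (inner_add_right _ _ _).symm)
      map_smul' := fun c x => tendsto_nhds_unique (hl (c • x))
        (((hl x).const_mul c).congr fun i => (real_inner_smul_right _ _ _).symm) }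
  let Λ' : StrongDual ℝ H := Λ.mkContinuous C hb
  refine ⟨(InnerProductSpace.toDual ℝ H).symm Λ', fun h => ?_⟩
  rw [InnerProductSpace.toDual_symm_apply]
  exact hl h

/-- The real line is regarded as a Hilbert space and tested against $1$. -/
theorem exists_tendsto_of_bounded {ι : Type*} (U : Ultrafilter ι) (f : ι → ℝ) {C : ℝ}
    (hC : ∀ᶠ i in U, |f i| ≤ C) : ∃ l : ℝ, Tendsto f U (𝓝 l) := by
  obtain ⟨g, hg⟩ := exists_weak_limit U f hC
  exact ⟨g, by simpa using hg 1⟩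

end GP

/-! ### $H^1$ as a linear space and the quartic term. -/

namespace GP

open scoped ENNReal NNReal

section SobolevSpace

theorem L2.locallyIntegrable (u : L2) : LocallyIntegrable u (volume : Measure Plane) :=
  (Lp.memLp u).locallyIntegrable (by norm_num)

theorem L2Vec.locallyIntegrable (g : L2Vec) : LocallyIntegrable g (volume : Measure Plane) :=
  (Lp.memLp g).locallyIntegrable (by norm_num)

theorem IsWeakGradient.add_Lp {u v : L2} {g k : L2Vec} (hu : IsWeakGradient u g)
    (hv : IsWeakGradient v k) : IsWeakGradient (u + v : L2) (g + k : L2Vec) := by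
  refine IsWeakGradient.congr (u := fun x => u x + v x) (g := fun x => g x + k x) ?_
    (Lp.coeFn_add u v).symm (Lp.coeFn_add g k).symm
  intro φ hφ hc
  have i : ∀ w : L2, Integrable fun x => w x • gradient φ x := fun w =>
    w.locallyIntegrable.integrable_smul_right_of_hasCompactSupport (continuous_gradient hφ)
      (hasCompactSupport_gradient hc)
  have j : ∀ w : L2Vec, Integrable fun x => φ x • w x := fun w =>
    w.locallyIntegrable.integrable_smul_left_of_hasCompactSupport hφ.continuous hc
  simp_rw [add_smul, smul_add]
  rw [integral_add (i u) (i v), integral_add (j g) (j k), hu φ hφ hc, hv φ hφ hc, neg_add]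

theorem IsWeakGradient.smul_Lp {u : L2} {g : L2Vec} (hu : IsWeakGradient u g) (c : ℝ) :
    IsWeakGradient (c • u : L2) (c • g : L2Vec) := by
  refine IsWeakGradient.congr (u := fun x => c • u x) (g := fun x => c • g x) ?_
    (Lp.coeFn_smul c u).symm (Lp.coeFn_smul c g).symm
  intro φ hφ hc
  simp_rw [smul_assoc, smul_comm _ c, integral_smul]
  rw [hu φ hφ hc, smul_neg]

theorem MemH1.weakGrad_eq {u : L2} {g : L2Vec} (h : IsWeakGradient u g) : weakGrad u = g :=
  (MemH1.isWeakGradient ⟨g, h⟩).unique h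

theorem MemH1.add {u v : L2} (hu : MemH1 u) (hv : MemH1 v) : MemH1 (u + v) :=
  ⟨_, hu.isWeakGradient.add_Lp hv.isWeakGradient⟩

theorem MemH1.smul {u : L2} (hu : MemH1 u) (c : ℝ) : MemH1 (c • u) :=
  ⟨_, hu.isWeakGradient.smul_Lp c⟩

theorem weakGrad_add {u v : L2} (hu : MemH1 u) (hv : MemH1 v) :
    weakGrad (u + v) = weakGrad u + weakGrad v :=
  MemH1.weakGrad_eq (hu.isWeakGradient.add_Lp hv.isWeakGradient)

theorem weakGrad_smul {u : L2} (hu : MemH1 u) (c : ℝ) : weakGrad (c • u) = c • weakGrad u :=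
  MemH1.weakGrad_eq (hu.isWeakGradient.smul_Lp c)

theorem integral_sq_eq_norm_sq (u : L2) : ∫ x, u x ^ 2 = ‖u‖ ^ 2 := by
  rw [← real_inner_self_eq_norm_sq, L2.inner_def]
  refine integral_congr_ae (Eventually.of_forall fun x => ?_)
  simp [sq]

theorem integral_norm_weakGrad_sq (g : L2Vec) : ∫ x, ‖g x‖ ^ 2 = ‖g‖ ^ 2 := by
  rw [← real_inner_self_eq_norm_sq, L2.inner_def]
  refine integral_congr_ae (Eventually.of_forall fun x => ?_)
  simp

theorem eLpNorm_coe {F : Type*} [NormedAddCommGroup F] (u : Lp F 2 (volume : Measure Plane)) :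
    eLpNorm u 2 volume = ENNReal.ofReal ‖u‖ := by
  rw [Lp.norm_def, ENNReal.ofReal_toReal (Lp.eLpNorm_ne_top u)]

/-- `∫ |u|⁴`. -/
noncomputable def quartic (u : L2) : ℝ := ∫ x, u x ^ 4

theorem quartic_nonneg (u : L2) : 0 ≤ quartic u := integral_nonneg fun x => by positivity

theorem eLpNorm_four_pow (f : Plane → ℝ) : eLpNorm f 4 volume ^ 4 = ∫⁻ x, ‖f x‖ₑ ^ 4 := by
  have := eLpNorm_nnreal_pow_eq_lintegral (f := f) (p := 4) (μ := (volume : Measure Plane))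
    (by norm_num)
  simpa using this

theorem quartic_eq (u : L2) : quartic u = (eLpNorm u 4 volume).toReal ^ 4 := by
  rw [← ENNReal.toReal_pow, eLpNorm_four_pow, quartic, integral_eq_lintegral_of_nonneg_ae
    (f := fun x => u x ^ 4) (Eventually.of_forall fun x => by positivity)
    ((Lp.aestronglyMeasurable u).pow 4)]
  congr 1
  refine lintegral_congr fun x => ?_
  rw [← Real.enorm_of_nonneg (by positivity), enorm_pow]

/-- Ladyzhenskaya's inequality in terms of `L2`. -/
theorem exists_quartic_le : ∃ C : ℝ, 0 ≤ C ∧ ∀ u : L2, MemH1 u →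
    MemLp u 4 volume ∧ quartic u ≤ C * (‖u‖ ^ 2 * ‖weakGrad u‖ ^ 2) := by
  obtain ⟨C, hC⟩ := exists_ladyzhenskaya
  refine ⟨C, C.2, fun u hu => ?_⟩
  have h := hC u (weakGrad u) (Lp.memLp u) (Lp.memLp _) hu.isWeakGradient
  rw [eLpNorm_coe, eLpNorm_coe, ← eLpNorm_four_pow, ← ENNReal.ofReal_pow (norm_nonneg _),
    ← ENNReal.ofReal_pow (norm_nonneg _), ← ENNReal.ofReal_mul (by positivity),
    ← ENNReal.ofReal_coe_nnreal, ← ENNReal.ofReal_mul (NNReal.coe_nonneg C)] at h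
  have hfin : eLpNorm u 4 volume ^ 4 < ⊤ := h.trans_lt ENNReal.ofReal_lt_top
  refine ⟨⟨Lp.aestronglyMeasurable u, ?_⟩, ?_⟩
  · simpa using hfin
  · rw [quartic_eq, ← ENNReal.toReal_pow]
    exact ENNReal.toReal_le_of_le_ofReal (by positivity) h

theorem MemH1.memLp_four {u : L2} (hu : MemH1 u) : MemLp u 4 volume :=
  exists_quartic_le.choose_spec.2 u hu |>.1

theorem MemH1.integrable_pow_four {u : L2} (hu : MemH1 u) : Integrable fun x => u x ^ 4 := by
  have := hu.memLp_four.integrable_norm_pow (p := 4) (by norm_num)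
  refine this.congr (Eventually.of_forall fun x => ?_)
  simp only [Real.norm_eq_abs]
  exact Even.pow_abs (by decide) _

/-- Pointwise, the product is at most the fourth power of the larger factor. This covers the mixed
terms in the expansion of $\int(u+tv)^4$. -/
theorem MemH1.integrable_mul_four {u v : L2} (hu : MemH1 u) (hv : MemH1 v) {i j : ℕ}
    (hij : i + j = 4) : Integrable fun x => u x ^ i * v x ^ j := by
  refine (hu.integrable_pow_four.add hv.integrable_pow_four).mono'
    (((Lp.aestronglyMeasurable u).pow i).mul ((Lp.aestronglyMeasurable v).pow j))
    (Eventually.of_forall fun x => ?_)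
  rw [norm_mul, norm_pow, norm_pow]
  set s := ‖u x‖
  set t := ‖v x‖
  have hs : 0 ≤ s := norm_nonneg _
  have ht : 0 ≤ t := norm_nonneg _
  have e1 : u x ^ 4 = s ^ 4 := (Even.pow_abs (by decide) _).symm
  have e2 : v x ^ 4 = t ^ 4 := (Even.pow_abs (by decide) _).symm
  simp only [Pi.add_apply]
  rw [e1, e2]
  rcases le_total s t with h | h
  · calc s ^ i * t ^ j ≤ t ^ i * t ^ j := by gcongr
      _ = t ^ 4 := by rw [← pow_add, hij]
      _ ≤ _ := le_add_of_nonneg_left (by positivity)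
  · calc s ^ i * t ^ j ≤ s ^ i * s ^ j := by gcongr
      _ = s ^ 4 := by rw [← pow_add, hij]
      _ ≤ _ := le_add_of_nonneg_right (by positivity)

theorem quartic_smul (c : ℝ) (u : L2) : quartic (c • u) = c ^ 4 * quartic u := by
  rw [quartic, quartic, ← integral_const_mul]
  refine integral_congr_ae ?_
  filter_upwards [Lp.coeFn_smul c u] with x hx
  rw [hx]; simp [mul_pow]

theorem quartic_add_smul {u v : L2} (hu : MemH1 u) (hv : MemH1 v) (t : ℝ) :
    quartic (u + t • v) = quartic u + 4 * t * (∫ x, u x ^ 3 * v x)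
      + 6 * t ^ 2 * (∫ x, u x ^ 2 * v x ^ 2) + 4 * t ^ 3 * (∫ x, u x * v x ^ 3)
      + t ^ 4 * quartic v := by
  have i1 : Integrable fun x => u x ^ 3 * v x := by
    simpa using hu.integrable_mul_four hv (i := 3) (j := 1) rfl
  have i2 : Integrable fun x => u x ^ 2 * v x ^ 2 :=
    hu.integrable_mul_four hv (i := 2) (j := 2) rfl
  have i3 : Integrable fun x => u x * v x ^ 3 := by
    simpa using hu.integrable_mul_four hv (i := 1) (j := 3) rfl
  have e : quartic (u + t • v) = ∫ x, (u x ^ 4 + 4 * t * (u x ^ 3 * v x)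
      + 6 * t ^ 2 * (u x ^ 2 * v x ^ 2) + 4 * t ^ 3 * (u x * v x ^ 3) + t ^ 4 * v x ^ 4) := by
    refine integral_congr_ae ?_
    filter_upwards [Lp.coeFn_add u (t • v), Lp.coeFn_smul t v] with x h1 h2
    rw [h1, Pi.add_apply, h2, Pi.smul_apply, smul_eq_mul]
    ring
  have j1 : Integrable fun x => u x ^ 4 + 4 * t * (u x ^ 3 * v x) :=
    hu.integrable_pow_four.add (i1.const_mul (4 * t))
  have j2 : Integrable fun x => u x ^ 4 + 4 * t * (u x ^ 3 * v x)
      + 6 * t ^ 2 * (u x ^ 2 * v x ^ 2) := j1.add (i2.const_mul (6 * t ^ 2))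
  have j3 : Integrable fun x => u x ^ 4 + 4 * t * (u x ^ 3 * v x)
      + 6 * t ^ 2 * (u x ^ 2 * v x ^ 2) + 4 * t ^ 3 * (u x * v x ^ 3) :=
    j2.add (i3.const_mul (4 * t ^ 3))
  rw [e, integral_add j3 (hv.integrable_pow_four.const_mul _),
    integral_add j2 (i3.const_mul _), integral_add j1 (i2.const_mul _),
    integral_add hu.integrable_pow_four (i1.const_mul _)]
  simp only [integral_const_mul]
  rfl

theorem abs_quartic_root_sub_le {u v : L2} (hu : MemH1 u) (hv : MemH1 v) :
    |(eLpNorm u 4 volume).toReal - (eLpNorm v 4 volume).toReal|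
      ≤ (eLpNorm (u - v : L2) 4 volume).toReal := by
  have key : ∀ {u v : L2}, MemH1 u → MemH1 v → (eLpNorm u 4 volume).toReal
      ≤ (eLpNorm v 4 volume).toReal + (eLpNorm (u - v : L2) 4 volume).toReal := by
    intro u v hu hv
    have hs : MemLp (u - v : L2) 4 volume :=
      (memLp_congr_ae (Lp.coeFn_sub u v)).2 (hu.memLp_four.sub hv.memLp_four)
    rw [← ENNReal.toReal_add hv.memLp_four.2.ne hs.2.ne]
    refine ENNReal.toReal_mono (ENNReal.add_ne_top.2 ⟨hv.memLp_four.2.ne, hs.2.ne⟩) ?_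
    calc eLpNorm u 4 volume = eLpNorm ((v : Plane → ℝ) + ((u - v : L2) : Plane → ℝ)) 4 volume := by
          refine eLpNorm_congr_ae ?_
          filter_upwards [Lp.coeFn_sub u v] with x hx
          rw [Pi.add_apply, hx, Pi.sub_apply, add_sub_cancel]
      _ ≤ _ := eLpNorm_add_le hv.memLp_four.1 hs.1 (by norm_num)
  have e : eLpNorm (v - u : L2) 4 volume = eLpNorm (u - v : L2) 4 volume := by
    rw [eLpNorm_congr_ae (Lp.coeFn_sub v u), eLpNorm_congr_ae (Lp.coeFn_sub u v),
      eLpNorm_sub_comm]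
  have k1 := key hu hv
  have k2 := key hv hu
  rw [e] at k2
  exact abs_le.2 ⟨by linarith, by linarith⟩

/-- The quartic term is continuous along `L²`-convergent `H¹`-bounded families. -/
theorem tendsto_quartic {ι : Type*} {l : Filter ι} {u : ι → L2} {v : L2} {C : ℝ}
    (hu : ∀ᶠ i in l, MemH1 (u i)) (hv : MemH1 v) (hb : ∀ᶠ i in l, ‖weakGrad (u i)‖ ≤ C)
    (h : Tendsto u l (𝓝 v)) : Tendsto (fun i => quartic (u i)) l (𝓝 (quartic v)) := by
  obtain ⟨K, hK, hlad⟩ := exists_quartic_le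
  have hn : Tendsto (fun i => ‖u i - v‖) l (𝓝 0) := tendsto_iff_norm_sub_tendsto_zero.1 h
  -- Ladyzhenskaya's inequality for the difference: its $L^2$ factor tends to zero while its
  -- gradient factor stays bounded.
  have h4 : Tendsto (fun i => (eLpNorm (u i - v : L2) 4 volume).toReal ^ 4) l (𝓝 0) := by
    have hlim : Tendsto (fun i => K * (‖u i - v‖ ^ 2 * (C + ‖weakGrad v‖) ^ 2)) l (𝓝 0) := by
      simpa using ((hn.pow 2).mul_const ((C + ‖weakGrad v‖) ^ 2)).const_mul K
    refine tendsto_of_tendsto_of_tendsto_of_le_of_le' tendsto_const_nhds hlim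
      (Eventually.of_forall fun i => by positivity) ?_
    filter_upwards [hu, hb] with i h1 h2
    have hneg : u i - v = u i + (-1 : ℝ) • v := by rw [neg_one_smul, sub_eq_add_neg]
    have hm : MemH1 (u i - v) := by rw [hneg]; exact h1.add (hv.smul _)
    have hg : ‖weakGrad (u i - v)‖ ≤ C + ‖weakGrad v‖ := by
      rw [hneg, weakGrad_add h1 (hv.smul _), weakGrad_smul hv]
      refine (norm_add_le _ _).trans ?_
      rw [neg_one_smul, norm_neg]
      gcongr
    rw [← quartic_eq]
    refine (hlad _ hm).2.trans ?_
    gcongr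
  have h1 : Tendsto (fun i => (eLpNorm (u i - v : L2) 4 volume).toReal) l (𝓝 0) := by
    have := h4.rpow_const (p := (1 : ℝ) / 4) (Or.inr (by norm_num))
    rw [Real.zero_rpow (by norm_num)] at this
    refine this.congr fun i => ?_
    rw [← Real.rpow_natCast, ← Real.rpow_mul ENNReal.toReal_nonneg]
    norm_num
  have h2 : Tendsto (fun i => (eLpNorm (u i) 4 volume).toReal) l
      (𝓝 (eLpNorm v 4 volume).toReal) := by
    rw [tendsto_iff_norm_sub_tendsto_zero]
    refine tendsto_of_tendsto_of_tendsto_of_le_of_le' tendsto_const_nhds h1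
      (Eventually.of_forall fun i => norm_nonneg _) ?_
    filter_upwards [hu] with i hi
    exact abs_quartic_root_sub_le hi hv
  simpa only [quartic_eq] using h2.pow 4

end SobolevSpace

/-! ### The energy space and its quadratic form. -/

section EnergySpace

variable {V : Plane → ℝ}

/-- The quadratic part `∫ |∇u|² + V |u|²` of the energy. -/
noncomputable def quadEnergy (V : Plane → ℝ) (u : L2) : ℝ :=
  ∫ x, (‖weakGrad u x‖ ^ 2 + V x * u x ^ 2)

/-- The symmetric bilinear form `∫ ∇u·∇v + V u v`. -/
noncomputable def energyForm (V : Plane → ℝ) (u v : L2) : ℝ :=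
  ∫ x, (inner ℝ (weakGrad u x) (weakGrad v x) + V x * (u x * v x))

theorem gpEnergy_eq (V : Plane → ℝ) (a : ℝ) (u : L2) :
    gpEnergy V a u = quadEnergy V u - a / 2 * quartic u := rfl

theorem integrable_mul_L2 (u v : L2) : Integrable fun x => u x * v x :=
  (Lp.memLp u).integrable_mul (Lp.memLp v)

theorem integrable_sq_L2 (u : L2) : Integrable fun x => u x ^ 2 := by
  simpa [sq] using integrable_mul_L2 u u

theorem integrable_norm_sq_L2Vec (g : L2Vec) : Integrable fun x => ‖g x‖ ^ 2 := by
  simpa using (Lp.memLp g).integrable_norm_pow (p := 2) (by norm_num)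

theorem integrable_inner_L2Vec (g k : L2Vec) : Integrable fun x => (inner ℝ (g x) (k x) : ℝ) :=
  L2.integrable_inner g k

theorem IsTrappingPotential.integrable_mul (hV : IsTrappingPotential V) {u v : L2}
    (hu : u ∈ energySpace V) (hv : v ∈ energySpace V) :
    Integrable fun x => V x * (u x * v x) := by
  refine (hu.2.add hv.2).mono' (hV.aestronglyMeasurable.mul
    ((Lp.aestronglyMeasurable u).mul (Lp.aestronglyMeasurable v))) ?_
  filter_upwards [hV.nonneg] with x hx
  rw [norm_mul, Real.norm_of_nonneg hx, norm_mul, Pi.add_apply, ← mul_add]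
  refine mul_le_mul_of_nonneg_left ?_ hx
  rw [← sq_abs (u x), ← sq_abs (v x), Real.norm_eq_abs, Real.norm_eq_abs]
  nlinarith [sq_nonneg (|u x| - |v x|), sq_nonneg (|u x|), sq_nonneg (|v x|)]

theorem IsTrappingPotential.add_mem (hV : IsTrappingPotential V) {u v : L2}
    (hu : u ∈ energySpace V) (hv : v ∈ energySpace V) : u + v ∈ energySpace V := by
  refine ⟨hu.1.add hv.1, ?_⟩
  have := (hu.2.add ((hV.integrable_mul hu hv).const_mul 2)).add hv.2
  refine this.congr ?_
  filter_upwards [Lp.coeFn_add u v] with x hx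
  simp only [Pi.add_apply]
  rw [hx, Pi.add_apply]
  ring

theorem smul_mem_energySpace {u : L2} (hu : u ∈ energySpace V) (c : ℝ) :
    c • u ∈ energySpace V := by
  refine ⟨hu.1.smul c, (hu.2.const_mul (c ^ 2)).congr ?_⟩
  filter_upwards [Lp.coeFn_smul c u] with x hx
  rw [hx, Pi.smul_apply, smul_eq_mul]
  ring

theorem quadEnergy_eq {u : L2} (hu : u ∈ energySpace V) :
    quadEnergy V u = ‖weakGrad u‖ ^ 2 + ∫ x, V x * u x ^ 2 := by
  rw [quadEnergy, integral_add (integrable_norm_sq_L2Vec _) hu.2, integral_norm_weakGrad_sq]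

theorem IsTrappingPotential.potential_nonneg (hV : IsTrappingPotential V) (u : L2) :
    0 ≤ ∫ x, V x * u x ^ 2 :=
  integral_nonneg_of_ae (hV.nonneg.mono fun x hx => by positivity)

theorem energyForm_eq (hV : IsTrappingPotential V) {u v : L2} (hu : u ∈ energySpace V)
    (hv : v ∈ energySpace V) :
    energyForm V u v = inner ℝ (weakGrad u) (weakGrad v) + ∫ x, V x * (u x * v x) := by
  rw [energyForm, integral_add (integrable_inner_L2Vec _ _) (hV.integrable_mul hu hv),
    L2.inner_def]

theorem energyForm_self (V : Plane → ℝ) (u : L2) : energyForm V u u = quadEnergy V u := by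
  refine integral_congr_ae (Eventually.of_forall fun x => ?_)
  simp [sq]

theorem quadEnergy_smul {u : L2} (hu : u ∈ energySpace V) (c : ℝ) :
    quadEnergy V (c • u) = c ^ 2 * quadEnergy V u := by
  rw [quadEnergy_eq hu, quadEnergy_eq (smul_mem_energySpace hu c), weakGrad_smul hu.1, norm_smul,
    mul_pow, Real.norm_eq_abs, sq_abs, mul_add, ← integral_const_mul]
  congr 1
  refine integral_congr_ae ?_
  filter_upwards [Lp.coeFn_smul c u] with x hx
  rw [hx, Pi.smul_apply, smul_eq_mul]
  ring

theorem quadEnergy_add_smul (hV : IsTrappingPotential V) {u v : L2} (hu : u ∈ energySpace V)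
    (hv : v ∈ energySpace V) (t : ℝ) : quadEnergy V (u + t • v)
      = quadEnergy V u + 2 * t * energyForm V u v + t ^ 2 * quadEnergy V v := by
  have htv := smul_mem_energySpace hv t
  rw [quadEnergy_eq (hV.add_mem hu htv), quadEnergy_eq hu, quadEnergy_eq hv,
    energyForm_eq hV hu hv, weakGrad_add hu.1 htv.1, weakGrad_smul hv.1,
    norm_add_sq_real, norm_smul, mul_pow, Real.norm_eq_abs, sq_abs, inner_smul_right]
  have e : ∫ x, V x * (u + t • v : L2) x ^ 2
      = (∫ x, V x * u x ^ 2) + 2 * t * (∫ x, V x * (u x * v x))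
        + t ^ 2 * ∫ x, V x * v x ^ 2 := by
    have j : Integrable fun x => V x * u x ^ 2 + 2 * t * (V x * (u x * v x)) :=
      hu.2.add ((hV.integrable_mul hu hv).const_mul _)
    rw [← integral_const_mul, ← integral_const_mul,
      ← integral_add hu.2 ((hV.integrable_mul hu hv).const_mul _), ← integral_add j
      (hv.2.const_mul _)]
    refine integral_congr_ae ?_
    filter_upwards [Lp.coeFn_add u (t • v), Lp.coeFn_smul t v] with x h1 h2
    rw [h1, Pi.add_apply, h2, Pi.smul_apply, smul_eq_mul]
    ring
  rw [e]
  ring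

/-- Both $Vu\varphi$ and $u\varphi$ are integrable on the energy space, so the integral splits and
$\mu$ appears as a plain coefficient. -/
theorem isWeakSolution_iff (hV : IsTrappingPotential V) {a μ : ℝ} {u : L2}
    (hu : u ∈ energySpace V) : IsWeakSolution V a μ u ↔ ∀ φ ∈ energySpace V,
      energyForm V u φ - μ * inner ℝ u φ - a * ∫ x, u x ^ 3 * φ x = 0 := by
  rw [IsWeakSolution, and_iff_right hu]
  refine forall₂_congr fun φ hφ => ?_
  have e : ∫ x, (inner ℝ (weakGrad u x) (weakGrad φ x) + (V x - μ) * u x * φ x)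
      = energyForm V u φ - μ * inner ℝ u φ := by
    have j : Integrable fun x => (inner ℝ (weakGrad u x) (weakGrad φ x) : ℝ)
        + V x * (u x * φ x) := (integrable_inner_L2Vec _ _).add (hV.integrable_mul hu hφ)
    rw [energyForm, L2.inner_def, ← integral_const_mul, ← integral_sub j
      ((L2.integrable_inner u φ).const_mul μ)]
    refine integral_congr_ae (Eventually.of_forall fun x => ?_)
    simp only [RCLike.inner_apply, conj_trivial]
    ring
  rw [e]

theorem action_eq {a μ : ℝ} {u : L2} (hu : u ∈ energySpace V) :
    action V a μ u = 1 / 2 * (quadEnergy V u - μ * ‖u‖ ^ 2) - a / 4 * quartic u := by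
  have e : ∫ x, (‖weakGrad u x‖ ^ 2 + (V x - μ) * u x ^ 2)
      = quadEnergy V u - μ * ‖u‖ ^ 2 := by
    have j : Integrable fun x => ‖weakGrad u x‖ ^ 2 + V x * u x ^ 2 :=
      (integrable_norm_sq_L2Vec _).add hu.2
    rw [quadEnergy, ← integral_sq_eq_norm_sq, ← integral_const_mul, ← integral_sub j
      ((integrable_sq_L2 u).const_mul μ)]
    refine integral_congr_ae (Eventually.of_forall fun x => ?_)
    ring
  rw [action, e]; rfl

theorem mem_unitMass_iff {u : L2} : u ∈ unitMass V ↔ u ∈ energySpace V ∧ ‖u‖ = 1 := by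
  rw [unitMass, mem_ofPred_eq, integral_sq_eq_norm_sq, pow_eq_one_iff_of_nonneg (norm_nonneg u) two_ne_zero]

end EnergySpace

end GP

/-! ### Compactness of bounded-energy families in $L^2$. -/

namespace GP

open scoped ENNReal NNReal

/-- Testing against `φ` in the direction `e` is a bounded functional on `L²`. -/
theorem exists_inner_eq_test {φ : Plane → ℝ} (hφ : ContDiff ℝ ∞ φ) (hc : HasCompactSupport φ)
    (e : Plane) : ∃ (p : L2) (q : L2Vec),
      (∀ u : L2, inner ℝ u p = inner ℝ e (∫ x, u x • gradient φ x)) ∧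
      (∀ g : L2Vec, inner ℝ g q = inner ℝ e (∫ x, φ x • g x)) := by
  have hcg := continuous_gradient hφ
  have hsg := hasCompactSupport_gradient hc
  have mp : MemLp (fun x => (inner ℝ e (gradient φ x) : ℝ)) 2 volume :=
    (continuous_const.inner hcg).memLp_of_hasCompactSupport
      (hsg.comp_left (g := fun y => (inner ℝ e y : ℝ)) (by simp))
  have mq : MemLp (fun x => φ x • e) 2 volume :=
    (hφ.continuous.smul continuous_const).memLp_of_hasCompactSupport
      (hasCompactSupport_smul_right hc)
  refine ⟨mp.toLp, mq.toLp, fun u => ?_, fun g => ?_⟩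
  · rw [L2.inner_def, ← integral_inner
      (u.locallyIntegrable.integrable_smul_right_of_hasCompactSupport hcg hsg)]
    refine integral_congr_ae ?_
    filter_upwards [mp.coeFn_toLp] with x hx
    rw [hx, inner_smul_right]
    simp [mul_comm]
  · rw [L2.inner_def, ← integral_inner
      (g.locallyIntegrable.integrable_smul_left_of_hasCompactSupport hφ.continuous hc)]
    refine integral_congr_ae ?_
    filter_upwards [mq.coeFn_toLp] with x hx
    rw [hx, inner_smul_right, inner_smul_right, real_inner_comm]

/-- Weak gradients pass to weak limits. -/
theorem IsWeakGradient.of_tendsto_inner {ι : Type*} {l : Filter ι} [l.NeBot] {u : ι → L2}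
    {g : ι → L2Vec} {v : L2} {k : L2Vec} (h : ∀ᶠ i in l, IsWeakGradient (u i) (g i))
    (hu : ∀ p, Tendsto (fun i => inner ℝ (u i) p) l (𝓝 (inner ℝ v p)))
    (hg : ∀ q, Tendsto (fun i => inner ℝ (g i) q) l (𝓝 (inner ℝ k q))) : IsWeakGradient v k := by
  intro φ hφ hc
  refine ext_inner_left ℝ fun e => ?_
  obtain ⟨p, q, hp, hq⟩ := exists_inner_eq_test hφ hc e
  rw [inner_neg_right, ← hp, ← hq]
  refine tendsto_nhds_unique (hu p) ((hg q).neg.congr' ?_)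
  filter_upwards [h] with i hi
  rw [hp, hq, hi φ hφ hc, inner_neg_right]

/-- Point values of mollifications are therefore continuous under weak $L^2$ convergence, so the
finitely many values in `exists_finite_net` can be controlled along an ultrafilter. -/
theorem exists_inner_eq_mollify (ρ : ContDiffBump (0 : Plane)) (s : Plane) :
    ∃ k : L2, ∀ u : L2, mollify ρ u s = inner ℝ u k := by
  have hcont : Continuous fun y => ρ.normed volume (s - y) :=
    ρ.continuous_normed.comp (by fun_prop)
  have m : MemLp (fun y => ρ.normed volume (s - y)) 2 volume :=
    hcont.memLp_of_hasCompactSupport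
      (ρ.hasCompactSupport_normed.comp_homeomorph (Homeomorph.subLeft s))
  refine ⟨m.toLp, fun u => ?_⟩
  rw [mollify_apply', L2.inner_def]
  refine integral_congr_ae ?_
  filter_upwards [m.coeFn_toLp] with x hx
  rw [hx]
  simp

section Compactness

variable {V : Plane → ℝ}

/-- The trapping potential controls the mass at infinity. -/
theorem IsTrappingPotential.exists_tail_le (hV : IsTrappingPotential V) {C ε : ℝ} (hC : 0 ≤ C)
    (hε : 0 < ε) : ∃ R : ℝ, ∀ w ∈ energySpace V, (∫ x, V x * w x ^ 2) ≤ C →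
      eLpNorm w 2 (volume.restrict (Metric.closedBall 0 R)ᶜ) ≤ ENNReal.ofReal ε := by
  -- Where $V\ge M$ one has $w^2\le M^{-1}Vw^2$, so the tail mass is at most $C/M\le\varepsilon^2$;
  -- $C+1$ keeps $M$ positive when $C=0$.
  set M : ℝ := (C + 1) / ε ^ 2 with hM
  have hM0 : 0 < M := by positivity
  obtain ⟨R, hR⟩ := hV.tendsto_atTop M
  refine ⟨R, fun w hw hwC => ?_⟩
  set B : Set Plane := Metric.closedBall 0 R
  have hBm : MeasurableSet Bᶜ := Metric.isClosed_closedBall.measurableSet.compl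
  have e := eLpNorm_nnreal_pow_eq_lintegral (f := w) (p := 2) (μ := volume.restrict Bᶜ)
    (by norm_num)
  have e' : eLpNorm w 2 (volume.restrict Bᶜ) ^ 2 = ∫⁻ x in Bᶜ, ‖w x‖ₑ ^ 2 := by simpa using e
  rw [← ENNReal.pow_le_pow_left_iff two_ne_zero, e']
  calc ∫⁻ x in Bᶜ, ‖w x‖ₑ ^ 2 ≤ ∫⁻ x in Bᶜ, ENNReal.ofReal (M⁻¹ * (V x * w x ^ 2)) := by
        refine lintegral_mono_ae ((ae_restrict_iff' hBm).2 ?_)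
        filter_upwards [hR] with x hx hxB
        have hxR : R ≤ ‖x‖ := by
          have : ¬ ‖x‖ ≤ R := by simpa [B] using hxB
          linarith
        rw [← enorm_pow, Real.enorm_of_nonneg (by positivity)]
        refine ENNReal.ofReal_le_ofReal ?_
        rw [le_inv_mul_iff₀ hM0]
        exact mul_le_mul_of_nonneg_right (hx hxR) (by positivity)
    _ ≤ ∫⁻ x, ENNReal.ofReal (M⁻¹ * (V x * w x ^ 2)) := lintegral_mono' Measure.restrict_le_self
        le_rfl
    _ = ENNReal.ofReal (M⁻¹ * ∫ x, V x * w x ^ 2) := by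
        rw [← integral_const_mul, ofReal_integral_eq_lintegral_ofReal (hw.2.const_mul _)]
        filter_upwards [hV.nonneg] with x hx
        positivity
    _ ≤ ENNReal.ofReal ε ^ 2 := by
        rw [← ENNReal.ofReal_pow hε.le]
        refine ENNReal.ofReal_le_ofReal ?_
        rw [inv_mul_le_iff₀ hM0, hM, div_mul_cancel₀ _ (by positivity)]
        linarith

theorem IsTrappingPotential.weakGrad_sq_le (hV : IsTrappingPotential V) {u : L2}
    (hu : u ∈ energySpace V) : ‖weakGrad u‖ ^ 2 ≤ quadEnergy V u := by
  rw [quadEnergy_eq hu]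
  linarith [hV.potential_nonneg u]

theorem potential_le_quadEnergy {u : L2}
    (hu : u ∈ energySpace V) : ∫ x, V x * u x ^ 2 ≤ quadEnergy V u := by
  rw [quadEnergy_eq hu]
  linarith [sq_nonneg ‖weakGrad u‖]

/-- The crude bound $t\le t^2+1$ replaces a square root. -/
theorem IsTrappingPotential.norm_weakGrad_le (hV : IsTrappingPotential V) {u : L2} {C : ℝ}
    (hu : u ∈ energySpace V) (hC : quadEnergy V u ≤ C) : ‖weakGrad u‖ ≤ C + 1 := by
  have h := (hV.weakGrad_sq_le hu).trans hC
  nlinarith [sq_nonneg (‖weakGrad u‖ - 1), norm_nonneg (weakGrad u)]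

theorem sub_eq_add_neg_one_smul {E : Type*} [AddCommGroup E] [Module ℝ E] (u v : E) :
    u - v = u + (-1 : ℝ) • v := by
  rw [neg_one_smul, sub_eq_add_neg]

/-- Families of bounded energy are Cauchy in `L²` along ultrafilters. -/
theorem IsTrappingPotential.cauchy_of_bounded (hV : IsTrappingPotential V) {ι : Type*}
    (U : Ultrafilter ι) (u : ι → L2) {C : ℝ}
    (hu : ∀ᶠ i in U, u i ∈ energySpace V ∧ quadEnergy V (u i) ≤ C ∧ ‖u i‖ ≤ C) :
    Cauchy (map u U) := by
  have hC0 : 0 ≤ C := by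
    obtain ⟨i, -, -, hi⟩ := hu.exists
    exact (norm_nonneg _).trans hi
  rw [Metric.cauchy_iff]
  refine ⟨inferInstance, fun ε hε => ?_⟩
  -- Two tails of size $\varepsilon/8$ give $\varepsilon/4$ for a difference, and the net criterion
  -- then yields $3\varepsilon/4<\varepsilon$. The gradient bound $2(C+1)$ below is likewise the one
  -- for a difference.
  obtain ⟨R, hR⟩ := hV.exists_tail_le hC0 (show 0 < ε / 8 by positivity)
  obtain ⟨ρ, S, η, hSf, hη, hnet⟩ := exists_finite_net (R := R)
    (show 0 < 2 * (C + 1) by positivity) (show 0 < ε / 4 by positivity)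
  have hlim : ∀ s, ∃ l : ℝ, ∀ᶠ i in U, |mollify ρ (u i) s - l| ≤ η / 2 := by
    intro s
    obtain ⟨k, hk⟩ := exists_inner_eq_mollify ρ s
    obtain ⟨g, hg⟩ := exists_weak_limit U u (hu.mono fun i hi => hi.2.2)
    refine ⟨inner ℝ g k, ?_⟩
    filter_upwards [Metric.tendsto_nhds.1 (hg k) (η / 2) (by positivity)] with i hi
    rw [hk]
    exact hi.le
  choose l hl using hlim
  have hall : ∀ᶠ i in U, ∀ s ∈ S, |mollify ρ (u i) s - l s| ≤ η / 2 :=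
    (eventually_all_finite hSf).2 fun s _ => hl s
  have hT : {i | (u i ∈ energySpace V ∧ quadEnergy V (u i) ≤ C ∧ ‖u i‖ ≤ C) ∧
      ∀ s ∈ S, |mollify ρ (u i) s - l s| ≤ η / 2} ∈ U := hu.and hall
  refine ⟨u '' _, image_mem_map hT, ?_⟩
  rintro _ ⟨i, ⟨⟨hi1, hi2, -⟩, hi3⟩, rfl⟩ _ ⟨j, ⟨⟨hj1, hj2, -⟩, hj3⟩, rfl⟩
  have hm : MemH1 (u i - u j) := by
    rw [sub_eq_add_neg_one_smul]; exact hi1.1.add (hj1.1.smul _)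
  have hgr : weakGrad (u i - u j) = weakGrad (u i) - weakGrad (u j) := by
    rw [sub_eq_add_neg_one_smul, weakGrad_add hi1.1 (hj1.1.smul _), weakGrad_smul hj1.1,
      ← sub_eq_add_neg_one_smul]
  have key := hnet (u i - u j : L2) (weakGrad (u i - u j)) (Lp.memLp _) (Lp.memLp _)
    hm.isWeakGradient ?_ ?_ ?_
  · rw [eLpNorm_coe, ENNReal.ofReal_le_ofReal_iff (by positivity)] at key
    rw [dist_eq_norm]
    linarith
  · rw [eLpNorm_coe, hgr]
    refine ENNReal.ofReal_le_ofReal ((norm_sub_le _ _).trans ?_)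
    linarith [hV.norm_weakGrad_le hi1 hi2, hV.norm_weakGrad_le hj1 hj2]
  · have t1 := hR (u i) hi1 ((potential_le_quadEnergy hi1).trans hi2)
    have t2 := hR (u j) hj1 ((potential_le_quadEnergy hj1).trans hj2)
    rw [eLpNorm_congr_ae (ae_restrict_of_ae (Lp.coeFn_sub (u i) (u j)))]
    refine (eLpNorm_sub_le (Lp.aestronglyMeasurable _).restrict
      (Lp.aestronglyMeasurable _).restrict (by norm_num)).trans ((add_le_add t1 t2).trans_eq ?_)
    rw [← ENNReal.ofReal_add (by positivity) (by positivity)]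
    congr 1; ring
  · intro s hs
    obtain ⟨k, hk⟩ := exists_inner_eq_mollify ρ s
    have h1 := hi3 s hs
    have h2 := hj3 s hs
    rw [hk] at h1 h2
    rw [hk, inner_sub_left]
    calc |inner ℝ (u i) k - inner ℝ (u j) k|
        = |(inner ℝ (u i) k - l s) - (inner ℝ (u j) k - l s)| := by congr 1; ring
      _ ≤ _ := abs_sub _ _
      _ ≤ η := by linarith

/-- Bounded multiplication is continuous for the quadratic form `∫ W u²`. -/
theorem tendsto_integral_mul_sq {ι : Type*} {l : Filter ι} {W : Plane → ℝ} {K : ℝ}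
    (hW : AEStronglyMeasurable W volume) (hK : ∀ᵐ x, ‖W x‖ ≤ K) {u : ι → L2} {v : L2}
    (h : Tendsto u l (𝓝 v)) :
    Tendsto (fun i => ∫ x, W x * u i x ^ 2) l (𝓝 (∫ x, W x * v x ^ 2)) := by
  have hi : ∀ p q : L2, Integrable fun x => W x * (p x * q x) := fun p q =>
    (integrable_mul_L2 p q).bdd_mul hW hK
  have hb : ∀ p q : L2, |∫ x, W x * (p x * q x)| ≤ K * (‖p‖ * ‖q‖) := by
    intro p q
    have hle : ∀ᵐ x, ‖W x * p x‖ ≤ K * ‖p x‖ := by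
      filter_upwards [hK] with x hx
      rw [norm_mul]
      gcongr
    have hm : MemLp (fun x => W x * p x) 2 volume :=
      (Lp.memLp p).of_le_mul (hW.mul (Lp.aestronglyMeasurable p)) hle
    have hn : ‖hm.toLp‖ ≤ K * ‖p‖ := by
      refine Lp.norm_le_mul_norm_of_ae_le_mul ?_
      filter_upwards [hm.coeFn_toLp, hle] with x h1 h2
      rwa [h1]
    have e : ∫ x, W x * (p x * q x) = inner ℝ hm.toLp q := by
      rw [L2.inner_def]
      refine integral_congr_ae ?_
      filter_upwards [hm.coeFn_toLp] with x hx
      rw [hx]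
      simp only [RCLike.inner_apply, conj_trivial]
      ring
    rw [e, ← mul_assoc]
    exact (abs_real_inner_le_norm _ _).trans (by gcongr)
  -- The remainder comes from $u_i^2-v^2=(u_i-v)(u_i+v)$.
  have e : ∀ i, (∫ x, W x * u i x ^ 2) = (∫ x, W x * v x ^ 2)
      + ∫ x, W x * ((u i - v : L2) x * (u i + v : L2) x) := by
    intro i
    have j : Integrable fun x => W x * v x ^ 2 := by simpa only [sq] using hi v v
    rw [← integral_add j (hi _ _)]
    refine integral_congr_ae ?_
    filter_upwards [Lp.coeFn_sub (u i) v, Lp.coeFn_add (u i) v] with x h1 h2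
    rw [h1, h2, Pi.sub_apply, Pi.add_apply]
    ring
  have h0 : Tendsto (fun i => ∫ x, W x * ((u i - v : L2) x * (u i + v : L2) x)) l (𝓝 0) := by
    refine squeeze_zero_norm (fun i => hb _ _) ?_
    have t1 : Tendsto (fun i => ‖u i - v‖) l (𝓝 0) := tendsto_iff_norm_sub_tendsto_zero.1 h
    have t2 : Tendsto (fun i => ‖u i + v‖) l (𝓝 ‖v + v‖) := (h.add_const v).norm
    simpa using (t1.mul t2).const_mul K
  simp_rw [e]
  simpa using h0.const_add (∫ x, W x * v x ^ 2)

/-- Compactness of families of bounded energy, with lower semicontinuity. -/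
theorem IsTrappingPotential.exists_limit (hV : IsTrappingPotential V) {ι : Type*}
    (U : Ultrafilter ι) (u : ι → L2) {C : ℝ}
    (hu : ∀ᶠ i in U, u i ∈ unitMass V ∧ quadEnergy V (u i) ≤ C) :
    ∃ v ∈ unitMass V, Tendsto u U (𝓝 v) ∧
      Tendsto (fun i => quartic (u i)) U (𝓝 (quartic v)) ∧
      ∀ c, (∀ᶠ i in U, quadEnergy V (u i) ≤ c) → quadEnergy V v ≤ c := by
  have hu' : ∀ᶠ i in U, u i ∈ energySpace V ∧ quadEnergy V (u i) ≤ max C 1 ∧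
      ‖u i‖ ≤ max C 1 := hu.mono fun i hi =>
    ⟨hi.1.1, hi.2.trans (le_max_left _ _), (mem_unitMass_iff.1 hi.1).2.le.trans (le_max_right _ _)⟩
  obtain ⟨v, hv⟩ := CompleteSpace.complete (hV.cauchy_of_bounded U u hu')
  replace hv : Tendsto u U (𝓝 v) := hv
  have hgb : ∀ᶠ i in U, ‖weakGrad (u i)‖ ≤ C + 1 := hu.mono fun i hi =>
    hV.norm_weakGrad_le hi.1.1 hi.2
  obtain ⟨g, hg⟩ := exists_weak_limit U (fun i => weakGrad (u i)) hgb
  have hvg : IsWeakGradient v g := IsWeakGradient.of_tendsto_inner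
    (hu.mono fun i hi => hi.1.1.1.isWeakGradient) (fun p => hv.inner tendsto_const_nhds) hg
  have hvH : MemH1 v := ⟨g, hvg⟩
  obtain ⟨n, hn⟩ := exists_tendsto_of_bounded U (fun i => ‖weakGrad (u i)‖) (C := C + 1)
    (by simpa using hgb)
  -- Weak lower semicontinuity of the norm, obtained by testing the weak convergence with the limit
  -- `g`.
  have hgn : ‖g‖ ≤ n := by
    have h1 : inner ℝ g g ≤ n * ‖g‖ := le_of_tendsto_of_tendsto' (hg g) (hn.mul_const ‖g‖)
      fun i => real_inner_le_norm _ _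
    rw [real_inner_self_eq_norm_sq] at h1
    rcases (norm_nonneg g).eq_or_lt with h0 | h0
    · rw [← h0]
      exact ge_of_tendsto' hn fun i => norm_nonneg _
    · nlinarith
  obtain ⟨w, hw⟩ := exists_tendsto_of_bounded U (fun i => ∫ x, V x * u i x ^ 2) (C := C) (by
    filter_upwards [hu] with i hi
    rw [abs_of_nonneg (hV.potential_nonneg _)]
    exact (potential_le_quadEnergy hi.1.1).trans hi.2)
  have hw0 : 0 ≤ w := ge_of_tendsto' hw fun i => hV.potential_nonneg _
  -- $V$ is unbounded, so its quadratic form need not be $L^2$-continuous; the truncated forms are.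
  -- The truncation is removed by Fatou, which also gives integrability of $Vv^2$.
  have htr : ∀ k : ℕ, ∫ x, min (V x) k * v x ^ 2 ≤ w := by
    intro k
    have hWm : AEStronglyMeasurable (fun x => min (V x) k) volume :=
      hV.aestronglyMeasurable.inf aestronglyMeasurable_const
    have hWb : ∀ᵐ x, ‖min (V x) (k : ℝ)‖ ≤ k := by
      filter_upwards [hV.nonneg] with x hx
      rw [Real.norm_of_nonneg (le_min hx k.cast_nonneg)]
      exact min_le_right _ _
    refine le_of_tendsto_of_tendsto (tendsto_integral_mul_sq hWm hWb hv) hw ?_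
    filter_upwards [hu] with i hi
    refine integral_mono_ae ((integrable_sq_L2 (u i)).bdd_mul hWm hWb) hi.1.1.2
      (Eventually.of_forall fun x => ?_)
    exact mul_le_mul_of_nonneg_right (min_le_left _ _) (by positivity)
  have hfatou : ∫⁻ x, ENNReal.ofReal (V x * v x ^ 2) ≤ ENNReal.ofReal w := by
    have hm : ∀ k : ℕ, AEStronglyMeasurable (fun x => min (V x) (k : ℝ) * v x ^ 2) volume :=
      fun k => (hV.aestronglyMeasurable.inf aestronglyMeasurable_const).mul
        ((Lp.aestronglyMeasurable v).pow 2)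
    calc ∫⁻ x, ENNReal.ofReal (V x * v x ^ 2)
        = ∫⁻ x, liminf (fun k : ℕ => ENNReal.ofReal (min (V x) k * v x ^ 2)) atTop := by
          refine lintegral_congr fun x => ?_
          refine (Tendsto.liminf_eq (tendsto_const_nhds.congr' ?_)).symm
          obtain ⟨N, hN⟩ := exists_nat_ge (V x)
          filter_upwards [eventually_ge_atTop N] with k hk
          rw [min_eq_left (hN.trans (by exact_mod_cast hk))]
      _ ≤ liminf (fun k : ℕ => ∫⁻ x, ENNReal.ofReal (min (V x) k * v x ^ 2)) atTop :=
          lintegral_liminf_le' fun k => (hm k).aemeasurable.ennreal_ofReal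
      _ ≤ ENNReal.ofReal w := by
          refine liminf_le_of_le (by isBoundedDefault) fun b hb => ?_
          obtain ⟨k, hk⟩ := hb.exists
          refine hk.trans ?_
          rw [← ofReal_integral_eq_lintegral_ofReal]
          · exact ENNReal.ofReal_le_ofReal (htr k)
          · refine (integrable_sq_L2 v).bdd_mul (c := k)
              (hV.aestronglyMeasurable.inf aestronglyMeasurable_const) ?_
            filter_upwards [hV.nonneg] with x hx
            rw [Real.norm_of_nonneg (le_min hx k.cast_nonneg)]
            exact min_le_right _ _
          · filter_upwards [hV.nonneg] with x hx
            exact mul_nonneg (le_min hx k.cast_nonneg) (by positivity)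
  have hvm : AEStronglyMeasurable (fun x => V x * v x ^ 2) volume :=
    hV.aestronglyMeasurable.mul ((Lp.aestronglyMeasurable v).pow 2)
  have hvn : ∀ᵐ x, 0 ≤ V x * v x ^ 2 := hV.nonneg.mono fun x hx => by positivity
  have hvi : Integrable fun x => V x * v x ^ 2 :=
    ⟨hvm, (hasFiniteIntegral_iff_ofReal hvn).2 (hfatou.trans_lt ENNReal.ofReal_lt_top)⟩
  have hvw : ∫ x, V x * v x ^ 2 ≤ w := by
    rw [← ofReal_integral_eq_lintegral_ofReal hvi hvn, ENNReal.ofReal_le_ofReal_iff hw0] at hfatou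
    exact hfatou
  have hvE : v ∈ energySpace V := ⟨hvH, hvi⟩
  have hnorm : ‖v‖ = 1 := by
    refine tendsto_nhds_unique hv.norm (tendsto_const_nhds.congr' ?_)
    filter_upwards [hu] with i hi
    exact (mem_unitMass_iff.1 hi.1).2.symm
  refine ⟨v, mem_unitMass_iff.2 ⟨hvE, hnorm⟩, hv,
    tendsto_quartic (hu.mono fun i hi => hi.1.1.1) hvH hgb hv, fun c hc => ?_⟩
  have hq : n ^ 2 + w ≤ c := by
    refine le_of_tendsto ((hn.pow 2).add hw) ?_
    filter_upwards [hu, hc] with i hi hic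
    rw [← quadEnergy_eq hi.1.1]
    exact hic
  rw [quadEnergy_eq hvE, MemH1.weakGrad_eq hvg]
  have : ‖g‖ ^ 2 ≤ n ^ 2 := by gcongr
  linarith

end Compactness

end GP

/-! ### Strong maximum principle by a logarithmic estimate. -/

namespace GP

open scoped ENNReal NNReal

section StrongMaximumPrinciple

variable {V : Plane → ℝ}

theorem hasDerivAt_inv_add {δ : ℝ} (hδ : 0 < δ) (t : ℝ) (ht : 0 ≤ t) :
    HasDerivAt (fun t => (t + δ)⁻¹) (-((t + δ) ^ 2)⁻¹) t := by
  have h := ((hasDerivAt_id t).add_const δ).inv (by simp only [id]; positivity)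
  refine h.congr_deriv ?_
  simp only [id]
  ring

theorem hasDerivAt_log_add {δ : ℝ} (hδ : 0 < δ) (t : ℝ) (ht : 0 ≤ t) :
    HasDerivAt (fun t => Real.log (t + δ)) ((t + δ)⁻¹) t := by
  have h := ((hasDerivAt_id t).add_const δ).log (by simp only [id]; positivity)
  simpa using h

theorem continuousOn_inv_add {δ : ℝ} (hδ : 0 < δ) :
    ContinuousOn (fun t : ℝ => (t + δ)⁻¹) (Ici 0) :=
  fun t ht => (hasDerivAt_inv_add hδ t ht).continuousAt.continuousWithinAt

theorem inv_add_le {δ : ℝ} (hδ : 0 < δ) {t : ℝ} (ht : 0 ≤ t) : (t + δ)⁻¹ ≤ δ⁻¹ :=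
  inv_anti₀ hδ (by linarith)

/-- The admissible test function `χ² / (u + δ)`. -/
theorem IsTrappingPotential.exists_test (hV : IsTrappingPotential V) {u : L2} (hu : MemH1 u)
    (hpos : ∀ᵐ x, 0 ≤ u x) {χ : Plane → ℝ} (hχ : ContDiff ℝ ∞ χ) (hc : HasCompactSupport χ)
    {δ : ℝ} (hδ : 0 < δ) : ∃ p ∈ energySpace V, (∀ᵐ x, p x = χ x ^ 2 * (u x + δ)⁻¹) ∧
      ∀ᵐ x, weakGrad p x = -(χ x ^ 2 * ((u x + δ) ^ 2)⁻¹) • weakGrad u x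
        + ((u x + δ)⁻¹ * (2 * χ x)) • gradient χ x := by
  have mu : AEStronglyMeasurable u volume := Lp.aestronglyMeasurable u
  have mq : AEStronglyMeasurable (fun x => (u x + δ)⁻¹) volume :=
    (mu.aemeasurable.add_const δ).inv.aestronglyMeasurable
  have mq' : AEStronglyMeasurable (fun x => -((u x + δ) ^ 2)⁻¹) volume :=
    ((mu.aemeasurable.add_const δ).pow_const 2).inv.neg.aestronglyMeasurable
  have hq : IsWeakGradient (fun x => (u x + δ)⁻¹) (fun x => (-((u x + δ) ^ 2)⁻¹) • weakGrad u x) := by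
    refine hu.isWeakGradient.comp_of_nonneg (Lp.memLp u) (Lp.memLp _) hpos
      (f := fun t => (t + δ)⁻¹) (f' := fun t => -((t + δ) ^ 2)⁻¹) (K := (δ ^ 2)⁻¹)
      (hasDerivAt_inv_add hδ) ?_ fun t ht => ?_
    · refine (((continuous_id.add continuous_const).pow 2).continuousOn.inv₀ ?_).neg
      intro t ht
      have : (0 : ℝ) ≤ t := ht
      change (t + δ) ^ 2 ≠ 0
      positivity
    · rw [abs_neg, abs_of_nonneg (by positivity)]
      exact inv_anti₀ (by positivity) (by gcongr; linarith)
  have bq : ∀ᵐ x, ‖(u x + δ)⁻¹‖ ≤ δ⁻¹ := by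
    filter_upwards [hpos] with x hx
    rw [Real.norm_of_nonneg (by positivity)]
    exact inv_add_le hδ hx
  have bq' : ∀ᵐ x, ‖-((u x + δ) ^ 2)⁻¹‖ ≤ (δ ^ 2)⁻¹ := by
    filter_upwards [hpos] with x hx
    rw [norm_neg, Real.norm_of_nonneg (by positivity)]
    exact inv_anti₀ (by positivity) (by gcongr; linarith)
  have lq : LocallyIntegrable (fun x => (u x + δ)⁻¹) (volume : Measure Plane) :=
    (locallyIntegrable_const δ⁻¹).mono mq (bq.mono fun x hx => hx.trans (le_abs_self _))
  have l2g : MemLp (fun x => (-((u x + δ) ^ 2)⁻¹) • weakGrad u x) 2 volume := by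
    refine (Lp.memLp (weakGrad u)).of_le_mul (c := (δ ^ 2)⁻¹)
      (mq'.smul (Lp.aestronglyMeasurable _)) ?_
    filter_upwards [bq'] with x hx
    rw [norm_smul]
    gcongr
  have hχ2 : ContDiff ℝ ∞ fun x => χ x * χ x := hχ.mul hχ
  have hc2 : HasCompactSupport fun x => χ x * χ x := hc.smul_left (f := χ)
  have hp := hq.smooth_mul lq (l2g.locallyIntegrable (by norm_num)) hχ2
  have mp : MemLp (fun x => χ x * χ x * (u x + δ)⁻¹) 2 volume := by
    refine (hχ2.continuous.memLp_of_hasCompactSupport hc2 (p := 2) (μ := volume)).of_le_mul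
      (c := δ⁻¹) (hχ2.continuous.aestronglyMeasurable.mul mq) ?_
    filter_upwards [bq] with x hx
    rw [norm_mul, mul_comm]
    gcongr
  obtain ⟨Cχ, hCχ⟩ := hc2.exists_bound_of_continuous hχ2.continuous
  have mg : MemLp (fun x => (χ x * χ x) • (-((u x + δ) ^ 2)⁻¹) • weakGrad u x
      + (u x + δ)⁻¹ • gradient (fun y => χ y * χ y) x) 2 volume := by
    refine MemLp.add ?_ ?_
    · refine l2g.of_le_mul (c := Cχ) (hχ2.continuous.aestronglyMeasurable.smul l2g.1)
        (Eventually.of_forall fun x => ?_)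
      rw [norm_smul]
      gcongr
      exact hCχ x
    · refine ((continuous_gradient hχ2).memLp_of_hasCompactSupport
        (hasCompactSupport_gradient hc2) (p := 2) (μ := volume)).of_le_mul (c := δ⁻¹)
        (mq.smul (continuous_gradient hχ2).aestronglyMeasurable) ?_
      filter_upwards [bq] with x hx
      rw [norm_smul]
      gcongr
  have hwg : IsWeakGradient mp.toLp mg.toLp := hp.congr mp.coeFn_toLp.symm mg.coeFn_toLp.symm
  obtain ⟨R, hR⟩ := hc.isCompact.isBounded.subset_closedBall (0 : Plane)
  obtain ⟨CV, hCV⟩ := hV.locallyBounded R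
  refine ⟨mp.toLp, ⟨⟨_, hwg⟩, ?_⟩, ?_, ?_⟩
  · refine ((integrable_sq_L2 mp.toLp).const_mul CV).mono'
      (hV.aestronglyMeasurable.mul ((Lp.aestronglyMeasurable _).pow 2)) ?_
    filter_upwards [hV.nonneg, hCV, mp.coeFn_toLp] with x h0 h1 h2
    rw [h2, Real.norm_of_nonneg (by positivity)]
    by_cases hx : x ∈ tsupport χ
    · refine mul_le_mul_of_nonneg_right (h1 ?_) (by positivity)
      simpa using hR hx
    · simp [image_eq_zero_of_notMem_tsupport hx]
  · filter_upwards [mp.coeFn_toLp] with x hx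
    rw [hx, sq]
  · rw [MemH1.weakGrad_eq hwg]
    filter_upwards [mg.coeFn_toLp] with x hx
    have dχ := hχ.differentiable (by simp) x
    rw [hx, gradient_mul dχ dχ, ← add_smul, smul_smul, smul_smul]
    congr 2 <;> ring

/-- The logarithmic gradient estimate for nonnegative supersolutions. -/
theorem IsTrappingPotential.exists_log_gradient_bound (hV : IsTrappingPotential V) {u : L2} {m : ℝ}
    (hu : u ∈ energySpace V) (hpos : ∀ᵐ x, 0 ≤ u x) (hm : 0 ≤ m)
    (hsup : ∀ φ ∈ energySpace V, (∀ᵐ x, 0 ≤ φ x) → 0 ≤ energyForm V u φ + m * inner ℝ u φ)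
    {χ : Plane → ℝ} (hχ : ContDiff ℝ ∞ χ) (hc : HasCompactSupport χ) :
    ∃ K : ℝ, ∀ δ : ℝ, 0 < δ →
      Integrable (fun x => χ x ^ 2 * ((u x + δ) ^ 2)⁻¹ * ‖weakGrad u x‖ ^ 2) ∧
      ∫ x, χ x ^ 2 * ((u x + δ) ^ 2)⁻¹ * ‖weakGrad u x‖ ^ 2 ≤ K := by
  obtain ⟨R, hR⟩ := hc.isCompact.isBounded.subset_closedBall (0 : Plane)
  obtain ⟨CV, hCV⟩ := hV.locallyBounded R
  set k : Plane → ℝ := fun x => 2 * ‖gradient χ x‖ ^ 2 + (|CV| + m) * χ x ^ 2 with hk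
  have ik : Integrable k := by
    have c1 : Continuous fun x => ‖gradient χ x‖ ^ 2 := (continuous_gradient hχ).norm.pow 2
    have c2 : Continuous fun x => χ x ^ 2 := hχ.continuous.pow 2
    refine Integrable.add (Integrable.const_mul ?_ 2) (Integrable.const_mul ?_ _)
    · exact c1.integrable_of_hasCompactSupport
        ((hasCompactSupport_gradient hc).comp_left (g := fun y => ‖y‖ ^ 2) (by simp))
    · exact c2.integrable_of_hasCompactSupport (hc.comp_left (g := fun y => y ^ 2) (by simp))
  -- The bound is independent of $\delta$, which is what allows $\delta\to0$ later.
  refine ⟨2 * ∫ x, k x, fun δ hδ => ?_⟩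
  obtain ⟨p, hp, hp1, hp2⟩ := hV.exists_test hu.1 hpos hχ hc hδ
  have mu : AEStronglyMeasurable u volume := Lp.aestronglyMeasurable u
  have mq' : AEStronglyMeasurable (fun x => ((u x + δ) ^ 2)⁻¹) volume :=
    ((mu.aemeasurable.add_const δ).pow_const 2).inv.aestronglyMeasurable
  obtain ⟨Cχ, hCχ⟩ := hc.exists_bound_of_continuous hχ.continuous
  have iE : Integrable (fun x => χ x ^ 2 * ((u x + δ) ^ 2)⁻¹ * ‖weakGrad u x‖ ^ 2) := by
    refine (integrable_norm_sq_L2Vec (weakGrad u)).bdd_mul (c := Cχ ^ 2 * (δ ^ 2)⁻¹)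
      ((hχ.continuous.pow 2).aestronglyMeasurable.mul mq') ?_
    filter_upwards [hpos] with x hx
    rw [norm_mul, norm_pow, Real.norm_of_nonneg (by positivity : 0 ≤ ((u x + δ) ^ 2)⁻¹)]
    gcongr
    · exact hCχ x
    · linarith
  refine ⟨iE, ?_⟩
  have h0 := hsup p hp (by
    filter_upwards [hp1, hpos] with x h1 h2
    rw [h1]; positivity)
  have iF : Integrable fun x => (inner ℝ (weakGrad u x) (weakGrad p x) : ℝ) + V x * (u x * p x) :=
    (integrable_inner_L2Vec _ _).add (hV.integrable_mul hu hp)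
  rw [energyForm, L2.inner_def, ← integral_const_mul, ← integral_add iF
    ((L2.integrable_inner u p).const_mul m)] at h0
  have h1 : ∫ x, ((inner ℝ (weakGrad u x) (weakGrad p x) : ℝ) + V x * (u x * p x)
      + m * inner ℝ (u x) (p x))
      -- Testing with $\chi^2/(u+\delta)$ produces $-\chi^2|\nabla u|^2/(u+\delta)^2$. Young's
      -- inequality absorbs the cross term into half of it, and $u/(u+\delta)\le1$ bounds the
      -- zero-order terms.
      ≤ ∫ x, (k x - 1 / 2 * (χ x ^ 2 * ((u x + δ) ^ 2)⁻¹ * ‖weakGrad u x‖ ^ 2)) := by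
    refine integral_mono_ae (iF.add ((L2.integrable_inner u p).const_mul m))
      (ik.sub (iE.const_mul _)) ?_
    filter_upwards [hp1, hp2, hpos, hV.nonneg, hCV] with x e1 e2 hux hVx hCx
    have hVχ : V x * χ x ^ 2 ≤ |CV| * χ x ^ 2 := by
      by_cases hx : x ∈ tsupport χ
      · refine mul_le_mul_of_nonneg_right ((hCx ?_).trans (le_abs_self _)) (by positivity)
        simpa using hR hx
      · simp [image_eq_zero_of_notMem_tsupport hx]
    set r : ℝ := (u x + δ)⁻¹ with hr
    have hr0 : 0 < r := by positivity
    have hr1 : u x * r ≤ 1 := by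
      rw [hr, ← div_eq_mul_inv, div_le_one (by positivity)]; linarith
    have hur : 0 ≤ u x * r := by positivity
    have er : ((u x + δ) ^ 2)⁻¹ = r ^ 2 := by rw [hr, inv_pow]
    simp only [RCLike.inner_apply, conj_trivial]
    rw [e1, e2, er, inner_add_right, inner_smul_right, inner_smul_right,
      real_inner_self_eq_norm_sq, hk]
    set N := ‖weakGrad u x‖
    set G := ‖gradient χ x‖
    have hin : inner ℝ (weakGrad u x) (gradient χ x) ≤ N * G := real_inner_le_norm _ _
    have hin' := abs_real_inner_le_norm (weakGrad u x) (gradient χ x)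
    have t1 : r * (2 * χ x) * inner ℝ (weakGrad u x) (gradient χ x)
        ≤ 1 / 2 * (χ x ^ 2 * r ^ 2 * N ^ 2) + 2 * G ^ 2 := by
      calc _ ≤ |r * (2 * χ x) * inner ℝ (weakGrad u x) (gradient χ x)| := le_abs_self _
        _ = 2 * (r * |χ x|) * |inner ℝ (weakGrad u x) (gradient χ x)| := by
            rw [abs_mul, abs_mul, abs_mul, abs_of_pos hr0, abs_two]; ring
        _ ≤ 2 * (r * |χ x|) * (N * G) := by gcongr
        _ ≤ 1 / 2 * (|χ x| ^ 2 * r ^ 2 * N ^ 2) + 2 * G ^ 2 := by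
            nlinarith [sq_nonneg (|χ x| * r * N - 2 * G)]
        _ = _ := by rw [sq_abs]
    have t2 : V x * (u x * (χ x ^ 2 * r)) ≤ |CV| * χ x ^ 2 := by
      calc V x * (u x * (χ x ^ 2 * r)) = (V x * χ x ^ 2) * (u x * r) := by ring
        _ ≤ (V x * χ x ^ 2) * 1 := by gcongr
        _ ≤ _ := by linarith
    have t3 : m * (χ x ^ 2 * r * u x) ≤ m * χ x ^ 2 := by
      gcongr
      nlinarith [sq_nonneg (χ x)]
    beta_reduce
    nlinarith
  rw [integral_sub ik (iE.const_mul _), integral_const_mul] at h1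
  linarith

/-- The strong maximum principle: a nonnegative, nontrivial supersolution is positive. -/
theorem IsTrappingPotential.ae_pos_of_supersolution (hV : IsTrappingPotential V) {u : L2} {m : ℝ}
    (hu : u ∈ energySpace V) (hpos : ∀ᵐ x, 0 ≤ u x) (hne : u ≠ 0) (hm : 0 ≤ m)
    (hsup : ∀ φ ∈ energySpace V, (∀ᵐ x, 0 ≤ φ x) → 0 ≤ energyForm V u φ + m * inner ℝ u φ) :
    ∀ᵐ x, 0 < u x := by
  have mu : AEStronglyMeasurable u volume := Lp.aestronglyMeasurable u
  -- Chosen so that $w_n=\log(u+\delta_n)/(n+1)$ equals $-1$ where $u=0$ and tends to $0$ where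
  -- $u>0$. The logarithms have locally bounded gradients in $L^2$, uniformly in $n$, so the limit
  -- `z` has zero gradient.
  set δ : ℕ → ℝ := fun n => Real.exp (-((n : ℝ) + 1)) with hδdef
  have hδ : ∀ n, 0 < δ n := fun n => Real.exp_pos _
  have hδ1 : ∀ n, δ n ≤ 1 := fun n => Real.exp_le_one_iff.2 (by linarith [n.cast_nonneg (α := ℝ)])
  have hlogδ : ∀ n, Real.log (δ n) = -((n : ℝ) + 1) := fun n => Real.log_exp _
  have hδ0 : Tendsto δ atTop (𝓝 0) := Real.tendsto_exp_atBot.comp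
    (tendsto_neg_atTop_atBot.comp (tendsto_atTop_add_const_right _ 1 tendsto_natCast_atTop_atTop))
  set w : ℕ → Plane → ℝ := fun n x => ((n : ℝ) + 1)⁻¹ * Real.log (u x + δ n) with hw
  set z : Plane → ℝ := fun x => if u x = 0 then -1 else 0 with hz
  have hlim : ∀ᵐ x, Tendsto (fun n => w n x) atTop (𝓝 (z x)) := by
    filter_upwards [hpos] with x hx
    by_cases h0 : u x = 0
    · have : ∀ n, w n x = -1 := by
        intro n
        simp only [hw, h0, zero_add, hlogδ]
        have : (n : ℝ) + 1 ≠ 0 := by positivity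
        field_simp
      simp only [this, hz, h0, if_true]
      exact tendsto_const_nhds
    · have hl : Tendsto (fun n => Real.log (u x + δ n)) atTop (𝓝 (Real.log (u x))) := by
        refine (Real.continuousAt_log h0).tendsto.comp ?_
        simpa using hδ0.const_add (u x)
      have hi : Tendsto (fun n : ℕ => ((n : ℝ) + 1)⁻¹) atTop (𝓝 0) := by
        simpa using tendsto_one_div_add_atTop_nhds_zero_nat (𝕜 := ℝ)
      simpa [hz, h0] using hi.mul hl
  have hbound : ∀ n, ∀ᵐ x, ‖w n x‖ ≤ |u x| + 2 := by
    intro n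
    filter_upwards [hpos] with x hx
    have hn : (1 : ℝ) ≤ (n : ℝ) + 1 := by linarith [n.cast_nonneg (α := ℝ)]
    have hsum : 0 < u x + δ n := by linarith [hδ n]
    rw [hw, norm_mul, norm_inv, Real.norm_of_nonneg (by positivity : (0 : ℝ) ≤ (n : ℝ) + 1),
      inv_mul_le_iff₀ (by positivity), Real.norm_eq_abs, abs_of_nonneg hx, abs_le]
    constructor
    · have : Real.log (δ n) ≤ Real.log (u x + δ n) :=
        Real.log_le_log (hδ n) (by linarith)
      rw [hlogδ] at this
      nlinarith
    · have := Real.log_le_sub_one_of_pos hsum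
      nlinarith [hδ1 n]
  have mw : ∀ n, AEStronglyMeasurable (w n) volume := fun n =>
    ((Real.measurable_log.comp_aemeasurable
      (mu.aemeasurable.add_const (δ n))).const_mul _).aestronglyMeasurable
  have mz : AEStronglyMeasurable z volume := aestronglyMeasurable_of_tendsto_ae atTop mw hlim
  have lz : LocallyIntegrable z := by
    refine (locallyIntegrable_const (1 : ℝ)).mono mz (Eventually.of_forall fun x => ?_)
    simp only [hz]
    split_ifs <;> simp
  have hzero : IsWeakGradient z 0 := by
    intro ψ hψ hψc
    have hgψ := continuous_gradient hψ
    obtain ⟨-, χ, -, hs, hc, -, -, -, hone⟩ := exists_cutoff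
    obtain ⟨R, hR⟩ := hψc.isCompact.isBounded.subset_closedBall (0 : Plane)
    obtain ⟨N, hN⟩ := exists_nat_gt R
    have hχ1 : ∀ x, x ∈ tsupport ψ → χ N x = 1 := by
      intro x hx
      have : ‖x‖ ≤ R := by simpa using hR hx
      exact (hone N x (by linarith)).1
    obtain ⟨K, hK⟩ := hV.exists_log_gradient_bound hu hpos hm hsup (hs N) (hc N)
    have hlog : ∀ n, IsWeakGradient (fun x => Real.log (u x + δ n))
        (fun x => (u x + δ n)⁻¹ • weakGrad u x) := fun n =>
      hu.1.isWeakGradient.comp_of_nonneg (Lp.memLp u) (Lp.memLp _) hpos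
        (f := fun t => Real.log (t + δ n)) (f' := fun t => (t + δ n)⁻¹) (K := (δ n)⁻¹)
        (hasDerivAt_log_add (hδ n)) (continuousOn_inv_add (hδ n)) fun t ht => by
          have := hδ n
          rw [abs_of_nonneg (by positivity)]
          exact inv_add_le (hδ n) ht
    have hψ2 : Integrable fun x => ψ x ^ 2 := by
      have c2 : Continuous fun x => ψ x ^ 2 := hψ.continuous.pow 2
      exact c2.integrable_of_hasCompactSupport (hψc.comp_left (g := fun y => y ^ 2) (by simp))
    have hb : ∀ n, ‖∫ x, ψ x • (u x + δ n)⁻¹ • weakGrad u x‖ ≤ (∫ x, ψ x ^ 2) + K := by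
      intro n
      obtain ⟨iE, hE⟩ := hK (δ n) (hδ n)
      have iS := hψ2.add iE
      calc _ ≤ ∫ x, (ψ x ^ 2 + χ N x ^ 2 * ((u x + δ n) ^ 2)⁻¹ * ‖weakGrad u x‖ ^ 2) := by
            refine norm_integral_le_of_norm_le iS (Eventually.of_forall fun x => ?_)
            rw [norm_smul, norm_smul]
            by_cases hx : x ∈ tsupport ψ
            · rw [hχ1 x hx]
              have e : ((u x + δ n) ^ 2)⁻¹ = ‖(u x + δ n)⁻¹‖ ^ 2 := by
                rw [Real.norm_eq_abs, sq_abs, inv_pow]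
              have e' : ψ x ^ 2 = ‖ψ x‖ ^ 2 := by rw [Real.norm_eq_abs, sq_abs]
              rw [e, e']
              nlinarith [sq_nonneg (‖ψ x‖ - ‖(u x + δ n)⁻¹‖ * ‖weakGrad u x‖),
                sq_nonneg ‖ψ x‖, sq_nonneg (‖(u x + δ n)⁻¹‖ * ‖weakGrad u x‖)]
            · rw [image_eq_zero_of_notMem_tsupport hx]
              simp only [norm_zero, zero_mul]
              positivity
        _ = (∫ x, ψ x ^ 2) + _ := integral_add hψ2 iE
        _ ≤ _ := by gcongr
    have hwn : ∀ n, ‖∫ x, w n x • gradient ψ x‖ ≤ ((n : ℝ) + 1)⁻¹ * ((∫ x, ψ x ^ 2) + K) := by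
      intro n
      have e : ∫ x, w n x • gradient ψ x
          = ((n : ℝ) + 1)⁻¹ • ∫ x, Real.log (u x + δ n) • gradient ψ x := by
        rw [← integral_smul]
        refine integral_congr_ae (Eventually.of_forall fun x => ?_)
        simp only [hw, mul_smul]
      rw [e, hlog n ψ hψ hψc, norm_smul, norm_neg,
        Real.norm_of_nonneg (by positivity : (0 : ℝ) ≤ ((n : ℝ) + 1)⁻¹)]
      gcongr
      exact hb n
    have t1 : Tendsto (fun n => ∫ x, w n x • gradient ψ x) atTop
        (𝓝 (∫ x, z x • gradient ψ x)) := by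
      have lb : LocallyIntegrable fun x => |u x| + 2 :=
        ((Lp.memLp u).norm.locallyIntegrable (by norm_num)).add (locallyIntegrable_const 2)
      refine tendsto_integral_of_dominated_convergence (fun x => (|u x| + 2) * ‖gradient ψ x‖)
        (fun n => (mw n).smul hgψ.aestronglyMeasurable) ?_ (fun n => ?_) ?_
      · exact lb.integrable_smul_right_of_hasCompactSupport hgψ.norm
          (hasCompactSupport_gradient hψc).norm
      · filter_upwards [hbound n] with x hx
        rw [norm_smul]
        gcongr
      · filter_upwards [hlim] with x hx
        exact hx.smul_const _
    have t2 : Tendsto (fun n => ∫ x, w n x • gradient ψ x) atTop (𝓝 0) := by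
      refine squeeze_zero_norm hwn ?_
      have hi : Tendsto (fun n : ℕ => ((n : ℝ) + 1)⁻¹) atTop (𝓝 0) := by
        simpa using tendsto_one_div_add_atTop_nhds_zero_nat (𝕜 := ℝ)
      simpa using hi.mul_const ((∫ x, ψ x ^ 2) + K)
    rw [tendsto_nhds_unique t1 t2]
    simp
  obtain ⟨c, hcst⟩ := hzero.ae_const_of_zero lz
  -- A constant `z` means that $\{u=0\}$ is null or of full measure; the latter contradicts
  -- nontriviality.
  by_cases h1 : c = 0
  · filter_upwards [hcst, hpos] with x hx h0
    refine h0.lt_of_ne fun h => ?_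
    simp [hz, ← h, h1] at hx
  · refine absurd ?_ hne
    refine (Lp.eq_zero_iff_ae_eq_zero).2 ?_
    filter_upwards [hcst] with x hx
    by_contra h
    have h' : u x ≠ 0 := h
    simp only [hz, h', if_false] at hx
    exact h1 hx.symm

end StrongMaximumPrinciple

end GP

/-! ### Minimizers, the Euler–Lagrange equation and ground states. -/

namespace GP

section GroundStates

variable {V : Plane → ℝ}

theorem groundEnergy_eq_of_mem {a : ℝ} {u : L2} (hu : u ∈ minimizers V a) :
    groundEnergy V a = gpEnergy V a u :=
  IsLeast.csInf_eq ⟨mem_image_of_mem _ hu.1, by rintro _ ⟨v, hv, rfl⟩; exact hu.2 v hv⟩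

/-- Coercivity below a value at which the energy is attained. -/
theorem groundEnergy_add_le (s : ℝ) {b : ℝ} (hb : (minimizers V b).Nonempty) {v : L2}
    (hv : v ∈ unitMass V) :
    groundEnergy V b + (b - s) / 2 * quartic v ≤ gpEnergy V s v := by
  obtain ⟨u, hu⟩ := hb
  have := hu.2 v hv
  rw [groundEnergy_eq_of_mem hu, gpEnergy_eq V s v]
  rw [gpEnergy_eq V b v] at this
  linarith

/-- The real `sInf` takes the default value $0$ on sets unbounded below, so boundedness is needed
before `groundEnergy` can serve as a lower bound. -/
theorem bddBelow_gpEnergy {s b : ℝ} (hb : (minimizers V b).Nonempty) (hs : s ≤ b) :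
    BddBelow (gpEnergy V s '' unitMass V) := by
  refine ⟨groundEnergy V b, ?_⟩
  rintro _ ⟨v, hv, rfl⟩
  have h1 := groundEnergy_add_le s hb hv
  have h2 : 0 ≤ (b - s) / 2 * quartic v := mul_nonneg (by linarith) (quartic_nonneg v)
  linarith

theorem groundEnergy_le {s b : ℝ} (hb : (minimizers V b).Nonempty) (hs : s ≤ b) {v : L2}
    (hv : v ∈ unitMass V) : groundEnergy V s ≤ gpEnergy V s v :=
  csInf_le (bddBelow_gpEnergy hb hs) (mem_image_of_mem _ hv)

/-- An energy bound controls the quadratic part below a value at which the energy is attained. -/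
theorem quadEnergy_le_of_gpEnergy_le {s b c K : ℝ} (hb : (minimizers V b).Nonempty) (hs0 : 0 ≤ s)
    (hsc : s ≤ c) (hcb : c < b) {v : L2} (hv : v ∈ unitMass V) (hK : gpEnergy V s v ≤ K) :
    quadEnergy V v ≤ K + c * ((K - groundEnergy V b) / (b - c)) := by
  have h1 := groundEnergy_add_le s hb hv
  have hq := quartic_nonneg v
  have h2 : (b - c) / 2 * quartic v ≤ K - groundEnergy V b := by
    -- Replacing $s$ by $c$ makes the bound uniform over $s\in[0,c]$, as needed when the parameter
    -- varies.
    have : (b - c) / 2 * quartic v ≤ (b - s) / 2 * quartic v := by gcongr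
    linarith
  have h3 : quartic v / 2 ≤ (K - groundEnergy V b) / (b - c) := by
    rw [le_div_iff₀ (by linarith)]; linarith
  have h4 : s / 2 * quartic v ≤ c * ((K - groundEnergy V b) / (b - c)) := by
    calc s / 2 * quartic v = s * (quartic v / 2) := by ring
      _ ≤ c * (quartic v / 2) := by gcongr
      _ ≤ _ := by gcongr; linarith
  rw [gpEnergy_eq] at hK
  linarith

/-- The energy is attained below any value at which it is attained. -/
theorem IsTrappingPotential.minimizers_nonempty (hV : IsTrappingPotential V) {s b : ℝ}
    (hb : (minimizers V b).Nonempty) (hs0 : 0 ≤ s) (hs : s < b) :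
    (minimizers V s).Nonempty := by
  have hne : (gpEnergy V s '' unitMass V).Nonempty := (hb.mono fun u hu => hu.1).image _
  obtain ⟨E, -, hE, hmem⟩ := exists_seq_tendsto_sInf hne (bddBelow_gpEnergy hb hs.le)
  choose u hu huE using hmem
  -- A nonprincipal ultrafilter replaces the extraction of subsequences from the minimizing
  -- sequence.
  have hE' : Tendsto (fun n => gpEnergy V s (u n)) (hyperfilter ℕ) (𝓝 (groundEnergy V s)) := by
    simp_rw [huE]
    exact hE.mono_left Nat.hyperfilter_le_atTop
  obtain ⟨v, hv, -, hq, hlsc⟩ := hV.exists_limit (hyperfilter ℕ) u (by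
    filter_upwards [hE'.eventually_lt_const (lt_add_one _)] with n hn
    exact ⟨hu n, quadEnergy_le_of_gpEnergy_le hb hs0 le_rfl hs (hu n) hn.le⟩)
  refine ⟨v, hv, fun w hw => le_trans ?_ (groundEnergy_le hb hs.le hw)⟩
  refine le_of_forall_pos_le_add fun ε hε => ?_
  have hlim : Tendsto (fun n => gpEnergy V s (u n) + s / 2 * quartic (u n)) (hyperfilter ℕ)
      (𝓝 (groundEnergy V s + s / 2 * quartic v)) := hE'.add (hq.const_mul _)
  have := hlsc (groundEnergy V s + s / 2 * quartic v + ε) (by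
    filter_upwards [hlim.eventually_lt_const (lt_add_of_pos_right _ hε)] with n hn
    rw [gpEnergy_eq] at hn
    linarith)
  rw [gpEnergy_eq]
  linarith

theorem unitMass_ne_zero {u : L2} (hu : u ∈ unitMass V) : u ≠ 0 := by
  rintro rfl
  have := (mem_unitMass_iff.1 hu).2
  simp at this

theorem normalize_mem_unitMass {w : L2} (hw : w ∈ energySpace V) (h0 : w ≠ 0) :
    ‖w‖⁻¹ • w ∈ unitMass V := by
  refine mem_unitMass_iff.2 ⟨smul_mem_energySpace hw _, ?_⟩
  rw [norm_smul, norm_inv, norm_norm, inv_mul_cancel₀ (norm_ne_zero_iff.2 h0)]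

/-- The homogeneous form of minimality. -/
theorem homogeneous_le_of_mem_minimizers {a : ℝ} {u w : L2} (hu : u ∈ minimizers V a)
    (hw : w ∈ energySpace V) :
    gpEnergy V a u * (‖w‖ ^ 2) ^ 2 ≤ quadEnergy V w * ‖w‖ ^ 2 - a / 2 * quartic w := by
  by_cases h0 : w = 0
  · have hq : quartic (0 : L2) = 0 := by simpa using quartic_smul 0 (0 : L2)
    simp [h0, hq]
  · have h := hu.2 _ (normalize_mem_unitMass hw h0)
    have hn : 0 < ‖w‖ := norm_pos_iff.2 h0
    rw [gpEnergy_eq V a (‖w‖⁻¹ • w), quadEnergy_smul hw, quartic_smul] at h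
    calc _ ≤ (‖w‖⁻¹ ^ 2 * quadEnergy V w - a / 2 * (‖w‖⁻¹ ^ 4 * quartic w)) * (‖w‖ ^ 2) ^ 2 := by
          gcongr
      _ = _ := by field_simp

/-- The Euler--Lagrange equation for minimizers. -/
theorem IsTrappingPotential.isWeakSolution_of_mem_minimizers (hV : IsTrappingPotential V) {a : ℝ}
    {u : L2} (hu : u ∈ minimizers V a) :
    IsWeakSolution V a (gpEnergy V a u - a / 2 * quartic u) u := by
  have huE := hu.1.1
  have hnorm := (mem_unitMass_iff.1 hu.1).2
  rw [isWeakSolution_iff hV huE]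
  intro φ hφ
  set e := gpEnergy V a u with he
  have e' : e = quadEnergy V u - a / 2 * quartic u := gpEnergy_eq V a u
  set q : ℝ → ℝ := fun t => quadEnergy V u + 2 * t * energyForm V u φ + t ^ 2 * quadEnergy V φ
  set n : ℝ → ℝ := fun t => 1 + 2 * t * inner ℝ u φ + t ^ 2 * ‖φ‖ ^ 2
  set b : ℝ → ℝ := fun t => quartic u + 4 * t * (∫ x, u x ^ 3 * φ x)
      + 6 * t ^ 2 * (∫ x, u x ^ 2 * φ x ^ 2) + 4 * t ^ 3 * (∫ x, u x * φ x ^ 3)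
      + t ^ 4 * quartic φ
  have hq : ∀ t, quadEnergy V (u + t • φ) = q t := fun t => quadEnergy_add_smul hV huE hφ t
  have hb : ∀ t, quartic (u + t • φ) = b t := fun t => quartic_add_smul huE.1 hφ.1 t
  have hn : ∀ t, ‖u + t • φ‖ ^ 2 = n t := fun t => by
    rw [norm_add_sq_real, norm_smul, inner_smul_right, mul_pow, Real.norm_eq_abs, sq_abs, hnorm]
    ring
  have dt : HasDerivAt (fun t : ℝ => t) 1 0 := hasDerivAt_id 0
  have dq : HasDerivAt q (2 * energyForm V u φ) 0 := by
    refine ((((dt.const_mul 2).mul_const (energyForm V u φ)).const_add (quadEnergy V u)).add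
      ((dt.pow 2).mul_const (quadEnergy V φ))).congr_deriv ?_
    simp
  have dn : HasDerivAt n (2 * inner ℝ u φ) 0 := by
    refine ((((dt.const_mul 2).mul_const (inner ℝ u φ)).const_add 1).add
      ((dt.pow 2).mul_const (‖φ‖ ^ 2))).congr_deriv ?_
    simp
  have db : HasDerivAt b (4 * ∫ x, u x ^ 3 * φ x) 0 := by
    refine ((((((dt.const_mul 4).mul_const (∫ x, u x ^ 3 * φ x)).const_add (quartic u)).add
      (((dt.pow 2).const_mul 6).mul_const (∫ x, u x ^ 2 * φ x ^ 2))).add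
      (((dt.pow 3).const_mul 4).mul_const (∫ x, u x * φ x ^ 3))).add
      ((dt.pow 4).mul_const (quartic φ))).congr_deriv ?_
    simp
  have dP : HasDerivAt (fun t => q t * n t - a / 2 * b t - e * n t ^ 2)
      (2 * energyForm V u φ * n 0 + q 0 * (2 * inner ℝ u φ)
        - a / 2 * (4 * ∫ x, u x ^ 3 * φ x) - e * (2 * n 0 * (2 * inner ℝ u φ))) 0 := by
    refine (((dq.mul dn).sub (db.const_mul (a / 2))).sub ((dn.pow 2).const_mul e)).congr_deriv ?_
    simp
  have hn0 : n 0 = 1 := by simp [n]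
  have hq0 : q 0 = quadEnergy V u := by simp [q]
  have hb0 : b 0 = quartic u := by simp [b]
  -- Homogeneous minimality makes this polynomial nonnegative, and it vanishes at $0$ because
  -- $\|u\|=1$. Its derivative there gives the equation, multiplier included, without
  -- differentiating a normalization.
  have hmin : IsLocalMin (fun t => q t * n t - a / 2 * b t - e * n t ^ 2) 0 := by
    refine Eventually.of_forall fun t => ?_
    have h := homogeneous_le_of_mem_minimizers hu
      (hV.add_mem huE (smul_mem_energySpace hφ t))
    rw [hq, hb, hn] at h
    beta_reduce
    rw [hn0, hq0, hb0]
    linarith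
  have key := hmin.hasDerivAt_eq_zero dP
  rw [hn0, hq0] at key
  rw [e'] at key ⊢
  linear_combination key / 2

theorem IsWeakSolution.quadEnergy_eq (hV : IsTrappingPotential V) {a μ : ℝ} {v : L2}
    (hv : IsWeakSolution V a μ v) : quadEnergy V v = μ * ‖v‖ ^ 2 + a * quartic v := by
  have h := (isWeakSolution_iff hV hv.1).1 hv v hv.1
  rw [energyForm_self, real_inner_self_eq_norm_sq] at h
  have e : ∫ x, v x ^ 3 * v x = quartic v :=
    integral_congr_ae (Eventually.of_forall fun x => by ring)
  rw [e] at h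
  linarith

/-- By the identity from testing with `v` itself, the quadratic part cancels; comparing actions of
solutions becomes comparing quartic terms. -/
theorem IsWeakSolution.action_eq (hV : IsTrappingPotential V) {a μ : ℝ} {v : L2}
    (hv : IsWeakSolution V a μ v) : action V a μ v = a / 4 * quartic v := by
  rw [GP.action_eq hv.1, hv.quadEnergy_eq hV]
  ring

theorem quartic_pos {u : L2} (hu : MemH1 u) (h0 : u ≠ 0) : 0 < quartic u := by
  refine (quartic_nonneg u).lt_of_ne fun h => h0 ?_
  rw [Lp.eq_zero_iff_ae_eq_zero]
  have := (integral_eq_zero_iff_of_nonneg (fun x => by positivity)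
    hu.integrable_pow_four).1 h.symm
  filter_upwards [this] with x hx
  simpa using hx

/-- The derivative of the ground state energy determines the quartic term of minimizers. -/
theorem deriv_groundEnergy_eq {a b e' : ℝ} (ha : 0 < a) (hab : a < b)
    (hb : (minimizers V b).Nonempty) (hd : HasDerivWithinAt (groundEnergy V) e' (Ici 0) a)
    {u : L2} (hu : u ∈ minimizers V a) : e' = -(quartic u / 2) := by
  have hd' : HasDerivAt (groundEnergy V) e' a := hd.hasDerivAt (Ici_mem_nhds ha)
  have h2 : HasDerivAt (fun s => groundEnergy V s + s * (quartic u / 2))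
      (e' + 1 * (quartic u / 2)) a := hd'.add ((hasDerivAt_id a).mul_const _)
  -- $e(s)\le E_s(u)=e(a)-\tfrac{s-a}2B(u)$, with equality at $s=a$. Attainment at $b>a$ makes this
  -- valid on both sides of $a$.
  have hmax : IsLocalMax (fun s => groundEnergy V s + s * (quartic u / 2)) a := by
    filter_upwards [Iio_mem_nhds hab] with s hs
    have h3 := groundEnergy_le hb (le_of_lt hs) hu.1
    rw [groundEnergy_eq_of_mem hu]
    rw [gpEnergy_eq] at h3 ⊢
    linarith
  have := hmax.hasDerivAt_eq_zero h2
  linarith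

/-- Minimizers are exactly the ground states, for positive interaction strength. -/
theorem IsTrappingPotential.minimizers_eq_groundStates (hV : IsTrappingPotential V) {a e' : ℝ}
    (ha : 0 < a) (hne : (minimizers V a).Nonempty)
    (he : ∀ u ∈ minimizers V a, e' = -(quartic u / 2)) :
    (∀ u ∈ minimizers V a, IsWeakSolution V a (groundEnergy V a + a * e') u) ∧
      minimizers V a = groundStates V a (groundEnergy V a + a * e') := by
  set μ := groundEnergy V a + a * e' with hμ
  have hsol : ∀ u ∈ minimizers V a, IsWeakSolution V a μ u := by
    intro u hu
    have h := hV.isWeakSolution_of_mem_minimizers hu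
    have e : μ = gpEnergy V a u - a / 2 * quartic u := by
      rw [hμ, groundEnergy_eq_of_mem hu, he u hu]; ring
    rwa [e]
  obtain ⟨u₀, hu₀⟩ := hne
  -- Insert $Q(v)=\mu\|v\|^2+aB(v)$ and $e(a)=\mu+\tfrac a2B(u_0)$ into the homogeneous inequality
  -- and divide by $a/2$.
  have hle : ∀ v ∈ nontrivialSolutions V a μ,
      quartic u₀ * (‖v‖ ^ 2) ^ 2 ≤ quartic v * (2 * ‖v‖ ^ 2 - 1) := by
    rintro v ⟨hv0, hv⟩
    have h := homogeneous_le_of_mem_minimizers hu₀ hv.1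
    rw [hv.quadEnergy_eq hV] at h
    have e : gpEnergy V a u₀ = μ + a / 2 * quartic u₀ := by
      rw [hμ, groundEnergy_eq_of_mem hu₀, he u₀ hu₀]; ring
    rw [e] at h
    have : a / 2 * (quartic u₀ * (‖v‖ ^ 2) ^ 2) ≤ a / 2 * (quartic v * (2 * ‖v‖ ^ 2 - 1)) := by
      linarith
    exact le_of_mul_le_mul_left this (by positivity)
  have hB : 0 < quartic u₀ := quartic_pos hu₀.1.1.1 (unitMass_ne_zero hu₀.1)
  have hBle : ∀ v ∈ nontrivialSolutions V a μ, quartic u₀ ≤ quartic v := by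
    intro v hv
    have h := hle v hv
    by_contra! hlt
    rcases le_or_gt (2 * ‖v‖ ^ 2 - 1) 0 with hm | hm
    · have h1 := mul_nonpos_of_nonneg_of_nonpos (quartic_nonneg v) hm
      have h2 : 0 < quartic u₀ * (‖v‖ ^ 2) ^ 2 := by
        have := norm_pos_iff.2 hv.1
        positivity
      linarith
    · have h1 : quartic v * (2 * ‖v‖ ^ 2 - 1) < quartic u₀ * (2 * ‖v‖ ^ 2 - 1) := by gcongr
      nlinarith [mul_nonneg hB.le (sq_nonneg (‖v‖ ^ 2 - 1))]
  have hnt : ∀ u ∈ minimizers V a, u ∈ nontrivialSolutions V a μ := fun u hu =>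
    ⟨unitMass_ne_zero hu.1, hsol u hu⟩
  refine ⟨hsol, Subset.antisymm (fun u hu => ⟨hnt u hu, fun v hv => ?_⟩) fun v hv => ?_⟩
  · rw [(hsol u hu).action_eq hV, hv.2.action_eq hV]
    have e : quartic u = quartic u₀ := by linarith [he u hu, he u₀ hu₀]
    rw [e]
    gcongr
    exact hBle v hv
  · have h1 := hv.2 u₀ (hnt u₀ hu₀)
    rw [(hsol u₀ hu₀).action_eq hV, hv.1.2.action_eq hV] at h1
    have h2 : quartic v = quartic u₀ :=
      le_antisymm (le_of_mul_le_mul_left h1 (by positivity)) (hBle v hv.1)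
    have h3 := hle v hv.1
    rw [h2] at h3
    -- With equal quartic terms the inequality reads $m^2\le2m-1$ for $m=\|v\|^2$.
    have h4 : (‖v‖ ^ 2 - 1) ^ 2 = 0 := by
      refine le_antisymm ?_ (sq_nonneg _)
      have := le_of_mul_le_mul_left h3 hB
      linarith
    have h5 : ‖v‖ ^ 2 = 1 := by
      have := pow_eq_zero_iff two_ne_zero |>.1 h4
      linarith
    have h6 : ‖v‖ = 1 := (pow_eq_one_iff_of_nonneg (norm_nonneg v) two_ne_zero).1 h5
    refine ⟨mem_unitMass_iff.2 ⟨hv.1.2.1, h6⟩, fun w hw => ?_⟩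
    have h7 := hv.1.2.quadEnergy_eq hV
    refine le_trans (le_of_eq ?_) (hu₀.2 w hw)
    rw [gpEnergy_eq, h7, h5, h2, hμ, groundEnergy_eq_of_mem hu₀, he u₀ hu₀]
    ring

/-- The linear case. -/
theorem IsTrappingPotential.minimizers_zero_eq (hV : IsTrappingPotential V)
    (hne : (minimizers V 0).Nonempty) (e' : ℝ) :
    (∀ u ∈ minimizers V 0, IsWeakSolution V 0 (groundEnergy V 0 + 0 * e') u) ∧
      minimizers V 0 = groundStates V 0 (groundEnergy V 0 + 0 * e') ∩ unitMass V := by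
  rw [zero_mul, add_zero]
  have hsol : ∀ u ∈ minimizers V 0, IsWeakSolution V 0 (groundEnergy V 0) u := by
    intro u hu
    have h := hV.isWeakSolution_of_mem_minimizers hu
    rw [groundEnergy_eq_of_mem hu]
    simpa using h
  obtain ⟨u₀, hu₀⟩ := hne
  refine ⟨hsol, Subset.antisymm (fun u hu => ⟨⟨⟨unitMass_ne_zero hu.1, hsol u hu⟩, fun v hv => ?_⟩,
    hu.1⟩) fun v hv => ⟨hv.2, fun w hw => ?_⟩⟩
  · rw [(hsol u hu).action_eq hV, hv.2.action_eq hV]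
    simp
  · refine le_trans (le_of_eq ?_) (hu₀.2 w hw)
    rw [gpEnergy_eq, hv.1.1.2.quadEnergy_eq hV, (mem_unitMass_iff.1 hv.2).2,
      groundEnergy_eq_of_mem hu₀]
    ring

/-! ### Differentiability of the ground state energy. -/

/-- A nonnegative minimizer is positive. -/
theorem IsTrappingPotential.ae_pos_of_mem_minimizers (hV : IsTrappingPotential V) {a : ℝ}
    (ha : 0 ≤ a) {u : L2} (hu : u ∈ minimizers V a) (hpos : ∀ᵐ x, 0 ≤ u x) :
    ∀ᵐ x, 0 < u x := by
  set μ := gpEnergy V a u - a / 2 * quartic u with hμ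
  have hsol := (isWeakSolution_iff hV hu.1.1).1 (hV.isWeakSolution_of_mem_minimizers hu)
  -- The sign of $\mu$ is unknown; adding $|\mu|u$ to both sides leaves $(|\mu|+\mu)u+au^3\ge0$ on
  -- the right.
  refine hV.ae_pos_of_supersolution hu.1.1 hpos (unitMass_ne_zero hu.1) (abs_nonneg μ)
    fun φ hφ hφ0 => ?_
  have h := hsol φ hφ
  have h1 : 0 ≤ (inner ℝ u φ : ℝ) := by
    rw [L2.inner_def]
    refine integral_nonneg_of_ae ?_
    filter_upwards [hpos, hφ0] with x hx hx'
    simp only [RCLike.inner_apply, conj_trivial, Pi.zero_apply]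
    positivity
  have h2 : 0 ≤ ∫ x, u x ^ 3 * φ x := by
    refine integral_nonneg_of_ae ?_
    filter_upwards [hpos, hφ0] with x hx hx'
    simp only [Pi.zero_apply]
    positivity
  have h3 : 0 ≤ (|μ| + μ) * inner ℝ u φ := mul_nonneg (by linarith [neg_abs_le μ]) h1
  have h4 : 0 ≤ a * ∫ x, u x ^ 3 * φ x := mul_nonneg ha h2
  rw [← hμ] at h
  linarith

/-- Continuity of the quartic term along positive minimizers, under uniqueness. -/
theorem IsTrappingPotential.tendsto_quartic_minimizers (hV : IsTrappingPotential V) {a b : ℝ}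
    (ha : 0 ≤ a) (hab : a < b) (hb : (minimizers V b).Nonempty)
    (hun : HasUniquePositiveMinimizer V a) {u : ℝ → L2}
    (hu : ∀ s ∈ Ico 0 b, u s ∈ minimizers V s ∧ ∀ᵐ x, 0 < u s x) :
    Tendsto (fun s => quartic (u s)) (𝓝[Ici 0] a) (𝓝 (quartic (u a))) := by
  rw [tendsto_iff_ultrafilter]
  intro U hU
  -- Staying below a midpoint keeps $b-s$ away from zero, so the minimizers near $a$ have uniformly
  -- bounded energy.
  set c : ℝ := (a + b) / 2 with hc
  have hac : a < c := by rw [hc]; linarith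
  have hcb : c < b := by rw [hc]; linarith
  have hsU : ∀ᶠ s in U, 0 ≤ s ∧ s < c := by
    refine hU ?_
    filter_upwards [self_mem_nhdsWithin, mem_nhdsWithin_of_mem_nhds (Iio_mem_nhds hac)]
      with s h1 h2
    exact ⟨h1, h2⟩
  have hsa : Tendsto (fun s : ℝ => s) U (𝓝 a) := hU.trans nhdsWithin_le_nhds
  have hmin : ∀ᶠ s in U, u s ∈ minimizers V s ∧ ∀ᵐ x, 0 < u s x :=
    hsU.mono fun s hs => hu s ⟨hs.1, hs.2.trans hcb⟩
  obtain ⟨u₀, hu₀⟩ := hV.minimizers_nonempty hb ha hab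
  obtain ⟨v, hv, hlim, hq, hlsc⟩ := hV.exists_limit U u
    (C := quadEnergy V u₀ + c * ((quadEnergy V u₀ - groundEnergy V b) / (b - c))) (by
    filter_upwards [hsU, hmin] with s hs hm
    refine ⟨hm.1.1, quadEnergy_le_of_gpEnergy_le hb hs.1 hs.2.le hcb hm.1.1 ?_⟩
    have h1 := hm.1.2 u₀ hu₀.1
    rw [gpEnergy_eq V s u₀] at h1
    have h2 : 0 ≤ s / 2 * quartic u₀ := mul_nonneg (by linarith [hs.1]) (quartic_nonneg _)
    linarith)
  have hvpos : ∀ᵐ x, 0 ≤ v x := by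
    have h0 : (0 : L2) ≤ v := by
      refine ge_of_tendsto hlim ?_
      filter_upwards [hmin] with s hs
      rw [← Lp.coeFn_nonneg]
      filter_upwards [hs.2] with x hx
      exact hx.le
    filter_upwards [(Lp.coeFn_nonneg v).2 h0] with x hx
    exact hx
  have hvmin : v ∈ minimizers V a := by
    refine ⟨hv, fun w hw => le_of_forall_pos_le_add fun ε hε => ?_⟩
    have hl : Tendsto (fun s => gpEnergy V s w + s / 2 * quartic (u s)) U
        (𝓝 (gpEnergy V a w + a / 2 * quartic v)) := by
      refine Tendsto.add ?_ ((hsa.div_const 2).mul hq)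
      simp only [gpEnergy_eq]
      exact ((hsa.div_const 2).mul_const _).const_sub _
    have := hlsc (gpEnergy V a w + a / 2 * quartic v + ε) (by
      filter_upwards [hl.eventually_lt_const (lt_add_of_pos_right _ hε), hmin] with s hs hm
      have h1 := hm.1.2 w hw
      rw [gpEnergy_eq V s (u s)] at h1
      linarith)
    rw [gpEnergy_eq V a v]
    linarith
  have hva : v = u a :=
    hun.unique ⟨hvmin, hV.ae_pos_of_mem_minimizers ha hvmin hvpos⟩ (hu a ⟨ha, hab⟩)
  rwa [← hva]

/-- The ground state energy is differentiable where positive minimizers are unique. -/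
theorem IsTrappingPotential.hasDerivWithinAt_groundEnergy (hV : IsTrappingPotential V) {a b : ℝ}
    (ha : 0 ≤ a) (hab : a < b) (hb : (minimizers V b).Nonempty)
    (hun : ∀ s ∈ Ico 0 b, HasUniquePositiveMinimizer V s) :
    ∃ e', HasDerivWithinAt (groundEnergy V) e' (Ici 0) a := by
  classical
  let u : ℝ → L2 := fun s => if h : s ∈ Ico 0 b then (hun s h).choose else 0
  have hu : ∀ s ∈ Ico 0 b, u s ∈ minimizers V s ∧ ∀ᵐ x, 0 < u s x := by
    intro s hs
    have : u s = (hun s hs).choose := dif_pos hs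
    rw [this]
    exact (hun s hs).choose_spec.1
  have hua := (hu a ⟨ha, hab⟩).1
  refine ⟨-(quartic (u a) / 2), hasDerivWithinAt_iff_tendsto_slope.2 ?_⟩
  have hcont := (hV.tendsto_quartic_minimizers ha hab hb (hun a ⟨ha, hab⟩) hu).mono_left
    (nhdsWithin_mono a (sdiff_subset (t := {a})))
  rw [tendsto_iff_norm_sub_tendsto_zero] at hcont ⊢
  refine tendsto_of_tendsto_of_tendsto_of_le_of_le' tendsto_const_nhds hcont
    (Eventually.of_forall fun s => norm_nonneg _) ?_
  filter_upwards [self_mem_nhdsWithin, mem_nhdsWithin_of_mem_nhds (Iio_mem_nhds hab)] with s hs hsb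
  have hus := (hu s ⟨hs.1, hsb⟩).1
  have hsa : s - a ≠ 0 := sub_ne_zero.2 hs.2
  -- Each minimizer competes at the other's parameter. The two inequalities bound the error of the
  -- difference quotient by $|B(u_s)-B(u_a)|$, on either side of $a$.
  have h1 := hus.2 (u a) hua.1
  have h2 := hua.2 (u s) hus.1
  rw [slope_def_field, groundEnergy_eq_of_mem hus, groundEnergy_eq_of_mem hua,
    Real.norm_eq_abs, Real.norm_eq_abs]
  rw [gpEnergy_eq, gpEnergy_eq] at h1 h2 ⊢
  set A := quadEnergy V (u s)
  set A' := quadEnergy V (u a)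
  set B := quartic (u s)
  set B' := quartic (u a)
  have e : (A - s / 2 * B - (A' - a / 2 * B')) / (s - a) - -(B' / 2)
      = (A - A' - s / 2 * (B - B')) / (s - a) := by
    field_simp
    ring
  rw [e, abs_div, div_le_iff₀ (abs_pos.2 hsa), ← abs_mul]
  have k1 : A - A' - s / 2 * (B - B') ≤ 0 := by linarith
  have k2 : -((B - B') * (s - a)) / 2 ≤ A - A' - s / 2 * (B - B') := by linarith
  rw [abs_of_nonpos k1]
  linarith [le_abs_self ((B - B') * (s - a)), abs_nonneg ((B - B') * (s - a))]

/-- If no parameter were admissible, the supremum would take its default value $0$, contradicting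
$0\le a<$ `aUpper V`. -/
theorem exists_minimizers_of_lt_aUpper {a : ℝ} (h0 : 0 ≤ a) (h : a < aUpper V) :
    ∃ b, a < b ∧ (minimizers V b).Nonempty := by
  have hne : {a : ℝ | 0 ≤ a ∧ (minimizers V a).Nonempty}.Nonempty := by
    rw [nonempty_iff_ne_empty]
    intro he
    rw [aUpper, he, Real.sSup_empty] at h
    linarith
  obtain ⟨b, hb, hab⟩ := exists_lt_of_lt_csSup hne h
  exact ⟨b, hab, hb.2⟩

theorem exists_unique_of_lt_aLower {a : ℝ} (h0 : 0 ≤ a) (h : a < aLower V) :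
    ∃ b, a < b ∧ (minimizers V b).Nonempty ∧ ∀ s ∈ Ico 0 b, HasUniquePositiveMinimizer V s := by
  have hne : {l : ℝ | 0 < l ∧ ∀ a ∈ Ico 0 l, HasUniquePositiveMinimizer V a}.Nonempty := by
    rw [nonempty_iff_ne_empty]
    intro he
    rw [aLower, he, Real.sSup_empty] at h
    linarith
  obtain ⟨l, hl, hal⟩ := exists_lt_of_lt_csSup hne h
  refine ⟨(a + l) / 2, by linarith, ?_, fun s hs => hl.2 s ⟨hs.1, by linarith [hs.2]⟩⟩
  obtain ⟨u, hu, -⟩ := hl.2 ((a + l) / 2) ⟨by linarith, by linarith⟩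
  exact ⟨u, hu.1⟩

/-- Each $E_a(v)$ decreases in $a$, and so does the infimum; attainment beyond the larger parameter
ensures that the infimum there is genuine. -/
theorem antitoneOn_groundEnergy : AntitoneOn (groundEnergy V) (Ico 0 (aUpper V)) := by
  intro s hs t ht hst
  obtain ⟨b, hb, hbm⟩ := exists_minimizers_of_lt_aUpper ht.1 ht.2
  refine le_csInf ((hbm.mono fun u hu => hu.1).image _) ?_
  rintro _ ⟨v, hv, rfl⟩
  refine (groundEnergy_le hbm hb.le hv).trans ?_
  rw [gpEnergy_eq, gpEnergy_eq]
  have := quartic_nonneg v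
  gcongr

/-- Lebesgue's theorem on monotone functions; on an open interval, differentiability within it is
full differentiability. -/
theorem ae_differentiableAt_groundEnergy :
    ∀ᵐ a : ℝ, a ∈ Ioo 0 (aUpper V) → DifferentiableAt ℝ (groundEnergy V) a := by
  have hanti : AntitoneOn (groundEnergy V) (Ioo 0 (aUpper V)) :=
    antitoneOn_groundEnergy.mono Ioo_subset_Ico_self
  have hm : MonotoneOn (fun a => -groundEnergy V a) (Ioo 0 (aUpper V)) := hanti.neg
  filter_upwards [hm.ae_differentiableWithinAt_of_mem] with a ha ham
  have := ((ha ham).differentiableAt (isOpen_Ioo.mem_nhds ham)).neg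
  simpa using this

end GroundStates

end GP

/-! ### Assembly of the main theorem. -/

theorem theorem1p1 (V : GP.Plane → ℝ) (hV : GP.IsTrappingPotential V) :
    let P : ℝ → Prop := fun a =>
      ∃ e' : ℝ, HasDerivWithinAt (GP.groundEnergy V) e' (Ici 0) a ∧
        (∀ u ∈ GP.minimizers V a,
          GP.IsWeakSolution V a (GP.groundEnergy V a + a * e') u) ∧
        (0 < a →
          GP.minimizers V a = GP.groundStates V a (GP.groundEnergy V a + a * e')) ∧
        (a = 0 →
          GP.minimizers V a =
            GP.groundStates V a (GP.groundEnergy V a + a * e') ∩ GP.unitMass V)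
    (∀ a ∈ Ico 0 (GP.aLower V), P a) ∧
      ∀ᵐ a : ℝ, a ∈ Ico (GP.aLower V) (GP.aUpper V) → P a := by
  intro P
  -- Both ranges of $a$ need only a derivative within $[0,\infty)$ and attainment at some larger
  -- parameter.
  have hP : ∀ a b e' : ℝ, 0 ≤ a → a < b → (GP.minimizers V b).Nonempty →
      HasDerivWithinAt (GP.groundEnergy V) e' (Ici 0) a → P a := by
    intro a b e' ha hab hb hd
    have hne := hV.minimizers_nonempty hb ha hab
    rcases ha.eq_or_lt with rfl | ha'
    · obtain ⟨h1, h2⟩ := hV.minimizers_zero_eq hne e'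
      exact ⟨e', hd, h1, fun h => absurd h (lt_irrefl _), fun _ => h2⟩
    · obtain ⟨h1, h2⟩ := hV.minimizers_eq_groundStates ha' hne
        fun u hu => GP.deriv_groundEnergy_eq ha' hab hb hd hu
      exact ⟨e', hd, h1, fun _ => h2, fun h => absurd h ha'.ne'⟩
  refine ⟨fun a ha => ?_, ?_⟩
  · obtain ⟨b, hab, hb, hun⟩ := GP.exists_unique_of_lt_aLower ha.1 ha.2
    obtain ⟨e', he'⟩ := hV.hasDerivWithinAt_groundEnergy ha.1 hab hb hun
    exact hP a b e' ha.1 hab hb he'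
  · have hL : 0 ≤ GP.aLower V := Real.sSup_nonneg fun l hl => hl.1.le
    filter_upwards [GP.ae_differentiableAt_groundEnergy (V := V),
      (Set.finite_singleton (0 : ℝ)).measure_zero volume |> measure_eq_zero_iff_ae_notMem.1]
      with a hda ha0 ha
    have ha' : 0 < a := lt_of_le_of_ne (hL.trans ha.1) fun h => ha0 h.symm
    obtain ⟨b, hab, hb⟩ := GP.exists_minimizers_of_lt_aUpper ha'.le ha.2
    exact hP a b _ ha'.le hab hb (hda ⟨ha', ha.2⟩).hasDerivAt.hasDerivWithinAt
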